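/- Let $N\ge 1$ be an integer and $a>0$ a real number. Let $p_0,\dots,p_{N-1}$ be the orthonormal polynomials for the Cauchy weight $w(x)=(1+x^2)^{-N-a}$ on $\mathbb R$, let $K_N(x,y)=[w(x)w(y)]^{1/2}\sum_{l=0}^{N-1}p_l(x)p_l(y)$ be the correlation kernel of the Cauchy unitary ensemble, let $R(x,y)$ be the kernel of the resolvent $K_N(1-K_N)^{-1}$ of the integral operator $K_N$ on $L^2(s,\infty)$, and put $\sigma(s)=(1+s^2)R(s,s)$ for $s\in\mathbb R$. The sixth Painlevé equation $P_{VI}(\alpha,\beta,\gamma,\delta)$ is $$\ddot\omega=\tfrac12\Big(\tfrac1\omega+\tfrac1{\omega-1}+\tfrac1{\omega-t}\Big)\dot\omega^2-\Big(\tfrac1t+\tfrac1{t-1}+\tfrac1{\omega-t}\Big)\dot\omega+\frac{\omega(\omega-1)(\omega-t)}{t^2(t-1)^2}\Big(\alpha+\frac{\beta t}{\omega^2}+\frac{\gamma(t-1)}{(\omega-1)^2}+\frac{\delta t(t-1)}{(\omega-t)^2}\Big).$$ A solution on a domain $U\subset\mathbb C\setminus\{0,1\}$ means a meromorphic function $\omega$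 on $U$, not identically $0$, $1$ or $t$, which satisfies the equation at all regular points, i.e. the points where $\omega$ is analytic and $\omega(t)\notin\{0,1,t\}$. Then there are a connected open set $U\subset\mathbb C\setminus\{0,1\}$ containing the line $\{\tfrac12(1-is):s\in\mathbb R\}$ and an analytic function $\eta$ on $U$ such that, for all $s\in\mathbb R$, $$t=\tfrac12(1-is),\qquad \eta(t)=\frac1{2i}\big(\sigma(s)-a^2s\big),$$ and the following hold. (i) There is a solution $\omega$ on $U$ of $P_{VI}$ with parameters $$\alpha=\tfrac12,\quad\beta=-\tfrac12(N+a)^2,\quad\gamma=\tfrac12(N+a)^2,\quad\delta=\tfrac12-2a^2,$$ such that at all regular points $t\in U$ $$\eta=\frac{t^2(t-1)^2}{4\omega(\omega-1)(\omega-t)}\Big\{\dot\omega-\frac{\omega(\omega-1)}{t(t-1)}\Big\}^2-\tfrac14(N+a)^2\frac{\omega-t}{\omega(\omega-1)}+\tfrac12a^2\Big(1-2t\,\frac{\omega-1}{\omega-t}\Big),$$ $$\dot\eta=-\frac{t(t-1)}{4\omega(\omega-1)}\Big\{\dot\omega-\frac{\omega(\omega-1)}{t(t-1)}\Big\}^2+\tfrac14(N+a)^2\frac{(\omega-t)^2}{t(t-1)\omega(\omega-1)}.$$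 (ii) The same function $\eta$ is obtained from each of the following parameter sets $(\alpha,\beta,\gamma,\delta)$ with $\alpha=\tfrac12\theta^2$: 1. $\theta=1$, $\beta=-\tfrac12(N+a)^2$, $\gamma=\tfrac12(N+a)^2$, $\delta=\tfrac12-2a^2$; 2. $\theta=1\pm2a$, $\beta=-\tfrac12(N+a)^2$, $\gamma=\tfrac12(N+a)^2$, $\delta=\tfrac12$; 3. $\theta=1\pm(N+2a)$, $\beta=-\tfrac12a^2$, $\gamma=\tfrac12a^2$, $\delta=\tfrac12(1-N^2)$; 4. $\theta=1\pm N$, $\beta=-\tfrac12a^2$, $\gamma=\tfrac12a^2$, $\delta=\tfrac12[1-(N+2a)^2]$ (with $N\ge2$ for the lower sign); 5. $\theta=1\pm(N+a)$, $\beta=0$, $\gamma=2a^2$, $\delta=\tfrac12[1-(N+a)^2]$; 6. $\theta=1\pm(N+a)$, $\beta=-2a^2$, $\gamma=0$, $\delta=\tfrac12[1-(N+a)^2]$; 7. $\theta=1\pm a$, $\beta=-\tfrac12N^2$, $\gamma=\tfrac12(N+2a)^2$, $\delta=\tfrac12(1-a^2)$; 8. $\theta=1\pm a$, $\beta=-\tfrac12(N+2a)^2$,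 $\gamma=\tfrac12N^2$, $\delta=\tfrac12(1-a^2)$; that is, for each of them, and each choice of sign, there is a solution $\omega$ on $U$ of $P_{VI}(\tfrac12\theta^2,\beta,\gamma,\delta)$ such that at all regular points $t\in U$ $$\eta=\frac{t^2(t-1)^2}{4\omega(\omega-1)(\omega-t)}\Big\{\dot\omega-\frac{\omega(\omega-1)}{t(t-1)}\Big\}^2+\tfrac18(1-\theta)^2(1-2\omega)-\tfrac\beta4\Big(1-\frac{2t}\omega\Big)-\tfrac\gamma4\Big(1-\frac{2(t-1)}{\omega-1}\Big)+\tfrac18(1-2\delta)\Big(1-\frac{2t(\omega-1)}{\omega-t}\Big),$$ $$\dot\eta=-\frac{t(t-1)}{4\omega(\omega-1)}\Big\{\dot\omega-\frac{\theta\,\omega(\omega-1)}{t(t-1)}\Big\}^2-\frac{\beta(\omega-t)}{2(t-1)\omega}-\frac{\gamma(\omega-t)}{2t(\omega-1)}.$$ -/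

import Mathlib

open scoped Polynomial

/-! ### Orthonormal polynomials of a weight on the line -/

/-- The bilinear form `∫ P(x) Q(x) w(x) dx` on real polynomials. -/
noncomputable def weightInner (w : ℝ → ℝ) (P Q : ℝ[X]) : ℝ :=
  ∫ x : ℝ, P.eval x * Q.eval x * w x

/-- The monic orthogonal polynomials of the weight `w` (Gram-Schmidt applied to `1, X, X², …`). -/
noncomputable def monicOrthoPoly (w : ℝ → ℝ) (n : ℕ) : ℝ[X] :=
  Polynomial.X ^ n - ∑ j : Fin n,
    Polynomial.C (weightInner w (Polynomial.X ^ n) (monicOrthoPoly w j) /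
      weightInner w (monicOrthoPoly w j) (monicOrthoPoly w j)) * monicOrthoPoly w j
termination_by n
decreasing_by all_goals exact j.2

/-- The orthonormal polynomials `p_n` of the weight `w`, with positive leading coefficient. -/
noncomputable def orthonormalPoly (w : ℝ → ℝ) (n : ℕ) : ℝ[X] :=
  Polynomial.C (1 / √(weightInner w (monicOrthoPoly w n) (monicOrthoPoly w n))) *
    monicOrthoPoly w n

/-! ### The Cauchy unitary ensemble and its resolvent kernel -/

/-- The Cauchy weight `(1 + x²)^(-N-a)`. -/
noncomputable def cauchyWeight (N : ℕ) (a x : ℝ) : ℝ :=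
  (1 + x ^ 2) ^ (-(N : ℝ) - a)

/-- The correlation kernel
`K_N(x,y) = (w(x) w(y))^(1/2) ∑_{l<N} p_l(x) p_l(y)` of the Cauchy unitary ensemble. -/
noncomputable def cauchyKernel (N : ℕ) (a x y : ℝ) : ℝ :=
  √(cauchyWeight N a x * cauchyWeight N a y) *
    ∑ l ∈ Finset.range N, (orthonormalPoly (cauchyWeight N a) l).eval x *
      (orthonormalPoly (cauchyWeight N a) l).eval y

/-- `R` is the kernel of the resolvent `K (1 - K)⁻¹`, where `K` is the integral operator on
`L²(I)` with kernel `K(x,y)`. The two equations are the pointwise form of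
`(1 - K)(1 + R) = 1 = (1 + R)(1 - K)`; they also give the values of `R` off `I`,
in particular at the endpoints of `I`, by continuous extension. -/
structure IsResolventKernel (I : Set ℝ) (K R : ℝ → ℝ → ℝ) : Prop where
  memLp_left : ∀ y, MeasureTheory.MemLp (fun z => R z y) 2 (MeasureTheory.volume.restrict I)
  memLp_right : ∀ x, MeasureTheory.MemLp (fun z => R x z) 2 (MeasureTheory.volume.restrict I)
  eq_left : ∀ x y, R x y = K x y + ∫ z in I, K x z * R z y
  eq_right : ∀ x y, R x y = K x y + ∫ z in I, R x z * K z y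

open Classical in
/-- The resolvent kernel `R(x,y)` of the kernel `K` on `I` (zero if there is none). -/
noncomputable def resolventKernel (I : Set ℝ) (K : ℝ → ℝ → ℝ) : ℝ → ℝ → ℝ :=
  if h : ∃ R, IsResolventKernel I K R then Classical.choose h else 0

/-- `σ(s) = (1 + s²) R(s,s)` for the Cauchy unitary ensemble on the interval `(s,∞)`. -/
noncomputable def cauchySigma (N : ℕ) (a s : ℝ) : ℝ :=
  (1 + s ^ 2) * resolventKernel (Set.Ioi s) (cauchyKernel N a) s s

/-! ### The sixth Painlevé equation -/

/-- The right-hand side of the sixth Painlevé equation `u'' = F(t, u, u')`. -/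
noncomputable def painleveVIRHS (α β γ δ t u du : ℂ) : ℂ :=
  1 / 2 * (1 / u + 1 / (u - 1) + 1 / (u - t)) * du ^ 2
    - (1 / t + 1 / (t - 1) + 1 / (u - t)) * du
    + u * (u - 1) * (u - t) / (t ^ 2 * (t - 1) ^ 2) *
      (α + β * t / u ^ 2 + γ * (t - 1) / (u - 1) ^ 2 + δ * t * (t - 1) / (u - t) ^ 2)

/-- `t` is a point at which `u` is analytic and does not take any of the values `0`, `1`, `t`
at which the sixth Painlevé equation is singular. -/
def IsRegularPoint (u : ℂ → ℂ) (t : ℂ) : Prop :=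
  AnalyticAt ℂ u t ∧ u t ≠ 0 ∧ u t ≠ 1 ∧ u t ≠ t

/-- `u` is a meromorphic solution of the sixth Painlevé equation on `U ⊆ ℂ ∖ {0, 1}`: all points
of `U` outside a discrete set are regular points, and the equation holds at each regular point. -/
structure IsPainleveVI (α β γ δ : ℂ) (U : Set ℂ) (u : ℂ → ℂ) : Prop where
  meromorphicOn : MeromorphicOn u U
  regular : ∀ᶠ t in Filter.codiscreteWithin U, IsRegularPoint u t
  equation : ∀ t ∈ U, IsRegularPoint u t →
    deriv (deriv u) t = painleveVIRHS α β γ δ t (u t) (deriv u t)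

/-- `η` on `U` is related, through the general Bäcklund formulas for the Painlevé-VI sigma
function, to a sixth Painlevé transcendent `u` with parameters `(θ² / 2, β, γ, δ)`; here `θ` is
the square root of `2 α` that is used in the formulas. -/
def IsPainleveVIRelated (U : Set ℂ) (η : ℂ → ℂ) (θ β γ δ : ℂ) : Prop :=
  ∃ u : ℂ → ℂ, IsPainleveVI (θ ^ 2 / 2) β γ δ U u ∧
    ∀ t ∈ U, IsRegularPoint u t →
      η t = t ^ 2 * (t - 1) ^ 2 / (4 * u t * (u t - 1) * (u t - t)) *
            (deriv u t - u t * (u t - 1) / (t * (t - 1))) ^ 2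
          + (1 - θ) ^ 2 / 8 * (1 - 2 * u t)
          - β / 4 * (1 - 2 * t / u t)
          - γ / 4 * (1 - 2 * (t - 1) / (u t - 1))
          + (1 - 2 * δ) / 8 * (1 - 2 * t * (u t - 1) / (u t - t)) ∧
      deriv η t = -(t * (t - 1) / (4 * u t * (u t - 1))) *
            (deriv u t - θ * u t * (u t - 1) / (t * (t - 1))) ^ 2
          - β * (u t - t) / (2 * (t - 1) * u t)
          - γ * (u t - t) / (2 * t * (u t - 1))

/-- The gauge variable `t = (1 - i s) / 2`. -/
noncomputable def gaugePoint (s : ℝ) : ℂ := (1 - Complex.I * (s : ℂ)) / 2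

/-!
The proof has two independent halves, joined by the substitution `t = (1 - i s) / 2`.

*The equation for `σ`.* Put `N = n + 1`. The correlation kernel has rank `N`, so its resolvent on
`(s, ∞)` is explicit: with `v(x) = (1, x, …, xⁿ)` and `H(s)` the Hankel matrix of the moments
`∫_{-∞}^s x^k w(x) dx`, it is `√(w x) √(w y) v(x)ᵀ H(s)⁻¹ v(y)`
(`IsMomentWeight.resolventKernel_eq`). Hence `σ(s) = (1 + s²) w(s) v(s)ᵀ H(s)⁻¹ v(s)`, which is
positive, and which continues analytically to a neighbourhood of the line, because the moments
continue to the strip `|Im z| < 1` and `H(s)` is positive definite for real `s`. Let `e` be the last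
coordinate vector, `M` the matrix of multiplication by `x` modulo the orthogonal polynomial of
degree `N`, and `X` that of the operator `(1 + x²) d/dx - n x`. The Pearson equation of `w` becomes
`Xᵀ H + H X = 2 a H M + (1 + s²) w v vᵀ`, while `[X, M] = 1 + M² - r eᵀ` for an explicit vector `r`
that the symmetry of `H M` expresses through `H⁻¹ v` and `H⁻¹ e`. Together with two traces these
relations make `σ`, `σ'`, `σ''` polynomials in a few scalar products, and eliminating the products
leaves a second order equation of second degree (`IsCauchyMoments.sigma_equation`).

*The Painlevé transcendent.* For `η(t) = (σ(s) - a² s) / (2i)` the equation is the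
Jimbo-Miwa-Okamoto sigma form `SigmaForm b₁ b₂ b₃ b₄ η` for every choice of `b₁, …, b₄` that is,
up to order and signs, `N + a, a, a, 0` (`sigmaForm_gaugedSigma`). Given any solution `η` of the sigma
form, the Painlevé function `u` is a root of a quadratic equation with coefficients polynomial in
`t, η, η'`, whose discriminant is a perfect square `((b₃ + b₄) t² (t - 1)² η'')²`; so `u` is rational
in `t, η, η', η''`, hence meromorphic. Differentiating the two algebraic relations that define `u`
and its conjugate momentum gives the Hamiltonian system, therefore the Painlevé equation and the
Bäcklund formulas, with `θ = 1 + b₃ + b₄`, `β = -(b₁ + b₂)² / 2`, `γ = (b₁ - b₂)² / 2`,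
`δ = (1 - (b₃ - b₄)²) / 2` (`isPainleveVIRelated_of_sigmaForm`). The eight parameter sets are eight
distributions of the numbers `±(N + a), ±a, ±a, 0` over `b₁, …, b₄`.

The construction needs `η'' ≢ 0` and, only when `b₃ + b₄ = -1`, that the leading coefficient of the
quadratic does not vanish identically. If `σ'' ≡ 0`, then `σ` would be affine and positive, so
constant, against the equation. The value `b₃ + b₄ = -1` occurs for `θ = 1 - 2a` at `a = 1/2`, where
vanishing would give `(1 + s²) σ' = -σ² + s σ - N (N + 1)`, which has no positive solution on the
line (`not_pos_of_riccati_le`), and for `θ = 1 - a` at `a = 1`, where the leading coefficient has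
imaginary part `±(N + 1) σ / 2` on the line.
-/

/-! ### Algebra of the Painlevé VI Hamiltonian system -/

section HamiltonianAlgebra

/-- If `τ²` is the stated polynomial, the pair `(u, r)` given by `u = 2 (b² - k² p) / D` and the
matching `r` lies on the line `k r = a u - b` and on the conic `r² = -e u² - c u + p`. The first
relation determines `r` when `k ≠ 0`; the explicit formula for `r` also covers `k = 0`, where the
conic would give it only up to sign. -/
theorem quadratic_root_relations {a b c e p k τ D u r : ℂ}
    (hτ : τ ^ 2 = -4 * a * b * c + 4 * a ^ 2 * p - 4 * e * b ^ 2 + k ^ 2 * (c ^ 2 + 4 * e * p))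
    (hD : D = 2 * a * b - k ^ 2 * c + k * τ) (hD0 : D ≠ 0)
    (hu : u = 2 * (b ^ 2 - k ^ 2 * p) / D)
    (hr : r = (-b * τ + k * (b * c - 2 * a * p)) / D) :
    k * r = a * u - b ∧ r ^ 2 = -e * u ^ 2 - c * u + p ∧
      -τ * u = 2 * b * r + k * (2 * p - u * c) := by
  have hu' : u * D = 2 * (b ^ 2 - k ^ 2 * p) := by rw [hu]; field_simp
  have hr' : r * D = -b * τ + k * (b * c - 2 * a * p) := by rw [hr]; field_simp
  refine ⟨?_, ?_, ?_⟩
  · apply mul_right_cancel₀ hD0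
    linear_combination k * hr' - a * hu' + b * hD
  · apply mul_right_cancel₀ (pow_ne_zero 2 hD0)
    have h1 : (r * D) ^ 2 = -e * (u * D) ^ 2 - c * (u * D) * D + p * D ^ 2 := by
      rw [hr', hu', hD]
      linear_combination (b ^ 2 - k ^ 2 * p) * hτ
    linear_combination h1
  · apply mul_right_cancel₀ hD0
    linear_combination -τ * hu' - 2 * b * hr' + k * c * hu' - 2 * k * p * hD

/-- The Hamiltonian system, where `Df` stands for `t (t - 1) f'` and `τ` for `t² (t - 1)² η''`.
Differentiating the line and the conic gives two linear equations for `Du` and `Dr`, whose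
determinant is `-τ`; their solution is the pair of first order equations below, the second of which
is the sixth Painlevé equation after `r` has been eliminated with the first. -/
theorem hamiltonian_flow {t η x τ u r Du Dr b₁ b₂ b₃ b₄ : ℂ}
    (ht0 : t ≠ 0) (ht1 : t ≠ 1) (hu0 : u ≠ 0) (hu1 : u ≠ 1) (hut : u ≠ t) (hτ : τ ≠ 0)
    {a b c e p : ℂ}
    (ha : a = η - b₁ * b₂ / 2 + b₃ * b₄ * (1 - 2 * t) / 2)
    (hb : b = t * (η - b₁ * b₂ / 2 - (t - 1) * x - b₃ * b₄ / 2))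
    (hc : c = -(t * (t - 1) * x) + (b₁ + b₂) ^ 2 / 4 * (t + t ^ 2)
      - (b₁ - b₂) ^ 2 / 4 * (t * (t - 1)))
    (he : e = t * (t - 1) * x - (b₁ + b₂) ^ 2 * t / 4 + (b₁ - b₂) ^ 2 * (t - 1) / 4)
    (hp : p = (b₁ + b₂) ^ 2 * t ^ 2 / 4)
    (h4 : (b₃ + b₄) * r = a * u - b) (h2 : r ^ 2 = -e * u ^ 2 - c * u + p)
    (h5 : -τ * u = 2 * b * r + (b₃ + b₄) * (2 * p - u * c))
    {Da Db Dc De Dp : ℂ}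
    (hDa : Da = t * (t - 1) * (x - b₃ * b₄))
    (hDb : Db = t * (t - 1) * (η - (b₁ * b₂ + b₃ * b₄) / 2) - (t - 1) * (t * (t - 1) * x) - τ)
    (hDc : Dc = -((2 * t - 1) * (t * (t - 1) * x)) - τ +
      t * (t - 1) * ((b₁ + b₂) ^ 2 / 4 * (1 + 2 * t) - (b₁ - b₂) ^ 2 / 4 * (2 * t - 1)))
    (hDe : De = (2 * t - 1) * (t * (t - 1) * x) + τ -
      t * (t - 1) * ((b₁ + b₂) ^ 2 / 4 - (b₁ - b₂) ^ 2 / 4))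
    (hDp : Dp = t * (t - 1) * ((b₁ + b₂) ^ 2 * t / 2))
    (hd4 : (b₃ + b₄) * Dr = a * Du + u * Da - Db)
    (hd2 : 2 * r * Dr = -e * (2 * u * Du) - De * u ^ 2 - (c * Du + Dc * u) + Dp) :
    Du = 2 * r + (b₃ + b₄ + 1) * u * (u - 1) ∧
    2 * Dr + (b₃ + b₄ + 1) * (2 * u - 1) * Du =
      1 / 2 * (1 / u + 1 / (u - 1) + 1 / (u - t)) * Du ^ 2 - t * (t - 1) / (u - t) * Du
      + u * (u - 1) * (u - t) * ((1 + b₃ + b₄) ^ 2 / 2 + -(b₁ + b₂) ^ 2 / 2 * t / u ^ 2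
        + (b₁ - b₂) ^ 2 / 2 * (t - 1) / (u - 1) ^ 2
        + (1 - (b₃ - b₄) ^ 2) / 2 * t * (t - 1) / (u - t) ^ 2) := by
  have hu1' : u - 1 ≠ 0 := sub_ne_zero.2 hu1
  have hut' : u - t ≠ 0 := sub_ne_zero.2 hut
  have ht1' : t - 1 ≠ 0 := sub_ne_zero.2 ht1
  -- the determinant of the linear system for `Du`, `Dr`
  have hJ : 2 * r * a + (b₃ + b₄) * (2 * e * u + c) = -τ := by
    apply mul_right_cancel₀ hu0
    linear_combination (-2 * r) * h4 + 2 * (b₃ + b₄) * h2 - h5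
  have hDu : Du = 2 * r + (b₃ + b₄ + 1) * u * (u - 1) := by
    apply mul_left_cancel₀ hτ
    have h1 : τ * Du = 2 * r * (u * Da - Db) - (b₃ + b₄) * (Dp - De * u ^ 2 - Dc * u) := by
      linear_combination Du * hJ + (2 * r) * hd4 - (b₃ + b₄) * hd2
    rw [h1, hDa, hDb, hDp, hDe, hDc]
    rw [ha, hb] at h4
    rw [he, hc, hp] at h2
    rw [hb, hp, hc] at h5
    linear_combination (-2 * r * t) * h4 + 2 * (b₃ + b₄) * t * h2 + (u - 1) * h5
  refine ⟨hDu, ?_⟩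
  -- now `η`, `η'` and `τ` are rational functions of `t`, `u`, `r`
  have hx : x = ((b₁ + b₂) ^ 2 / 4 * t * (u - t) * (u - 1)
      - (b₁ - b₂) ^ 2 / 4 * (t - 1) * (u - t) * u - r ^ 2) / (t * (t - 1) * (u * (u - 1))) := by
    rw [h2, he, hc, hp]; field_simp; ring
  have hη : η = b₁ * b₂ / 2 + b₃ * b₄ / 2 + ((b₃ + b₄) * r - t * (t - 1) * x
      + u * (t - 1) * (b₃ * b₄)) / (u - t) := by
    rw [h4, ha, hb]; field_simp; ring
  have hτ' : τ = -(2 * b * r + (b₃ + b₄) * (2 * p - u * c)) / u := by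
    rw [← h5]; field_simp
  generalize hr1 : (1 / 2 * (1 / u + 1 / (u - 1) + 1 / (u - t)) * Du ^ 2
      - t * (t - 1) / (u - t) * Du
      + u * (u - 1) * (u - t) * ((1 + b₃ + b₄) ^ 2 / 2 + -(b₁ + b₂) ^ 2 / 2 * t / u ^ 2
        + (b₁ - b₂) ^ 2 / 2 * (t - 1) / (u - 1) ^ 2
        + (1 - (b₃ - b₄) ^ 2) / 2 * t * (t - 1) / (u - t) ^ 2)) = y
  have e1 : (b₃ + b₄) * (y - (b₃ + b₄ + 1) * (2 * u - 1) * Du) = 2 * (a * Du + u * Da - Db) := by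
    rw [← hr1, hDu, hDa, hDb, hτ', ha, hp, hc, hb, hη, hx]
    field_simp
    ring
  have e2 : r * (y - (b₃ + b₄ + 1) * (2 * u - 1) * Du) =
      -e * (2 * u * Du) - De * u ^ 2 - (c * Du + Dc * u) + Dp := by
    rw [← hr1, hDu, hDe, hDc, hDp, hτ', he, hp, hc, hb, hη, hx]
    field_simp
    ring
  by_cases hk : b₃ + b₄ = 0
  · have hr : r ≠ 0 := by
      rintro rfl
      rw [hk] at hJ
      apply hτ
      linear_combination hJ
    apply mul_left_cancel₀ hr
    linear_combination hd2 - e2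
  · apply mul_left_cancel₀ hk
    linear_combination 2 * hd4 - e1

/-- The Bäcklund formulas: `η` and `x = η'` in terms of `u` and `u'`. -/
theorem backlund_formulas {t η x u r du b₁ b₂ b₃ b₄ : ℂ}
    (ht0 : t ≠ 0) (ht1 : t ≠ 1) (hu0 : u ≠ 0) (hu1 : u ≠ 1) (hut : u ≠ t)
    {a b c e p : ℂ}
    (ha : a = η - b₁ * b₂ / 2 + b₃ * b₄ * (1 - 2 * t) / 2)
    (hb : b = t * (η - b₁ * b₂ / 2 - (t - 1) * x - b₃ * b₄ / 2))
    (hc : c = -(t * (t - 1) * x) + (b₁ + b₂) ^ 2 / 4 * (t + t ^ 2)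
      - (b₁ - b₂) ^ 2 / 4 * (t * (t - 1)))
    (he : e = t * (t - 1) * x - (b₁ + b₂) ^ 2 * t / 4 + (b₁ - b₂) ^ 2 * (t - 1) / 4)
    (hp : p = (b₁ + b₂) ^ 2 * t ^ 2 / 4)
    (h4 : (b₃ + b₄) * r = a * u - b) (h2 : r ^ 2 = -e * u ^ 2 - c * u + p)
    (hdu : t * (t - 1) * du = 2 * r + (b₃ + b₄ + 1) * u * (u - 1)) :
    η = t ^ 2 * (t - 1) ^ 2 / (4 * u * (u - 1) * (u - t)) *
            (du - u * (u - 1) / (t * (t - 1))) ^ 2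
          + (1 - (1 + b₃ + b₄)) ^ 2 / 8 * (1 - 2 * u)
          - -(b₁ + b₂) ^ 2 / 2 / 4 * (1 - 2 * t / u)
          - (b₁ - b₂) ^ 2 / 2 / 4 * (1 - 2 * (t - 1) / (u - 1))
          + (1 - 2 * ((1 - (b₃ - b₄) ^ 2) / 2)) / 8 * (1 - 2 * t * (u - 1) / (u - t)) ∧
      x = -(t * (t - 1) / (4 * u * (u - 1))) *
            (du - (1 + b₃ + b₄) * u * (u - 1) / (t * (t - 1))) ^ 2
          - -(b₁ + b₂) ^ 2 / 2 * (u - t) / (2 * (t - 1) * u)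
          - (b₁ - b₂) ^ 2 / 2 * (u - t) / (2 * t * (u - 1)) := by
  have hu1' : u - 1 ≠ 0 := sub_ne_zero.2 hu1
  have hut' : u - t ≠ 0 := sub_ne_zero.2 hut
  have ht1' : t - 1 ≠ 0 := sub_ne_zero.2 ht1
  have hx : x = ((b₁ + b₂) ^ 2 / 4 * t * (u - t) * (u - 1)
      - (b₁ - b₂) ^ 2 / 4 * (t - 1) * (u - t) * u - r ^ 2) / (t * (t - 1) * (u * (u - 1))) := by
    rw [h2, he, hc, hp]; field_simp; ring
  have hη : η = b₁ * b₂ / 2 + b₃ * b₄ / 2 + ((b₃ + b₄) * r - t * (t - 1) * x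
      + u * (t - 1) * (b₃ * b₄)) / (u - t) := by
    rw [h4, ha, hb]; field_simp; ring
  have hdu' : du = (2 * r + (b₃ + b₄ + 1) * u * (u - 1)) / (t * (t - 1)) := by
    rw [← hdu]; field_simp
  constructor
  · rw [hη, hx, hdu']; field_simp; ring
  · rw [hx, hdu']; field_simp; ring

end HamiltonianAlgebra

/-! ### Identities that hold off a discrete set -/

section OffDiscrete
open Filter Topology

theorem eq_of_eventually_codiscreteWithin {U : Set ℂ} (hU : IsOpen U) {f g : ℂ → ℂ}
    (h : ∀ᶠ t in codiscreteWithin U, f t = g t) {t : ℂ} (ht : t ∈ U)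
    (hf : ContinuousAt f t) (hg : ContinuousAt g t) : f t = g t := by
  have h1 := mem_codiscreteWithin_iff_forall_mem_nhdsNE.1 h t ht
  have h2 : ∀ᶠ z in 𝓝[≠] t, z ∈ U := eventually_nhdsWithin_of_eventually_nhds (hU.mem_nhds ht)
  have h3 : f =ᶠ[𝓝[≠] t] g := by
    filter_upwards [h1, h2] with z hz hzU
    rcases hz with hz | hz
    · exact hz
    · exact absurd hzU hz
  exact ((hf.eventuallyEq_nhds_iff_eventuallyEq_nhdsNE hg).1 h3).eq_of_nhds

theorem AnalyticOnNhd.not_eqOn_zero_mul {U : Set ℂ} (hU : IsPreconnected U) {f g : ℂ → ℂ}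
    (hf : AnalyticOnNhd ℂ f U) (hg : AnalyticOnNhd ℂ g U) (hf0 : ¬ ∀ t ∈ U, f t = 0)
    (hg0 : ¬ ∀ t ∈ U, g t = 0) : ¬ ∀ t ∈ U, f t * g t = 0 := fun h =>
  (hf.eq_zero_or_eq_zero_of_mul_eq_zero hg h hU).elim hf0 hg0

theorem not_eqOn_const_of_hasDerivAt {U : Set ℂ} (hU : IsOpen U) {g g' : ℂ → ℂ}
    (hd : ∀ t ∈ U, HasDerivAt g (g' t) t) (hg' : ¬ ∀ t ∈ U, g' t = 0) (c : ℂ) :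
    ¬ ∀ t ∈ U, g t - c = 0 := fun h => hg' fun t ht => by
  have h1 : g =ᶠ[𝓝 t] fun _ => c := by
    filter_upwards [hU.mem_nhds ht] with z hz using sub_eq_zero.1 (h z hz)
  exact ((hd t ht).congr_of_eventuallyEq h1.symm).unique (hasDerivAt_const t c)

/-- It is enough to verify the Painlevé equation and the Bäcklund formulas off a discrete set: at
the remaining regular points they follow by continuity. -/
theorem isPainleveVIRelated_of_codiscrete {U : Set ℂ} (hU : IsOpen U) (h0 : (0 : ℂ) ∉ U)
    (h1 : (1 : ℂ) ∉ U) {η u : ℂ → ℂ} (hη : AnalyticOnNhd ℂ η U) {θ β γ δ : ℂ}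
    (hu : MeromorphicOn u U)
    (hreg : ∀ᶠ t in codiscreteWithin U, IsRegularPoint u t)
    (heq : ∀ᶠ t in codiscreteWithin U,
      deriv (deriv u) t = painleveVIRHS (θ ^ 2 / 2) β γ δ t (u t) (deriv u t))
    (hf : ∀ᶠ t in codiscreteWithin U,
      η t = t ^ 2 * (t - 1) ^ 2 / (4 * u t * (u t - 1) * (u t - t)) *
            (deriv u t - u t * (u t - 1) / (t * (t - 1))) ^ 2
          + (1 - θ) ^ 2 / 8 * (1 - 2 * u t)
          - β / 4 * (1 - 2 * t / u t)
          - γ / 4 * (1 - 2 * (t - 1) / (u t - 1))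
          + (1 - 2 * δ) / 8 * (1 - 2 * t * (u t - 1) / (u t - t)) ∧
      deriv η t = -(t * (t - 1) / (4 * u t * (u t - 1))) *
            (deriv u t - θ * u t * (u t - 1) / (t * (t - 1))) ^ 2
          - β * (u t - t) / (2 * (t - 1) * u t)
          - γ * (u t - t) / (2 * t * (u t - 1))) :
    IsPainleveVIRelated U η θ β γ δ := by
  have key : ∀ t ∈ U, IsRegularPoint u t → t ≠ 0 ∧ t - 1 ≠ 0 ∧ u t ≠ 0 ∧ u t - 1 ≠ 0 ∧
      u t - t ≠ 0 ∧ ContinuousAt u t ∧ ContinuousAt (deriv u) t ∧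
      ContinuousAt (deriv (deriv u)) t := by
    rintro t ht ⟨ha, hu0, hu1, hut⟩
    refine ⟨?_, ?_, hu0, sub_ne_zero.2 hu1, sub_ne_zero.2 hut, ha.continuousAt,
      ha.deriv.continuousAt, ha.deriv.deriv.continuousAt⟩
    · rintro rfl; exact h0 ht
    · intro h; exact h1 (sub_eq_zero.1 h ▸ ht)
  refine ⟨u, ⟨hu, hreg, fun t ht hr => ?_⟩, fun t ht hr => ⟨?_, ?_⟩⟩
  all_goals obtain ⟨ht0, ht1, hu0, hu1, hut, hc, hc1, hc2⟩ := key t ht hr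
  · refine eq_of_eventually_codiscreteWithin hU
      (g := fun t => painleveVIRHS (θ ^ 2 / 2) β γ δ t (u t) (deriv u t)) heq ht hc2 ?_
    unfold painleveVIRHS
    fun_prop (disch := simp [*])
  · refine eq_of_eventually_codiscreteWithin hU (hf.mono fun t h => h.1) ht
      (hη t ht).continuousAt ?_
    fun_prop (disch := simp [*])
  · refine eq_of_eventually_codiscreteWithin hU (hf.mono fun t h => h.2) ht
      (hη t ht).deriv.continuousAt ?_
    fun_prop (disch := simp [*])

end OffDiscrete

/-! ### The Jimbo-Miwa-Okamoto sigma form and the transcendent it determines -/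

section SigmaFormCoefficients

section
variable (b₁ b₂ b₃ b₄ : ℂ) (η : ℂ → ℂ) (t : ℂ)

/-- The slope in the line `(b₃ + b₄) r = linCoeff * u - linConst` on which the Painlevé function `u`
and its momentum `r` lie. -/
noncomputable def linCoeff : ℂ := η t - b₁ * b₂ / 2 + b₃ * b₄ * (1 - 2 * t) / 2

/-- The constant term in the line `(b₃ + b₄) r = linCoeff * u - linConst`. -/
noncomputable def linConst : ℂ := t * (η t - b₁ * b₂ / 2 - (t - 1) * deriv η t - b₃ * b₄ / 2)

/-- The linear coefficient, up to sign, in the conic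
`r² = -quadCoeff * u² - midCoeff * u + (b₁ + b₂)² t² / 4`. -/
noncomputable def midCoeff : ℂ :=
  -(t * (t - 1) * deriv η t) + (b₁ + b₂) ^ 2 / 4 * (t + t ^ 2) - (b₁ - b₂) ^ 2 / 4 * (t * (t - 1))

/-- The quadratic coefficient, up to sign, in the conic
`r² = -quadCoeff * u² - midCoeff * u + (b₁ + b₂)² t² / 4`. -/
noncomputable def quadCoeff : ℂ :=
  t * (t - 1) * deriv η t - (b₁ + b₂) ^ 2 * t / 4 + (b₁ - b₂) ^ 2 * (t - 1) / 4

/-- The second derivative in the scale of the sigma form, `t² (t - 1)² η''`. -/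
noncomputable def scaledSecond : ℂ := t * (t - 1) * (t * (t - 1) * deriv (deriv η) t)

/-- The leading coefficient of the quadratic equation for `u` that results from eliminating `r`
between the line and the conic. -/
noncomputable def leadQuad : ℂ :=
  linCoeff b₁ b₂ b₃ b₄ η t ^ 2 + (b₃ + b₄) ^ 2 * quadCoeff b₁ b₂ η t

/-- The constant coefficient of the quadratic equation for `u` that results from eliminating `r`
between the line and the conic. -/
noncomputable def constQuad : ℂ :=
  linConst b₁ b₂ b₃ b₄ η t ^ 2 - (b₃ + b₄) ^ 2 * ((b₁ + b₂) ^ 2 * t ^ 2 / 4)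

/-- The denominator in the root `2 C / (-B + √(B² - 4 A C))` of the quadratic equation
`A u² + B u + C = 0` for `u`; on solutions of the sigma form the square root is
`(b₃ + b₄) t² (t - 1)² η''`. -/
noncomputable def rootDen : ℂ :=
  2 * linCoeff b₁ b₂ b₃ b₄ η t * linConst b₁ b₂ b₃ b₄ η t - (b₃ + b₄) ^ 2 * midCoeff b₁ b₂ η t
    + (b₃ + b₄) * scaledSecond η t

/-- The Painlevé function `u` attached to a solution `η` of the sigma form. The root is written with
`constQuad` in the numerator, so that `leadQuad` may vanish; for `b₃ + b₄ = 0` it is the double root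
`linConst / linCoeff`. -/
noncomputable def transcendent : ℂ :=
  2 * constQuad b₁ b₂ b₃ b₄ η t / rootDen b₁ b₂ b₃ b₄ η t

/-- The momentum variable `r`, for which `t (t - 1) u' = 2 r + (b₃ + b₄ + 1) u (u - 1)`. -/
noncomputable def auxMomentum : ℂ :=
  (-linConst b₁ b₂ b₃ b₄ η t * scaledSecond η t + (b₃ + b₄) *
    (linConst b₁ b₂ b₃ b₄ η t * midCoeff b₁ b₂ η t
      - 2 * linCoeff b₁ b₂ b₃ b₄ η t * ((b₁ + b₂) ^ 2 * t ^ 2 / 4))) / rootDen b₁ b₂ b₃ b₄ η t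

/-- The Jimbo-Miwa-Okamoto sigma form of the sixth Painlevé equation with parameters
`b₁, b₂, b₃, b₄`. It is the equation
`η' (t (t - 1) η'')² + (η' (2 η - (2 t - 1) η') - b₁ b₂ b₃ b₄)² = ∏ (η' + b_j²)`
divided by `η'`. -/
def SigmaForm : Prop :=
  (t * (t - 1) * deriv (deriv η) t) ^ 2
      + deriv η t * (2 * η t - (2 * t - 1) * deriv η t) ^ 2
      - 2 * (b₁ * b₂ * b₃ * b₄) * (2 * η t - (2 * t - 1) * deriv η t) =
    deriv η t ^ 3 + (b₁ ^ 2 + b₂ ^ 2 + b₃ ^ 2 + b₄ ^ 2) * deriv η t ^ 2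
      + (b₁ ^ 2 * b₂ ^ 2 + b₁ ^ 2 * b₃ ^ 2 + b₁ ^ 2 * b₄ ^ 2 + b₂ ^ 2 * b₃ ^ 2 + b₂ ^ 2 * b₄ ^ 2
        + b₃ ^ 2 * b₄ ^ 2) * deriv η t
      + (b₁ ^ 2 * b₂ ^ 2 * b₃ ^ 2 + b₁ ^ 2 * b₂ ^ 2 * b₄ ^ 2 + b₁ ^ 2 * b₃ ^ 2 * b₄ ^ 2
        + b₂ ^ 2 * b₃ ^ 2 * b₄ ^ 2)
end

variable {b₁ b₂ b₃ b₄ : ℂ} {η : ℂ → ℂ} {U : Set ℂ}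

theorem SigmaForm.scaledSecond_sq {t : ℂ} (h : SigmaForm b₁ b₂ b₃ b₄ η t) :
    scaledSecond η t ^ 2 =
      -4 * linCoeff b₁ b₂ b₃ b₄ η t * linConst b₁ b₂ b₃ b₄ η t * midCoeff b₁ b₂ η t
      + 4 * linCoeff b₁ b₂ b₃ b₄ η t ^ 2 * ((b₁ + b₂) ^ 2 * t ^ 2 / 4)
      - 4 * quadCoeff b₁ b₂ η t * linConst b₁ b₂ b₃ b₄ η t ^ 2
      + (b₃ + b₄) ^ 2 * (midCoeff b₁ b₂ η t ^ 2
        + 4 * quadCoeff b₁ b₂ η t * ((b₁ + b₂) ^ 2 * t ^ 2 / 4)) := by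
  unfold SigmaForm at h
  unfold scaledSecond linCoeff linConst midCoeff quadCoeff
  generalize η t = y at *
  generalize deriv η t = x at *
  generalize deriv (deriv η) t = z at *
  linear_combination (t * (t - 1)) ^ 2 * h

/-- The discriminant of the quadratic equation for `u` is the square of
`(b₃ + b₄) * scaledSecond`, so that the product of its outer coefficients factors. -/
theorem SigmaForm.discriminant {t : ℂ} (h : SigmaForm b₁ b₂ b₃ b₄ η t) :
    4 * (leadQuad b₁ b₂ b₃ b₄ η t * constQuad b₁ b₂ b₃ b₄ η t) =
      rootDen b₁ b₂ b₃ b₄ η t *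
        (rootDen b₁ b₂ b₃ b₄ η t - 2 * (b₃ + b₄) * scaledSecond η t) := by
  have := h.scaledSecond_sq
  unfold leadQuad constQuad rootDen
  linear_combination (b₃ + b₄) ^ 2 * this

theorem SigmaForm.relations {t : ℂ} (h : SigmaForm b₁ b₂ b₃ b₄ η t)
    (hD : rootDen b₁ b₂ b₃ b₄ η t ≠ 0) :
    (b₃ + b₄) * auxMomentum b₁ b₂ b₃ b₄ η t =
      linCoeff b₁ b₂ b₃ b₄ η t * transcendent b₁ b₂ b₃ b₄ η t - linConst b₁ b₂ b₃ b₄ η t ∧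
    auxMomentum b₁ b₂ b₃ b₄ η t ^ 2 =
      -quadCoeff b₁ b₂ η t * transcendent b₁ b₂ b₃ b₄ η t ^ 2
      - midCoeff b₁ b₂ η t * transcendent b₁ b₂ b₃ b₄ η t + (b₁ + b₂) ^ 2 * t ^ 2 / 4 ∧
    -scaledSecond η t * transcendent b₁ b₂ b₃ b₄ η t =
      2 * linConst b₁ b₂ b₃ b₄ η t * auxMomentum b₁ b₂ b₃ b₄ η t + (b₃ + b₄) *
        (2 * ((b₁ + b₂) ^ 2 * t ^ 2 / 4) -
          transcendent b₁ b₂ b₃ b₄ η t * midCoeff b₁ b₂ η t) :=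
  quadratic_root_relations h.scaledSecond_sq rfl hD rfl rfl

section deriv
variable {t : ℂ} (hη : AnalyticAt ℂ η t)
include hη

theorem hasDerivAt_linCoeff :
    HasDerivAt (linCoeff b₁ b₂ b₃ b₄ η) (deriv η t - b₃ * b₄) t := by
  have h0 := hη.differentiableAt.hasDerivAt
  unfold linCoeff
  refine HasDerivAt.congr_deriv ((h0.sub_const (b₁ * b₂ / 2)).add
    ((((hasDerivAt_id t).const_mul 2).const_sub 1).const_mul (b₃ * b₄) |>.div_const 2)) ?_
  simp
  ring

theorem hasDerivAt_linConst :
    HasDerivAt (linConst b₁ b₂ b₃ b₄ η) (η t - (b₁ * b₂ + b₃ * b₄) / 2 - (t - 1) * deriv η t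
      - t * (t - 1) * deriv (deriv η) t) t := by
  have h0 := hη.differentiableAt.hasDerivAt
  have h1 := hη.deriv.differentiableAt.hasDerivAt
  unfold linConst
  refine HasDerivAt.congr_deriv ((hasDerivAt_id t).mul (((h0.sub_const (b₁ * b₂ / 2)).sub
    (((hasDerivAt_id t).sub_const 1).mul h1)).sub_const (b₃ * b₄ / 2))) ?_
  simp
  ring

theorem hasDerivAt_midCoeff :
    HasDerivAt (midCoeff b₁ b₂ η) (-((2 * t - 1) * deriv η t) - t * (t - 1) * deriv (deriv η) t +
      ((b₁ + b₂) ^ 2 / 4 * (1 + 2 * t) - (b₁ - b₂) ^ 2 / 4 * (2 * t - 1))) t := by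
  have h1 := hη.deriv.differentiableAt.hasDerivAt
  have hi := hasDerivAt_id t
  unfold midCoeff
  refine HasDerivAt.congr_deriv (((((hi.mul (hi.sub_const 1)).mul h1).neg).add
    ((hi.add (hi.pow 2)).const_mul ((b₁ + b₂) ^ 2 / 4))).sub
    ((hi.mul (hi.sub_const 1)).const_mul ((b₁ - b₂) ^ 2 / 4))) ?_
  simp
  ring

theorem hasDerivAt_quadCoeff :
    HasDerivAt (quadCoeff b₁ b₂ η) ((2 * t - 1) * deriv η t + t * (t - 1) * deriv (deriv η) t -
      ((b₁ + b₂) ^ 2 / 4 - (b₁ - b₂) ^ 2 / 4)) t := by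
  have h1 := hη.deriv.differentiableAt.hasDerivAt
  have hi := hasDerivAt_id t
  unfold quadCoeff
  refine HasDerivAt.congr_deriv ((((hi.mul (hi.sub_const 1)).mul h1).sub
    ((hi.const_mul ((b₁ + b₂) ^ 2)).div_const 4)).add
    (((hi.sub_const 1).const_mul ((b₁ - b₂) ^ 2)).div_const 4)) ?_
  simp
  ring

theorem analyticAt_coeffs :
    AnalyticAt ℂ (linCoeff b₁ b₂ b₃ b₄ η) t ∧ AnalyticAt ℂ (linConst b₁ b₂ b₃ b₄ η) t ∧
    AnalyticAt ℂ (midCoeff b₁ b₂ η) t ∧ AnalyticAt ℂ (quadCoeff b₁ b₂ η) t ∧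
    AnalyticAt ℂ (scaledSecond η) t := by
  have h1 := hη.deriv
  have h2 := hη.deriv.deriv
  unfold linCoeff linConst midCoeff quadCoeff scaledSecond
  refine ⟨?_, ?_, ?_, ?_, ?_⟩ <;> fun_prop (disch := norm_num)

theorem analyticAt_quads :
    AnalyticAt ℂ (leadQuad b₁ b₂ b₃ b₄ η) t ∧ AnalyticAt ℂ (constQuad b₁ b₂ b₃ b₄ η) t ∧
    AnalyticAt ℂ (rootDen b₁ b₂ b₃ b₄ η) t := by
  obtain ⟨h1, h2, h3, h4, h5⟩ := analyticAt_coeffs (b₁ := b₁) (b₂ := b₂) (b₃ := b₃) (b₄ := b₄) hη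
  unfold leadQuad constQuad rootDen
  refine ⟨?_, ?_, ?_⟩ <;> fun_prop (disch := norm_num)

end deriv

end SigmaFormCoefficients

/-! ### From the sigma form to the sixth Painlevé equation -/

section Transcendent
open Filter Topology

variable {b₁ b₂ b₃ b₄ : ℂ} {η : ℂ → ℂ} {U : Set ℂ}

theorem not_eqOn_zero_two_values {U : Set ℂ} (hU : IsOpen U) (hc : IsPreconnected U)
    {g g' : ℂ → ℂ} (hg : AnalyticOnNhd ℂ g U) (hd : ∀ t ∈ U, HasDerivAt g (g' t) t)
    (hg' : ¬ ∀ t ∈ U, g' t = 0) (c d : ℂ) : ¬ ∀ t ∈ U, (g t - c) * (g t - d) = 0 :=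
  AnalyticOnNhd.not_eqOn_zero_mul hc (hg.sub analyticOnNhd_const) (hg.sub analyticOnNhd_const)
    (not_eqOn_const_of_hasDerivAt hU hd hg' c) (not_eqOn_const_of_hasDerivAt hU hd hg' d)

/-- The derivative of `η - (t - e) η'` is `-(t - e) η''`, so this function is not constant. -/
theorem not_eqOn_zero_clairaut (hU : IsOpen U) (hc : IsPreconnected U)
    (hη : AnalyticOnNhd ℂ η U) {e : ℂ} (he : e ∉ U) (hT : ∃ t ∈ U, deriv (deriv η) t ≠ 0)
    (c d : ℂ) :
    ¬ ∀ t ∈ U, (η t - (t - e) * deriv η t - c) * (η t - (t - e) * deriv η t - d) = 0 := by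
  refine not_eqOn_zero_two_values hU hc (g := fun t => η t - (t - e) * deriv η t)
    (g' := fun t => -(t - e) * deriv (deriv η) t) ?_ (fun t ht => ?_) ?_ c d
  · intro t ht
    have h0 := hη t ht
    have h1 := h0.deriv
    fun_prop
  · have h0 := (hη t ht).differentiableAt.hasDerivAt
    have h1 := (hη t ht).deriv.differentiableAt.hasDerivAt
    refine HasDerivAt.congr_deriv (h0.sub (((hasDerivAt_id t).sub_const e).mul h1)) ?_
    simp
    ring
  · rintro h
    obtain ⟨t, ht, hT⟩ := hT
    rcases mul_eq_zero.1 (h t ht) with h | h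
    · exact he (by rwa [← sub_eq_zero.1 (neg_eq_zero.1 h)])
    · exact hT h

theorem not_eqOn_zero_constQuad (hU : IsOpen U) (hc : IsPreconnected U) (h0 : (0 : ℂ) ∉ U)
    (h1 : (1 : ℂ) ∉ U) (hη : AnalyticOnNhd ℂ η U) (hT : ∃ t ∈ U, deriv (deriv η) t ≠ 0) :
    ¬ ∀ t ∈ U, constQuad b₁ b₂ b₃ b₄ η t = 0 := fun h => by
  refine not_eqOn_zero_clairaut hU hc hη h1 hT
    ((b₁ * b₂ + b₃ * b₄) / 2 + (b₃ + b₄) * (b₁ + b₂) / 2)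
    ((b₁ * b₂ + b₃ * b₄) / 2 - (b₃ + b₄) * (b₁ + b₂) / 2) fun t ht => ?_
  have ht0 : t ≠ 0 := fun h => h0 (h ▸ ht)
  have := h t ht
  unfold constQuad linConst at this
  apply mul_left_cancel₀ (pow_ne_zero 2 ht0)
  linear_combination this

/-- The value of the quadratic polynomial at `u = 1` does not vanish identically. -/
theorem not_eqOn_zero_valueOne (hU : IsOpen U) (hc : IsPreconnected U) (h0 : (0 : ℂ) ∉ U)
    (h1 : (1 : ℂ) ∉ U) (hη : AnalyticOnNhd ℂ η U) (hT : ∃ t ∈ U, deriv (deriv η) t ≠ 0) :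
    ¬ ∀ t ∈ U, leadQuad b₁ b₂ b₃ b₄ η t + constQuad b₁ b₂ b₃ b₄ η t
      + ((b₃ + b₄) ^ 2 * midCoeff b₁ b₂ η t
        - 2 * linCoeff b₁ b₂ b₃ b₄ η t * linConst b₁ b₂ b₃ b₄ η t) = 0 := fun h => by
  refine not_eqOn_zero_clairaut hU hc hη h0 hT
    ((b₁ * b₂ - b₃ * b₄) / 2 + (b₃ + b₄) * (b₁ - b₂) / 2)
    ((b₁ * b₂ - b₃ * b₄) / 2 - (b₃ + b₄) * (b₁ - b₂) / 2) fun t ht => ?_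
  have ht0 : t - 1 ≠ 0 := fun h => h1 (sub_eq_zero.1 h ▸ ht)
  have := h t ht
  unfold leadQuad constQuad linConst linCoeff quadCoeff midCoeff at this
  apply mul_left_cancel₀ (pow_ne_zero 2 ht0)
  linear_combination this

/-- The value of the quadratic polynomial at `u = t`, divided by `t² (t - 1)²`, does not vanish
identically. -/
theorem not_eqOn_zero_valueSelf (hU : IsOpen U) (hc : IsPreconnected U)
    (hη : AnalyticOnNhd ℂ η U) (hT : ∃ t ∈ U, deriv (deriv η) t ≠ 0) :
    ¬ ∀ t ∈ U, (deriv η t + b₃ ^ 2) * (deriv η t + b₄ ^ 2) = 0 := fun h => by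
  refine not_eqOn_zero_two_values hU hc hη.deriv
    (fun t ht => (hη t ht).deriv.differentiableAt.hasDerivAt) (by push Not; exact hT)
    (-b₃ ^ 2) (-b₄ ^ 2) fun t ht => ?_
  linear_combination h t ht

/-- The denominator of `transcendent` does not vanish identically: otherwise the discriminant
identity forces `leadQuad ≡ 0`, and differentiating that makes
`(b₃ + b₄) (b₃ + b₄ + 1) η''` vanish; if `b₃ + b₄ = 0`, then `linCoeff`
vanishes and `η'` is constant. -/
theorem not_eqOn_zero_rootDen (hU : IsOpen U) (hc : IsPreconnected U) (h0 : (0 : ℂ) ∉ U)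
    (h1 : (1 : ℂ) ∉ U) (hη : AnalyticOnNhd ℂ η U) (hT : ∃ t ∈ U, deriv (deriv η) t ≠ 0)
    (hE : ∀ t ∈ U, SigmaForm b₁ b₂ b₃ b₄ η t)
    (hk : b₃ + b₄ ≠ -1 ∨ ∃ t ∈ U, leadQuad b₁ b₂ b₃ b₄ η t ≠ 0) :
    ¬ ∀ t ∈ U, rootDen b₁ b₂ b₃ b₄ η t = 0 := fun hD => by
  have hA : ∀ t ∈ U, leadQuad b₁ b₂ b₃ b₄ η t = 0 := by
    by_contra hA
    refine AnalyticOnNhd.not_eqOn_zero_mul hc (fun t ht => (analyticAt_quads (hη t ht)).1)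
      (fun t ht => (analyticAt_quads (hη t ht)).2.1) hA
      (not_eqOn_zero_constQuad (b₁ := b₁) (b₂ := b₂) (b₃ := b₃) (b₄ := b₄) hU hc h0 h1 hη hT)
      fun t ht => ?_
    have := (hE t ht).discriminant
    rw [hD t ht] at this
    linear_combination this / 4
  have hk : b₃ + b₄ ≠ -1 := by
    rcases hk with hk | ⟨t, ht, hk⟩
    · exact hk
    · exact absurd (hA t ht) hk
  have hA' : ∀ t ∈ U, 2 * linCoeff b₁ b₂ b₃ b₄ η t * (deriv η t - b₃ * b₄) + (b₃ + b₄) ^ 2 *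
      ((2 * t - 1) * deriv η t + t * (t - 1) * deriv (deriv η) t -
      ((b₁ + b₂) ^ 2 / 4 - (b₁ - b₂) ^ 2 / 4)) = 0 := fun t ht => by
    have hd : HasDerivAt (leadQuad b₁ b₂ b₃ b₄ η) _ t :=
      ((hasDerivAt_linCoeff (hη t ht)).pow 2).add
        ((hasDerivAt_quadCoeff (hη t ht)).const_mul ((b₃ + b₄) ^ 2))
    have hz : leadQuad b₁ b₂ b₃ b₄ η =ᶠ[𝓝 t] fun _ => 0 := by
      filter_upwards [hU.mem_nhds ht] with z hz using hA z hz
    have := (hd.congr_of_eventuallyEq hz.symm).unique (hasDerivAt_const t 0)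
    simpa using this
  obtain ⟨t, ht, hTt⟩ := hT
  have ht0 : t ≠ 0 := fun h => h0 (h ▸ ht)
  have ht1 : t - 1 ≠ 0 := fun h => h1 (sub_eq_zero.1 h ▸ ht)
  have hprod :
      (b₃ + b₄) * (b₃ + b₄ + 1) * (t * (t - 1) * (t * (t - 1) * deriv (deriv η) t)) = 0 := by
    have e1 := hA' t ht
    have e2 := hA t ht
    have e3 := hD t ht
    unfold rootDen scaledSecond midCoeff linConst at e3
    unfold leadQuad quadCoeff at e2
    unfold linCoeff at e1 e2 e3
    linear_combination e3 + t * (t - 1) * e1 - 2 * t * e2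
  have hk0 : b₃ + b₄ = 0 := by
    by_contra hk0
    have : b₃ + b₄ + 1 ≠ 0 := fun h => hk (by linear_combination h)
    simp_all
  have ha : ∀ t ∈ U, linCoeff b₁ b₂ b₃ b₄ η t = 0 := fun t ht => by
    have := hA t ht
    unfold leadQuad at this
    rw [hk0] at this
    simpa using this
  have hx : ∀ t ∈ U, deriv η t - b₃ * b₄ = 0 := fun t ht => by
    have hz : linCoeff b₁ b₂ b₃ b₄ η =ᶠ[𝓝 t] fun _ => 0 := by
      filter_upwards [hU.mem_nhds ht] with z hz using ha z hz
    exact ((hasDerivAt_linCoeff (hη t ht)).congr_of_eventuallyEq hz.symm).unique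
      (hasDerivAt_const t 0)
  refine not_eqOn_const_of_hasDerivAt hU
    (fun t ht => (hη t ht).deriv.differentiableAt.hasDerivAt) ?_ (b₃ * b₄) hx
  push Not
  exact ⟨t, ht, hTt⟩

/-- A solution of the sigma form with `η'' ≢ 0` comes from a sixth Painlevé transcendent. -/
theorem isPainleveVIRelated_of_sigmaForm (hU : IsOpen U) (hc : IsPreconnected U)
    (h0 : (0 : ℂ) ∉ U) (h1 : (1 : ℂ) ∉ U) (hη : AnalyticOnNhd ℂ η U)
    (hT : ∃ t ∈ U, deriv (deriv η) t ≠ 0)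
    (hE : ∀ t ∈ U, SigmaForm b₁ b₂ b₃ b₄ η t)
    (hk : b₃ + b₄ ≠ -1 ∨ ∃ t ∈ U, leadQuad b₁ b₂ b₃ b₄ η t ≠ 0) :
    IsPainleveVIRelated U η (1 + b₃ + b₄) (-(b₁ + b₂) ^ 2 / 2) ((b₁ - b₂) ^ 2 / 2)
      ((1 - (b₃ - b₄) ^ 2) / 2) := by
  have han := fun t ht => analyticAt_coeffs (b₁ := b₁) (b₂ := b₂) (b₃ := b₃) (b₄ := b₄) (hη t ht)
  have haq := fun t ht => analyticAt_quads (b₁ := b₁) (b₂ := b₂) (b₃ := b₃) (b₄ := b₄) (hη t ht)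
  have codisc : ∀ f : ℂ → ℂ, AnalyticOnNhd ℂ f U → (¬ ∀ t ∈ U, f t = 0) →
      ∀ᶠ t in codiscreteWithin U, f t ≠ 0 := fun f hf hf0 =>
    (hf.eqOn_zero_or_eventually_ne_zero_of_preconnected hc).resolve_left hf0
  set u := transcendent b₁ b₂ b₃ b₄ η with hu
  set r := auxMomentum b₁ b₂ b₃ b₄ η with hr
  -- the set of good points
  set V : Set ℂ := {t | t ∈ U ∧ deriv (deriv η) t ≠ 0 ∧ rootDen b₁ b₂ b₃ b₄ η t ≠ 0 ∧
    u t ≠ 0 ∧ u t ≠ 1 ∧ u t ≠ t} with hVdef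
  have hV : V ∈ codiscreteWithin U := by
    filter_upwards [self_mem_codiscreteWithin U,
      codisc _ hη.deriv.deriv (by push Not; exact hT),
      codisc _ (fun t ht => (haq t ht).2.2) (not_eqOn_zero_rootDen hU hc h0 h1 hη hT hE hk),
      codisc _ (fun t ht => (haq t ht).2.1) (not_eqOn_zero_constQuad hU hc h0 h1 hη hT),
      codisc _ (fun t ht => by
        obtain ⟨h1, h2, h3, h4, h5⟩ := han t ht
        obtain ⟨h6, h7, h8⟩ := haq t ht
        fun_prop) (not_eqOn_zero_valueOne (b₁ := b₁) (b₂ := b₂) (b₃ := b₃) (b₄ := b₄)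
          hU hc h0 h1 hη hT),
      codisc _ (fun t ht => by
        have := (hη t ht).deriv
        fun_prop) (not_eqOn_zero_valueSelf (b₃ := b₃) (b₄ := b₄) hU hc hη hT)]
      with t ht hT hD hC hv1 hvt
    obtain ⟨r4, r2, -⟩ := (hE t ht).relations hD
    refine ⟨ht, hT, hD, div_ne_zero (mul_ne_zero two_ne_zero hC) hD, fun h => hv1 ?_,
      fun h => hvt ?_⟩
    · rw [← hu, h] at r4 r2
      unfold leadQuad constQuad
      linear_combination (-(b₃ + b₄) * auxMomentum b₁ b₂ b₃ b₄ η t - (linCoeff b₁ b₂ b₃ b₄ η t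
        - linConst b₁ b₂ b₃ b₄ η t)) * r4 + (b₃ + b₄) ^ 2 * r2
    · have ht0 : t ≠ 0 := fun h => h0 (h ▸ ht)
      have ht1 : t - 1 ≠ 0 := fun h => h1 (sub_eq_zero.1 h ▸ ht)
      apply mul_left_cancel₀ (pow_ne_zero 2 (mul_ne_zero ht0 ht1))
      rw [← hu, h] at r4 r2
      generalize auxMomentum b₁ b₂ b₃ b₄ η t = y at r4 r2
      unfold linCoeff linConst at r4
      unfold quadCoeff midCoeff at r2
      linear_combination (-(b₃ + b₄) * y - t * (t - 1) * (deriv η t - b₃ * b₄)) * r4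
        + (b₃ + b₄) ^ 2 * r2
  have huV : ∀ t ∈ V, AnalyticAt ℂ u t := fun t ht =>
    (analyticAt_const.mul (haq t ht.1).2.1).div (haq t ht.1).2.2 ht.2.2.1
  have hrV : ∀ t ∈ V, AnalyticAt ℂ r t := fun t ht => by
    obtain ⟨h1, h2, h3, h4, h5⟩ := han t ht.1
    refine AnalyticAt.div ?_ (haq t ht.1).2.2 ht.2.2.1
    fun_prop (disch := norm_num)
  have hVo : ∀ t ∈ V, V ∈ 𝓝 t := fun t ht => by
    have hcu := (huV t ht).continuousAt
    filter_upwards [hU.mem_nhds ht.1, (hη t ht.1).deriv.deriv.continuousAt.eventually_ne ht.2.1,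
      (haq t ht.1).2.2.continuousAt.eventually_ne ht.2.2.1, hcu.eventually_ne ht.2.2.2.1,
      hcu.eventually_ne ht.2.2.2.2.1,
      (hcu.sub continuousAt_id).eventually_ne (sub_ne_zero.2 ht.2.2.2.2.2)] with z h1 h2 h3 h4 h5 h6
    exact ⟨h1, h2, h3, h4, h5, sub_ne_zero.1 h6⟩
  have hrel := fun t (ht : t ∈ V) => (hE t ht.1).relations ht.2.2.1
  -- the Hamiltonian flow on `V`
  have hflow : ∀ t ∈ V, t * (t - 1) * deriv u t = 2 * r t + (b₃ + b₄ + 1) * u t * (u t - 1) ∧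
      2 * (t * (t - 1) * deriv r t) + (b₃ + b₄ + 1) * (2 * u t - 1) * (t * (t - 1) * deriv u t) =
      1 / 2 * (1 / u t + 1 / (u t - 1) + 1 / (u t - t)) * (t * (t - 1) * deriv u t) ^ 2
      - t * (t - 1) / (u t - t) * (t * (t - 1) * deriv u t)
      + u t * (u t - 1) * (u t - t) * ((1 + b₃ + b₄) ^ 2 / 2 + -(b₁ + b₂) ^ 2 / 2 * t / u t ^ 2
        + (b₁ - b₂) ^ 2 / 2 * (t - 1) / (u t - 1) ^ 2
        + (1 - (b₃ - b₄) ^ 2) / 2 * t * (t - 1) / (u t - t) ^ 2) := fun t ht => by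
    have ht0 : t ≠ 0 := fun h => h0 (h ▸ ht.1)
    have ht1 : t ≠ 1 := fun h => h1 (h ▸ ht.1)
    have ht1' := sub_ne_zero.2 ht1
    obtain ⟨r4, r2, r5⟩ := hrel t ht
    have hdu := (huV t ht).differentiableAt.hasDerivAt
    have hdr := (hrV t ht).differentiableAt.hasDerivAt
    have da := hasDerivAt_linCoeff (b₁ := b₁) (b₂ := b₂) (b₃ := b₃) (b₄ := b₄) (hη t ht.1)
    have db := hasDerivAt_linConst (b₁ := b₁) (b₂ := b₂) (b₃ := b₃) (b₄ := b₄) (hη t ht.1)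
    have dc := hasDerivAt_midCoeff (b₁ := b₁) (b₂ := b₂) (hη t ht.1)
    have de := hasDerivAt_quadCoeff (b₁ := b₁) (b₂ := b₂) (hη t ht.1)
    have d4 := (hdr.const_mul (b₃ + b₄)).unique (((da.mul hdu).sub db).congr_of_eventuallyEq
      (by filter_upwards [hVo t ht] with z hz using (hrel z hz).1))
    have d2 := (hdr.pow 2).unique ((((de.neg.mul (hdu.pow 2)).sub (dc.mul hdu)).add
      ((((hasDerivAt_id t).pow 2).const_mul ((b₁ + b₂) ^ 2)).div_const 4)).congr_of_eventuallyEq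
      (by filter_upwards [hVo t ht] with z hz using (hrel z hz).2.1))
    simp at d4 d2
    exact hamiltonian_flow (x := deriv η t) (τ := scaledSecond η t)
      (a := linCoeff b₁ b₂ b₃ b₄ η t) (b := linConst b₁ b₂ b₃ b₄ η t) (c := midCoeff b₁ b₂ η t)
      (e := quadCoeff b₁ b₂ η t) (p := (b₁ + b₂) ^ 2 * t ^ 2 / 4) ht0 ht1
      ht.2.2.2.1 ht.2.2.2.2.1 ht.2.2.2.2.2
      (mul_ne_zero (mul_ne_zero ht0 ht1') (mul_ne_zero (mul_ne_zero ht0 ht1') ht.2.1))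
      rfl rfl rfl rfl rfl r4 r2 r5 rfl rfl rfl rfl rfl
      (by unfold scaledSecond; linear_combination t * (t - 1) * d4)
      (by unfold scaledSecond; linear_combination t * (t - 1) * d2)
  refine isPainleveVIRelated_of_codiscrete hU h0 h1 hη (u := u) (fun t ht => ?_)
    (mem_of_superset hV fun t ht => ⟨huV t ht, ht.2.2.2⟩) (mem_of_superset hV fun t ht => ?_)
    (mem_of_superset hV fun t ht => ?_)
  · exact (analyticAt_const.mul (haq t ht).2.1).meromorphicAt.div (haq t ht).2.2.meromorphicAt
  · have ht0 : t ≠ 0 := fun h => h0 (h ▸ ht.1)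
    have ht1 : t ≠ 1 := fun h => h1 (h ▸ ht.1)
    have ht1' := sub_ne_zero.2 ht1
    have hu0 := ht.2.2.2.1
    have hu1 := sub_ne_zero.2 ht.2.2.2.2.1
    have hut := sub_ne_zero.2 ht.2.2.2.2.2
    have hdu := (huV t ht).differentiableAt.hasDerivAt
    have hddu := (huV t ht).deriv.differentiableAt.hasDerivAt
    have hdr := (hrV t ht).differentiableAt.hasDerivAt
    have hi := hasDerivAt_id t
    have d1 := ((hi.mul (hi.sub_const 1)).mul hddu).unique
      (((hdr.const_mul 2).add ((hdu.const_mul (b₃ + b₄ + 1)).mul (hdu.sub_const 1))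
        ).congr_of_eventuallyEq
        (by filter_upwards [hVo t ht] with z hz using (hflow z hz).1))
    simp at d1
    have h2 := (hflow t ht).2
    have key : (t * (t - 1)) ^ 2 * deriv (deriv u) t =
        2 * (t * (t - 1) * deriv r t)
        + (b₃ + b₄ + 1) * (2 * u t - 1) * (t * (t - 1) * deriv u t)
        - t * (t - 1) * (2 * t - 1) * deriv u t := by
      linear_combination t * (t - 1) * d1
    rw [h2] at key
    have key' : deriv (deriv u) t =
      (1 / 2 * (1 / u t + 1 / (u t - 1) + 1 / (u t - t)) * (t * (t - 1) * deriv u t) ^ 2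
      - t * (t - 1) / (u t - t) * (t * (t - 1) * deriv u t)
      + u t * (u t - 1) * (u t - t) * ((1 + b₃ + b₄) ^ 2 / 2 + -(b₁ + b₂) ^ 2 / 2 * t / u t ^ 2
        + (b₁ - b₂) ^ 2 / 2 * (t - 1) / (u t - 1) ^ 2
        + (1 - (b₃ - b₄) ^ 2) / 2 * t * (t - 1) / (u t - t) ^ 2)
        - t * (t - 1) * (2 * t - 1) * deriv u t) / (t * (t - 1)) ^ 2 := by
      rw [← key]; field_simp
    show _ = _
    rw [key']
    unfold painleveVIRHS
    field_simp
    ring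
  · exact backlund_formulas (fun h => h0 (h ▸ ht.1)) (fun h => h1 (h ▸ ht.1)) ht.2.2.2.1
      ht.2.2.2.2.1 ht.2.2.2.2.2 rfl rfl rfl rfl rfl (hrel t ht).1 (hrel t ht).2.1 (hflow t ht).1

end Transcendent

/-! ### Multiplication and rotation on polynomials of bounded degree -/

section PolynomialMatrices
open Matrix

section shift
variable (n : ℕ)

/-- Multiplication by `x` on polynomials of degree at most `n` in the monomial basis, with
`x * xⁿ` replaced by `0`. -/
def shiftMatrix : Matrix (Fin (n + 1)) (Fin (n + 1)) ℂ :=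
  of fun i j => if (i : ℕ) = j + 1 then 1 else 0

/-- The operator `(1 + x²) d/dx - n x` on polynomials of degree at most `n`, in the monomial basis:
the infinitesimal generator of rotations of the projective line. -/
def rotationMatrix : Matrix (Fin (n + 1)) (Fin (n + 1)) ℂ :=
  of fun i j => if (i : ℕ) + 1 = j then (j : ℂ) else if (i : ℕ) = j + 1 then (j : ℂ) - n else 0

/-- The last coordinate vector, which reads off the coefficient of `xⁿ`. -/
def leadVec : Fin (n + 1) → ℂ := Pi.single (Fin.last n) 1

/-- The vector `(1, s, …, sⁿ)`, which evaluates polynomials at `s`. -/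
def powVec (s : ℂ) : Fin (n + 1) → ℂ := fun i => s ^ (i : ℕ)

/-- Multiplication by `x` modulo the monic polynomial `x^(n+1) - ∑ q_i x^i`. -/
def compMatrix (q : Fin (n + 1) → ℂ) : Matrix (Fin (n + 1)) (Fin (n + 1)) ℂ :=
  shiftMatrix n + vecMulVec q (leadVec n)

variable {n}

theorem sum_ite_val_eq (f : Fin (n + 1) → ℂ) (m : ℕ) :
    ∑ k : Fin (n + 1), (if (k : ℕ) = m then f k else 0) =
      if h : m < n + 1 then f ⟨m, h⟩ else 0 := by
  split_ifs with h
  · rw [Finset.sum_eq_single ⟨m, h⟩]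
    · simp
    · intro b _ hb
      rw [if_neg]
      rintro rfl
      exact hb rfl
    · simp
  · refine Finset.sum_eq_zero fun k _ => if_neg ?_
    have := k.2
    omega

theorem sum_ite_val_add_one_eq (f : Fin (n + 1) → ℂ) (m : ℕ) (hm : m < n + 2) :
    ∑ k : Fin (n + 1), (if m = (k : ℕ) + 1 then f k else 0) =
      if h : 0 < m then f ⟨m - 1, by omega⟩ else 0 := by
  split_ifs with h
  · rw [Finset.sum_eq_single ⟨m - 1, by omega⟩]
    · rw [if_pos]; simp; omega
    · intro b _ hb
      rw [if_neg]
      rintro rfl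
      exact hb (by simp)
    · simp
  · refine Finset.sum_eq_zero fun k _ => if_neg ?_
    omega

theorem powVec_vecMul_shift (s : ℂ) :
    powVec n s ᵥ* shiftMatrix n = s • powVec n s - s ^ (n + 1) • leadVec n := by
  ext j
  simp only [vecMul, dotProduct, shiftMatrix, powVec, of_apply, mul_ite, mul_one, mul_zero,
    sum_ite_val_eq, Pi.sub_apply, Pi.smul_apply, smul_eq_mul, leadVec]
  have := j.2
  split_ifs with h
  · rw [Pi.single_eq_of_ne (by rintro rfl; simp at h)]
    ring
  · have : j = Fin.last n := by ext; simp; omega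
    subst this
    simp
    ring

theorem powVec_vecMul_rotation (s : ℂ) (j : Fin (n + 1)) :
    (powVec n s ᵥ* rotationMatrix n) j + n * s * s ^ (j : ℕ) =
      (1 + s ^ 2) * ((j : ℂ) * s ^ ((j : ℕ) - 1)) := by
  have hx : ∀ i : Fin (n + 1), powVec n s i * rotationMatrix n i j =
      (if (j : ℕ) = i + 1 then s ^ (i : ℕ) * (j : ℂ) else 0) +
      (if (i : ℕ) = j + 1 then s ^ (i : ℕ) * ((j : ℂ) - n) else 0) := fun i => by
    simp only [powVec, rotationMatrix, of_apply]
    split_ifs <;> first | omega | simp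
  simp only [vecMul, dotProduct, hx, Finset.sum_add_distrib]
  rw [sum_ite_val_add_one_eq (fun i => s ^ (i : ℕ) * (j : ℂ)) j (by omega),
    sum_ite_val_eq (fun i => s ^ (i : ℕ) * ((j : ℂ) - n))]
  have := j.2
  obtain ⟨j, hj⟩ := j
  rcases j with _ | j
  · simp only [lt_irrefl, dite_false]
    split_ifs with h
    · simp; ring
    · have : n = 0 := by simp at h; omega
      subst this; simp
  · simp only [Nat.succ_pos, dite_true]
    split_ifs with h
    · simp; ring
    · have : n = j + 1 := by simp at h; omega
      subst this; simp; ring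

theorem leadVec_vecMul_rotation :
    leadVec n ᵥ* rotationMatrix n = -(leadVec n ᵥ* shiftMatrix n) := by
  ext j
  simp only [leadVec, single_one_vecMul, rotationMatrix, shiftMatrix, Pi.neg_apply, row, of_apply,
    Fin.val_last]
  have := j.2
  by_cases h : n = j + 1
  · rw [if_neg (by omega), if_pos h, if_pos h,
      show (n : ℂ) = (j : ℕ) + 1 by exact_mod_cast h]
    ring
  · rw [if_neg (by omega), if_neg h, if_neg h]; simp

theorem rotation_shift_commutator :
    rotationMatrix n * shiftMatrix n - shiftMatrix n * rotationMatrix n =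
      1 + shiftMatrix n * shiftMatrix n - ((n : ℂ) + 1) • vecMulVec (leadVec n) (leadVec n) := by
  ext i j
  have h1 : (rotationMatrix n * shiftMatrix n) i j =
      if h : (j : ℕ) + 1 < n + 1 then rotationMatrix n i ⟨j + 1, h⟩ else 0 := by
    rw [mul_apply, ← sum_ite_val_eq]
    simp [shiftMatrix]
  have h2 : ∀ Y : Matrix (Fin (n + 1)) (Fin (n + 1)) ℂ, (shiftMatrix n * Y) i j =
      if h : 0 < (i : ℕ) then Y ⟨i - 1, by omega⟩ j else 0 := fun Y => by
    rw [mul_apply, ← sum_ite_val_add_one_eq (fun k => Y k j) i (by omega)]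
    simp [shiftMatrix]
  have h3 : vecMulVec (leadVec n) (leadVec n) i j =
      if (i : ℕ) = n ∧ (j : ℕ) = n then 1 else 0 := by
    simp only [vecMulVec_apply, leadVec, Pi.single_apply, Fin.ext_iff, Fin.val_last]
    split_ifs <;> simp_all
  simp only [Matrix.sub_apply, Matrix.add_apply, Matrix.smul_apply, h1, h2, h3, one_apply,
    Fin.ext_iff, smul_eq_mul]
  simp only [rotationMatrix, shiftMatrix, of_apply]
  obtain ⟨i, hi⟩ := i
  obtain ⟨j, hj⟩ := j
  simp only
  rcases i with _ | i
  · rcases j with _ | j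
    · rcases n with _ | n
      · simp
      · simp
    · simp; omega
  · by_cases hd : i + 1 = j
    · subst hd
      by_cases hn : i + 1 = n
      · subst hn
        have : ¬ i = i + 1 + 1 := by omega
        simp [this]
      · have : i + 1 < n := by omega
        simp [this, hn]
        omega
    · by_cases hd2 : i = j + 1
      · subst hd2
        have : j < n := by omega
        have e2 : ¬ (j + 1 + 1 = n ∧ j = n) := by omega
        simp [this, hd, e2]
      · have e1 : ¬ i + 1 = j + 1 + 1 := by omega
        have e2 : ¬ (i + 1 = n ∧ j = n) := by omega
        have e3 : ¬ i + 1 + 1 = j + 1 := by omega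
        simp [hd, hd2, e2]

theorem trace_shift : (shiftMatrix n).trace = 0 :=
  Finset.sum_eq_zero fun i _ => by simp [shiftMatrix]

theorem trace_rotation : (rotationMatrix n).trace = 0 :=
  Finset.sum_eq_zero fun i _ => by simp [rotationMatrix]

theorem trace_shift_mul_shift : (shiftMatrix n * shiftMatrix n).trace = 0 := by
  refine Finset.sum_eq_zero fun i _ => ?_
  rw [diag_apply, mul_apply]
  refine Finset.sum_eq_zero fun k _ => ?_
  simp only [shiftMatrix, of_apply]
  split_ifs <;> first | omega | simp

theorem trace_rotation_mul_shift :
    (rotationMatrix n * shiftMatrix n).trace = n * (n + 1) / 2 := by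
  have h : ∀ i, (rotationMatrix n * shiftMatrix n).diag i =
      if (i : ℕ) < n then ((i : ℕ) : ℂ) + 1 else 0 := fun i => by
    rw [diag_apply, mul_apply]
    have := sum_ite_val_eq (fun k => rotationMatrix n i k) (i + 1)
    simp only [shiftMatrix, of_apply, mul_ite, mul_one, mul_zero]
    rw [this]
    simp [rotationMatrix]
  rw [trace, Finset.sum_congr rfl fun i _ => h i,
    Fin.sum_univ_eq_sum_range (fun i => if i < n then (i : ℂ) + 1 else 0) (n + 1),
    Finset.sum_range_succ, if_neg (lt_irrefl n), add_zero,
    Finset.sum_congr rfl fun i hi => if_pos (Finset.mem_range.1 hi)]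
  clear h
  induction n with
  | zero => simp
  | succ n ih => rw [Finset.sum_range_succ, ih]; push_cast; ring

end shift

end PolynomialMatrices

/-! ### Hankel matrices of truncated Cauchy weights -/

section HankelAlgebra
open Matrix

/-- The algebraic properties of the Hankel matrix `H` of the weight `(1 + x²)^(-n-1-a)` truncated at
`s`, where `w` is the value of the weight at `s` and `x^(n+1) - ∑ q_i x^i` is the monic orthogonal
polynomial of degree `n + 1`. The field `comp` says that multiplication by `x` is symmetric, and
`rotation` is the Pearson equation of the weight, integrated up to `s`. -/
structure IsCauchyHankel (n : ℕ) (a s w : ℂ) (H : Matrix (Fin (n + 1)) (Fin (n + 1)) ℂ)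
    (q : Fin (n + 1) → ℂ) : Prop where
  symm : Hᵀ = H
  det_ne : H.det ≠ 0
  comp : (H * compMatrix n q)ᵀ = H * compMatrix n q
  rotation : (rotationMatrix n)ᵀ * H + H * rotationMatrix n =
    (2 * a) • (H * compMatrix n q) + ((1 + s ^ 2) * w) • vecMulVec (powVec n s) (powVec n s)

namespace IsCauchyHankel
variable {n : ℕ} {a s w : ℂ} {H : Matrix (Fin (n + 1)) (Fin (n + 1)) ℂ} {q : Fin (n + 1) → ℂ}

theorem powVec_vecMul_comp (s : ℂ) (q : Fin (n + 1) → ℂ) : powVec n s ᵥ* compMatrix n q =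
    s • powVec n s - (s ^ (n + 1) - powVec n s ⬝ᵥ q) • leadVec n := by
  rw [compMatrix, vecMul_add, powVec_vecMul_shift, vecMul_vecMulVec]
  module

theorem leadVec_dotProduct_leadVec : leadVec n ⬝ᵥ leadVec n = 1 := by simp [leadVec]

theorem leadVec_vecMul_rotation_eq_comp (q : Fin (n + 1) → ℂ) : leadVec n ᵥ* rotationMatrix n =
    (leadVec n ⬝ᵥ q) • leadVec n - leadVec n ᵥ* compMatrix n q := by
  rw [leadVec_vecMul_rotation, compMatrix, vecMul_add, vecMul_vecMulVec]
  module

/-- The vector `r` in `[X, M] = 1 + M² - r eᵀ`, where `X` is `rotationMatrix`, `M` is `compMatrix`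
and `e` is `leadVec`. -/
noncomputable def remVec (n : ℕ) (q : Fin (n + 1) → ℂ) : Fin (n + 1) → ℂ :=
  ((n : ℂ) + 1) • leadVec n - rotationMatrix n *ᵥ q + shiftMatrix n *ᵥ q
    + (leadVec n ⬝ᵥ q) • q

theorem rotation_comp_commutator (q : Fin (n + 1) → ℂ) :
    rotationMatrix n * compMatrix n q - compMatrix n q * rotationMatrix n =
      1 + compMatrix n q * compMatrix n q - vecMulVec (remVec n q) (leadVec n) := by
  have h := rotation_shift_commutator (n := n)
  have h2 := leadVec_vecMul_rotation (n := n)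
  rw [compMatrix, remVec]
  simp only [mul_add, add_mul, mul_vecMulVec, vecMulVec_mul, h2, vecMulVec_mulVec,
    op_smul_eq_smul, add_vecMulVec, sub_vecMulVec, smul_vecMulVec, vecMulVec_neg]
  have h3 : rotationMatrix n * shiftMatrix n = shiftMatrix n * rotationMatrix n + (
      1 + shiftMatrix n * shiftMatrix n - ((n : ℂ) + 1) • vecMulVec (leadVec n) (leadVec n)) := by
    rw [← h]; abel
  rw [h3]
  abel

theorem dot_comp (y : Fin (n + 1) → ℂ) : powVec n s ⬝ᵥ compMatrix n q *ᵥ (H⁻¹ *ᵥ y) =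
    s * (powVec n s ⬝ᵥ H⁻¹ *ᵥ y)
      - (s ^ (n + 1) - powVec n s ⬝ᵥ q) * (leadVec n ⬝ᵥ H⁻¹ *ᵥ y) := by
  rw [dotProduct_mulVec, powVec_vecMul_comp, sub_dotProduct, smul_dotProduct, smul_dotProduct,
    smul_eq_mul, smul_eq_mul]

variable (h : IsCauchyHankel n a s w H q)
include h

theorem mul_inv : H * H⁻¹ = 1 := H.mul_nonsing_inv (isUnit_iff_ne_zero.2 h.det_ne)

theorem inv_mul : H⁻¹ * H = 1 := H.nonsing_inv_mul (isUnit_iff_ne_zero.2 h.det_ne)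

theorem inv_symm : (H⁻¹)ᵀ = H⁻¹ := by rw [transpose_nonsing_inv, h.symm]

theorem dot_inv (x y : Fin (n + 1) → ℂ) : x ⬝ᵥ H⁻¹ *ᵥ y = y ⬝ᵥ H⁻¹ *ᵥ x := by
  rw [dotProduct_mulVec, ← mulVec_transpose, h.inv_symm, dotProduct_comm]

theorem dot_mul_inv (x : Fin (n + 1) → ℂ) (y : Fin (n + 1) → ℂ) :
    H⁻¹ *ᵥ x ⬝ᵥ H *ᵥ y = x ⬝ᵥ y := by
  rw [dotProduct_mulVec, ← mulVec_transpose, h.symm, mulVec_mulVec, h.mul_inv, one_mulVec]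

theorem comp_mul_inv : compMatrix n q * H⁻¹ = H⁻¹ * (compMatrix n q)ᵀ := by
  have h1 : (compMatrix n q)ᵀ * H = H * compMatrix n q := by
    rw [← h.comp, transpose_mul, h.symm]
  calc compMatrix n q * H⁻¹ = H⁻¹ * (H * compMatrix n q) * H⁻¹ := by
        rw [← Matrix.mul_assoc, h.inv_mul, Matrix.one_mul]
    _ = H⁻¹ * (compMatrix n q)ᵀ := by
        rw [← h1, Matrix.mul_assoc, Matrix.mul_assoc, h.mul_inv, Matrix.mul_one]

theorem comp_mulVec_kernel : compMatrix n q *ᵥ (H⁻¹ *ᵥ powVec n s) =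
    s • (H⁻¹ *ᵥ powVec n s) - (s ^ (n + 1) - powVec n s ⬝ᵥ q) • (H⁻¹ *ᵥ leadVec n) := by
  rw [mulVec_mulVec, h.comp_mul_inv, ← mulVec_mulVec, mulVec_transpose, powVec_vecMul_comp,
    mulVec_sub, mulVec_smul, mulVec_smul]

/-- The Pearson equation between `H⁻¹ x` and `H⁻¹ y`. -/
theorem sandwich (x y : Fin (n + 1) → ℂ) :
    y ⬝ᵥ rotationMatrix n *ᵥ (H⁻¹ *ᵥ x) + x ⬝ᵥ rotationMatrix n *ᵥ (H⁻¹ *ᵥ y) =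
      2 * a * (x ⬝ᵥ compMatrix n q *ᵥ (H⁻¹ *ᵥ y)) +
        (1 + s ^ 2) * w * (x ⬝ᵥ H⁻¹ *ᵥ powVec n s) * (y ⬝ᵥ H⁻¹ *ᵥ powVec n s) := by
  have h1 := congrArg (fun A => H⁻¹ *ᵥ x ⬝ᵥ A *ᵥ (H⁻¹ *ᵥ y)) h.rotation
  simp only [add_mulVec, dotProduct_add, smul_mulVec, dotProduct_smul, smul_eq_mul,
    ← mulVec_mulVec, h.dot_mul_inv, vecMulVec_mulVec] at h1
  have h2 : H⁻¹ *ᵥ x ⬝ᵥ (rotationMatrix n)ᵀ *ᵥ H *ᵥ H⁻¹ *ᵥ y =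
      y ⬝ᵥ rotationMatrix n *ᵥ H⁻¹ *ᵥ x := by
    rw [mulVec_mulVec (M := H), h.mul_inv, one_mulVec, mulVec_transpose, dotProduct_comm,
      ← dotProduct_mulVec]
  rw [h2] at h1
  rw [h1, h.dot_inv y, dotProduct_comm x (H⁻¹ *ᵥ powVec n s)]
  have h3 : H⁻¹ *ᵥ x ⬝ᵥ powVec n s = H⁻¹ *ᵥ powVec n s ⬝ᵥ x := by
    rw [dotProduct_comm, h.dot_inv, dotProduct_comm]
  simp [h3]
  ring

/-- The antisymmetric part of `H [X, M]` can be computed in two ways, from the Pearson equation and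
from the commutation relation. Comparing them determines `remVec` up to a multiple of `H⁻¹ e`. -/
theorem remVec_eq : ∃ α : ℂ, remVec n q =
    ((1 + s ^ 2) * w * (s ^ (n + 1) - powVec n s ⬝ᵥ q)) • (H⁻¹ *ᵥ powVec n s)
      + α • (H⁻¹ *ᵥ leadVec n) := by
  set M := compMatrix n q with hM
  set X := rotationMatrix n with hX
  set v := powVec n s with hv
  set e := leadVec n with he
  set ρ := s ^ (n + 1) - powVec n s ⬝ᵥ q with hρ
  set μ := (1 + s ^ 2) * w with hμ
  have h1 : Mᵀ * H = H * M := by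
    rw [hM, ← h.comp, transpose_mul, h.symm]
  have hHX : H * X = (2 * a) • (H * M) + μ • vecMulVec v v - Xᵀ * H := by
    rw [← h.rotation]; abel
  have hMv : v ᵥ* M = s • v - ρ • e := powVec_vecMul_comp s q
  have e1 : H * X * M = (2 * a) • (H * M * M) + μ • vecMulVec v (v ᵥ* M) - Xᵀ * (H * M) := by
    rw [hHX, Matrix.sub_mul, Matrix.add_mul, Matrix.smul_mul, Matrix.smul_mul, vecMulVec_mul,
      Matrix.mul_assoc Xᵀ]
  have e2 : H * M * X = (2 * a) • (H * M * M) + μ • vecMulVec (v ᵥ* M) v - Mᵀ * (Xᵀ * H) := by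
    rw [← h1, Matrix.mul_assoc, hHX, Matrix.mul_sub, Matrix.mul_add, Matrix.mul_smul,
      Matrix.mul_smul, mul_vecMulVec, mulVec_transpose, ← Matrix.mul_assoc Mᵀ H M, h1]
  have e3 : H * (X * M - M * X) - (H * (X * M - M * X))ᵀ =
      μ • vecMulVec v (v ᵥ* M) - μ • vecMulVec (v ᵥ* M) v := by
    rw [Matrix.mul_sub, ← Matrix.mul_assoc, ← Matrix.mul_assoc, transpose_sub, e1, e2]
    have : (H * X * M)ᵀ = Mᵀ * (Xᵀ * H) := by
      rw [transpose_mul, transpose_mul, h.symm]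
    have h3 : (H * M * X)ᵀ = Xᵀ * (H * M) := by
      rw [transpose_mul, h.comp]
    rw [← e1, ← e2, this, h3, e1, e2]
    abel
  have hMM : (H * (M * M))ᵀ = H * (M * M) := by
    rw [transpose_mul, transpose_mul, h.symm, Matrix.mul_assoc, h1, ← Matrix.mul_assoc, h1,
      Matrix.mul_assoc]
  have e4 : H * (X * M - M * X) - (H * (X * M - M * X))ᵀ =
      vecMulVec e (H *ᵥ remVec n q) - vecMulVec (H *ᵥ remVec n q) e := by
    rw [rotation_comp_commutator, Matrix.mul_sub, Matrix.mul_add, Matrix.mul_one, transpose_sub,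
      transpose_add, hMM, h.symm, mul_vecMulVec, transpose_vecMulVec]
    abel
  rw [e3, hMv] at e4
  have e5 := congrArg (fun A => A *ᵥ e) e4
  simp only [vecMulVec_sub, sub_vecMulVec, vecMulVec_smul, smul_vecMulVec, sub_mulVec, smul_mulVec,
    vecMulVec_mulVec, leadVec_dotProduct_leadVec, MulOpposite.op_one, one_smul, he] at e5
  have e6 : H *ᵥ remVec n q = (μ * ρ) • v + (H *ᵥ remVec n q ⬝ᵥ e - μ * ρ * (v ⬝ᵥ e)) • e := by
    ext i
    have := congrFun e5 i
    simp at this ⊢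
    linear_combination this
  refine ⟨H *ᵥ remVec n q ⬝ᵥ e - μ * ρ * (v ⬝ᵥ e), ?_⟩
  have e7 := congrArg (fun x => H⁻¹ *ᵥ x) e6
  simp only [mulVec_mulVec, h.inv_mul, one_mulVec, mulVec_add, mulVec_smul] at e7
  exact e7

theorem dot_rotation_pow : 2 * (powVec n s ⬝ᵥ rotationMatrix n *ᵥ (H⁻¹ *ᵥ powVec n s)) =
    2 * a * (s * (powVec n s ⬝ᵥ H⁻¹ *ᵥ powVec n s) - (s ^ (n + 1) - powVec n s ⬝ᵥ q) *
      (powVec n s ⬝ᵥ H⁻¹ *ᵥ leadVec n))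
    + (1 + s ^ 2) * w * (powVec n s ⬝ᵥ H⁻¹ *ᵥ powVec n s) ^ 2 := by
  have h1 := h.sandwich (powVec n s) (powVec n s)
  rw [dot_comp, h.dot_inv (leadVec n)] at h1
  linear_combination h1

theorem lead_dot_rotation : leadVec n ⬝ᵥ rotationMatrix n *ᵥ (H⁻¹ *ᵥ powVec n s) =
    (leadVec n ⬝ᵥ q) * (powVec n s ⬝ᵥ H⁻¹ *ᵥ leadVec n)
    - (s * (powVec n s ⬝ᵥ H⁻¹ *ᵥ leadVec n) - (s ^ (n + 1) - powVec n s ⬝ᵥ q) *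
      (leadVec n ⬝ᵥ H⁻¹ *ᵥ leadVec n)) := by
  rw [dotProduct_mulVec, leadVec_vecMul_rotation_eq_comp q, sub_dotProduct, smul_dotProduct,
    ← dotProduct_mulVec, h.comp_mulVec_kernel, dotProduct_sub, dotProduct_smul, dotProduct_smul,
    h.dot_inv (leadVec n) (powVec n s)]
  simp only [smul_eq_mul]

theorem dot_rotation_lead : powVec n s ⬝ᵥ rotationMatrix n *ᵥ (H⁻¹ *ᵥ leadVec n) =
    (2 * a + 1) * (s * (powVec n s ⬝ᵥ H⁻¹ *ᵥ leadVec n) - (s ^ (n + 1) - powVec n s ⬝ᵥ q) *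
      (leadVec n ⬝ᵥ H⁻¹ *ᵥ leadVec n))
    + (1 + s ^ 2) * w * (powVec n s ⬝ᵥ H⁻¹ *ᵥ powVec n s) * (powVec n s ⬝ᵥ H⁻¹ *ᵥ leadVec n)
    - (leadVec n ⬝ᵥ q) * (powVec n s ⬝ᵥ H⁻¹ *ᵥ leadVec n) := by
  have h1 := h.sandwich (powVec n s) (leadVec n)
  rw [dot_comp, h.lead_dot_rotation, h.dot_inv (leadVec n) (powVec n s)] at h1
  linear_combination h1

/-- The trace of `H⁻¹` times the Pearson equation. -/
theorem trace_rotation_eq : (1 + s ^ 2) * w * (powVec n s ⬝ᵥ H⁻¹ *ᵥ powVec n s) =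
    -2 * a * (leadVec n ⬝ᵥ q) := by
  have h1 := congrArg (fun A => (H⁻¹ * A).trace) h.rotation
  simp only [Matrix.mul_add, Matrix.mul_smul, mul_vecMulVec, ← Matrix.mul_assoc, h.inv_mul,
    Matrix.one_mul, trace_add, trace_smul, trace_vecMulVec, trace_rotation, smul_eq_mul] at h1
  rw [trace_mul_cycle, h.mul_inv, Matrix.one_mul, trace_transpose, trace_rotation, compMatrix,
    trace_add, trace_shift, trace_vecMulVec, dotProduct_comm _ (powVec n s),
    dotProduct_comm q] at h1
  linear_combination -h1

/-- The trace of `H⁻¹` times the Pearson equation times `compMatrix`. -/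
theorem trace_rotation_mul_comp_eq :
    (n : ℂ) * (n + 1) - 2 * (leadVec n ⬝ᵥ shiftMatrix n *ᵥ q) =
      2 * a * ((leadVec n ⬝ᵥ q) ^ 2 + 2 * (leadVec n ⬝ᵥ shiftMatrix n *ᵥ q)) +
      (1 + s ^ 2) * w * (s * (powVec n s ⬝ᵥ H⁻¹ *ᵥ powVec n s)
        - (s ^ (n + 1) - powVec n s ⬝ᵥ q) * (powVec n s ⬝ᵥ H⁻¹ *ᵥ leadVec n)) := by
  have h1 := congrArg (fun A => (H⁻¹ * A * compMatrix n q).trace) h.rotation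
  simp only [Matrix.mul_add, Matrix.mul_smul, mul_vecMulVec, ← Matrix.mul_assoc, h.inv_mul,
    Matrix.one_mul, trace_add, trace_smul, trace_vecMulVec, smul_eq_mul, Matrix.add_mul,
    Matrix.smul_mul, vecMulVec_mul] at h1
  have h2 : (H⁻¹ * (rotationMatrix n)ᵀ * H * compMatrix n q).trace =
      (rotationMatrix n * compMatrix n q).trace := by
    rw [Matrix.mul_assoc _ H, ← h.comp, transpose_mul, h.symm, ← Matrix.mul_assoc, trace_mul_comm,
      ← Matrix.mul_assoc, ← Matrix.mul_assoc, h.mul_inv, Matrix.one_mul, ← transpose_mul,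
      trace_transpose, trace_mul_comm]
  have h3 : (rotationMatrix n * compMatrix n q).trace =
      n * (n + 1) / 2 - leadVec n ⬝ᵥ shiftMatrix n *ᵥ q := by
    rw [compMatrix, Matrix.mul_add, trace_add, trace_rotation_mul_shift, mul_vecMulVec,
      trace_vecMulVec, dotProduct_comm, dotProduct_mulVec, leadVec_vecMul_rotation, neg_dotProduct,
      ← dotProduct_mulVec]
    ring
  have h4 : (compMatrix n q * compMatrix n q).trace =
      (leadVec n ⬝ᵥ q) ^ 2 + 2 * (leadVec n ⬝ᵥ shiftMatrix n *ᵥ q) := by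
    simp only [compMatrix, Matrix.mul_add, Matrix.add_mul, trace_add, trace_shift_mul_shift,
      mul_vecMulVec, vecMulVec_mul, trace_vecMulVec]
    rw [dotProduct_comm q (_ ᵥ* _), ← dotProduct_mulVec, dotProduct_comm (_ *ᵥ q)]
    simp only [add_mulVec, dotProduct_add, vecMulVec_mulVec, op_smul_eq_smul, dotProduct_smul,
      smul_eq_mul]
    ring
  rw [h2, h3, h4, dotProduct_comm (H⁻¹ *ᵥ powVec n s), powVec_vecMul_comp, sub_dotProduct,
    smul_dotProduct, smul_dotProduct, h.dot_inv (leadVec n)] at h1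
  simp only [smul_eq_mul] at h1
  linear_combination h1

/-- The scalar products with `remVec`, and a formula for the kernel on the diagonal that follows
from the commutation relation applied between `v` and `H⁻¹ v`. -/
theorem kernel_values : ∃ α : ℂ,
    powVec n s ⬝ᵥ remVec n q = (1 + s ^ 2) * w * (s ^ (n + 1) - powVec n s ⬝ᵥ q) *
        (powVec n s ⬝ᵥ H⁻¹ *ᵥ powVec n s) + α * (powVec n s ⬝ᵥ H⁻¹ *ᵥ leadVec n) ∧
    leadVec n ⬝ᵥ remVec n q = (1 + s ^ 2) * w * (s ^ (n + 1) - powVec n s ⬝ᵥ q) *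
        (powVec n s ⬝ᵥ H⁻¹ *ᵥ leadVec n) + α * (leadVec n ⬝ᵥ H⁻¹ *ᵥ leadVec n) ∧
    (1 + s ^ 2) * (powVec n s ⬝ᵥ H⁻¹ *ᵥ powVec n s) =
      α * (powVec n s ⬝ᵥ H⁻¹ *ᵥ leadVec n) ^ 2
      + (2 * a + 1) * (leadVec n ⬝ᵥ H⁻¹ *ᵥ leadVec n) * (s ^ (n + 1) - powVec n s ⬝ᵥ q) ^ 2
      + (2 * (leadVec n ⬝ᵥ q) - 2 * a * s) * (s ^ (n + 1) - powVec n s ⬝ᵥ q) *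
        (powVec n s ⬝ᵥ H⁻¹ *ᵥ leadVec n) := by
  obtain ⟨α, hα⟩ := h.remVec_eq
  have f1 := congrArg (fun x => powVec n s ⬝ᵥ x) hα
  have f2 := congrArg (fun x => leadVec n ⬝ᵥ x) hα
  simp only [dotProduct_add, dotProduct_smul, smul_eq_mul] at f1 f2
  rw [h.dot_inv (leadVec n) (powVec n s)] at f2
  refine ⟨α, f1, f2, ?_⟩
  have f3 := h.dot_rotation_lead
  have f4 := h.lead_dot_rotation
  have f5 := congrArg (fun A => powVec n s ⬝ᵥ A *ᵥ (H⁻¹ *ᵥ powVec n s))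
    (rotation_comp_commutator q)
  simp only [sub_mulVec, add_mulVec, one_mulVec, ← mulVec_mulVec, h.comp_mulVec_kernel, mulVec_sub,
    mulVec_smul, dotProduct_sub, dotProduct_add, dotProduct_smul, smul_eq_mul, vecMulVec_mulVec,
    op_smul_eq_smul, h.dot_inv (leadVec n) (powVec n s), f1] at f5
  rw [dotProduct_mulVec _ (compMatrix n q), powVec_vecMul_comp] at f5
  rw [dotProduct_mulVec _ (compMatrix n q), powVec_vecMul_comp] at f5
  simp only [sub_dotProduct, smul_dotProduct, smul_eq_mul, f4] at f5
  linear_combination -f5 - (s ^ (n + 1) - powVec n s ⬝ᵥ q) * f3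

end IsCauchyHankel

end HankelAlgebra

/-! ### The sigma equation of the truncated Cauchy weight -/

section SigmaEquation
open Matrix

section calculus
attribute [local instance] Matrix.linftyOpNormedRing Matrix.linftyOpNormedAlgebra

theorem hasDerivAt_matrix_inv {ι : Type*} [Fintype ι] [DecidableEq ι] {H : ℂ → Matrix ι ι ℂ}
    {H' : Matrix ι ι ℂ} {z : ℂ} (hH : ∀ i j, HasDerivAt (fun z => H z i j) (H' i j) z)
    (hdet : (H z).det ≠ 0) (i j : ι) :
    HasDerivAt (fun z => (H z)⁻¹ i j) (-((H z)⁻¹ * H' * (H z)⁻¹) i j) z := by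
  have h1 : HasDerivAt H H' z :=
    hasDerivAt_pi.2 fun i => hasDerivAt_pi.2 fun j => hH i j
  have hu : IsUnit (H z) := (isUnit_iff_isUnit_det _).2 (isUnit_iff_ne_zero.2 hdet)
  obtain ⟨x, hx⟩ := hu
  have h2 := hasFDerivAt_ringInverse (𝕜 := ℂ) x
  rw [hx] at h2
  have h3 := h2.comp_hasDerivAt z h1
  have h4 := (hasDerivAt_pi.1 ((hasDerivAt_pi.1 h3) i)) j
  have hx' : ((x⁻¹ : (Matrix ι ι ℂ)ˣ) : Matrix ι ι ℂ) = (H z)⁻¹ := by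
    rw [coe_units_inv, hx]
  simp only [_root_.neg_apply, ContinuousLinearMap.mulLeftRight_apply, hx'] at h4
  refine (h4.congr_deriv ?_).congr_of_eventuallyEq (Filter.Eventually.of_forall fun y => ?_)
  · simp
  · simp only [nonsing_inv_eq_ringInverse, Function.comp]

end calculus

theorem hasDerivAt_dotProduct {ι : Type*} [Fintype ι] {x y : ℂ → ι → ℂ} {x' y' : ι → ℂ} {z : ℂ}
    (hx : ∀ i, HasDerivAt (fun z => x z i) (x' i) z)
    (hy : ∀ i, HasDerivAt (fun z => y z i) (y' i) z) :
    HasDerivAt (fun z => x z ⬝ᵥ y z) (x' ⬝ᵥ y z + x z ⬝ᵥ y') z := by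
  unfold dotProduct
  rw [← Finset.sum_add_distrib]
  exact HasDerivAt.fun_sum fun i _ => (hx i).mul (hy i)

theorem hasDerivAt_inv_mulVec {ι : Type*} [Fintype ι] [DecidableEq ι] {H : ℂ → Matrix ι ι ℂ}
    {H' : Matrix ι ι ℂ} {y : ℂ → ι → ℂ} {y' : ι → ℂ} {z : ℂ}
    (hH : ∀ i j, HasDerivAt (fun z => H z i j) (H' i j) z)
    (hdet : (H z).det ≠ 0) (hy : ∀ i, HasDerivAt (fun z => y z i) (y' i) z) (i : ι) :
    HasDerivAt (fun z => ((H z)⁻¹ *ᵥ y z) i)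
      (((H z)⁻¹ *ᵥ y' - (H z)⁻¹ *ᵥ H' *ᵥ (H z)⁻¹ *ᵥ y z) i) z := by
  refine (hasDerivAt_dotProduct (x := fun z j => (H z)⁻¹ i j)
    (fun j => hasDerivAt_matrix_inv hH hdet i j) hy).congr_deriv ?_
  rw [Pi.sub_apply, mulVec_mulVec, mulVec_mulVec, add_comm, sub_eq_add_neg]
  congr 1
  simp only [mulVec, dotProduct, neg_mul, Finset.sum_neg_distrib]

/-- The Hankel matrix of size `n + 1` of the moment functions `m k`. -/
def hankelMatrix (n : ℕ) (m : ℕ → ℂ → ℂ) (z : ℂ) : Matrix (Fin (n + 1)) (Fin (n + 1)) ℂ :=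
  of fun i j => m (i + j) z

/-- The coefficients `q` for which `x^(n+1) - ∑ q_i x^i` is orthogonal to lower degrees. -/
noncomputable def recVec (n : ℕ) (m : ℕ → ℂ → ℂ) (z : ℂ) : Fin (n + 1) → ℂ :=
  (hankelMatrix n m z)⁻¹ *ᵥ fun i => m (n + 1 + i) z

/-- The function `σ`, written through the Hankel matrix of the truncated moments. -/
noncomputable def hankelSigma (n : ℕ) (m : ℕ → ℂ → ℂ) (w : ℂ → ℂ) (z : ℂ) : ℂ :=
  (1 + z ^ 2) * w z * (powVec n z ⬝ᵥ (hankelMatrix n m z)⁻¹ *ᵥ powVec n z)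

/-- The functions `m k`, `k ≤ 2 n + 1`, behave on `Ω` like the incomplete moments
`∫_{-∞}^z x^k w(x) dx` of the weight `w(x) = (1 + x²)^(-n-1-a)`. The index `k - 1` in `recursion`
is truncated at `k = 0`, where the coefficient `k` makes that term vanish. -/
structure IsCauchyMoments (n : ℕ) (a : ℂ) (m : ℕ → ℂ → ℂ) (w : ℂ → ℂ) (Ω : Set ℂ) : Prop where
  moment_deriv : ∀ z ∈ Ω, ∀ k ≤ 2 * n + 1, HasDerivAt (m k) (z ^ k * w z) z
  weight_deriv : ∀ z ∈ Ω, ∃ w', HasDerivAt w w' z ∧ (1 + z ^ 2) * w' = -2 * (n + 1 + a) * z * w z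
  recursion : ∀ z ∈ Ω, ∀ k ≤ 2 * n,
    ((k : ℂ) - 2 * n - 2 * a) * m (k + 1) z + k * m (k - 1) z = z ^ k * ((1 + z ^ 2) * w z)
  det_ne : ∀ z ∈ Ω, (hankelMatrix n m z).det ≠ 0

namespace IsCauchyMoments
variable {n : ℕ} {a : ℂ} {m : ℕ → ℂ → ℂ} {w : ℂ → ℂ} {Ω : Set ℂ} {z : ℂ}

theorem isCauchyHankel (h : IsCauchyMoments n a m w Ω) (hz : z ∈ Ω) :
    IsCauchyHankel n a z (w z) (hankelMatrix n m z) (recVec n m z) := by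
  have hdet := h.det_ne z hz
  have hcomp : hankelMatrix n m z * compMatrix n (recVec n m z) =
      of fun i j : Fin (n + 1) => m (i + j + 1) z := by
    rw [compMatrix, Matrix.mul_add, mul_vecMulVec, recVec, mulVec_mulVec,
      mul_nonsing_inv _ (isUnit_iff_ne_zero.2 hdet), one_mulVec]
    ext i j
    have h1 := sum_ite_val_eq (fun k => hankelMatrix n m z i k) (j + 1)
    have hj := j.2
    rw [Matrix.add_apply, mul_apply]
    simp only [shiftMatrix, of_apply, mul_ite, mul_one, mul_zero, vecMulVec_apply, leadVec]
    rw [h1]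
    split_ifs with hjn
    · rw [Pi.single_eq_of_ne (by rintro rfl; simp at hjn)]
      simp [hankelMatrix, add_assoc]
    · have : j = Fin.last n := by ext; simp; omega
      subst this
      simp only [Pi.single_eq_same, zero_add, mul_one, Fin.val_last]
      congr 1
      omega
  refine ⟨?_, hdet, ?_, ?_⟩
  · ext i j
    simp [hankelMatrix, add_comm]
  · rw [hcomp]
    ext i j
    simp [add_comm]
  · have key : ∀ i j : Fin (n + 1), (hankelMatrix n m z * rotationMatrix n) i j =
        (j : ℂ) * m (i + j - 1) z + ((j : ℂ) - n) * m (i + j + 1) z := fun i j => by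
      have hx : ∀ k : Fin (n + 1), hankelMatrix n m z i k * rotationMatrix n k j =
          (if (j : ℕ) = k + 1 then m (i + k) z * (j : ℂ) else 0) +
          (if (k : ℕ) = j + 1 then m (i + k) z * ((j : ℂ) - n) else 0) := fun k => by
        simp only [hankelMatrix, rotationMatrix, of_apply]
        split_ifs <;> first | omega | simp
      rw [mul_apply]
      simp only [hx, Finset.sum_add_distrib]
      rw [sum_ite_val_add_one_eq (fun k => m (i + k) z * (j : ℂ)) j (by omega),
        sum_ite_val_eq (fun k => m (i + k) z * ((j : ℂ) - n))]
      have hj := j.2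
      congr 1
      · split_ifs with h0
        · simp only
          rw [mul_comm, Nat.add_sub_assoc h0]
        · have : (j : ℕ) = 0 := by omega
          simp [this]
      · split_ifs with h0
        · rw [mul_comm, add_assoc]
        · have : (n : ℂ) = (j : ℕ) := by
            have : n = (j : ℕ) := by omega
            exact_mod_cast this
          rw [this]; simp
    have hT : (rotationMatrix n)ᵀ * hankelMatrix n m z =
        (hankelMatrix n m z * rotationMatrix n)ᵀ := by
      rw [transpose_mul]
      congr 1
      ext i j
      simp [hankelMatrix, add_comm]
    rw [hT, hcomp]
    ext i j
    have hij : (i : ℕ) + j ≤ 2 * n := by omega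
    have := h.recursion z hz (i + j) hij
    simp only [Matrix.add_apply, transpose_apply, key, Matrix.smul_apply, of_apply,
      vecMulVec_apply, powVec, smul_eq_mul]
    rw [add_comm (j : ℕ) i]
    push_cast at this
    rw [← pow_add]
    linear_combination this

end IsCauchyMoments

namespace IsCauchyMoments
variable {n : ℕ} {a : ℂ} {m : ℕ → ℂ → ℂ} {w : ℂ → ℂ} {Ω : Set ℂ} {z : ℂ}

/-- The derivative of the vector of powers `powVec n z` in `z`. -/
def powDerivVec (n : ℕ) (z : ℂ) : Fin (n + 1) → ℂ := fun i => (i : ℂ) * z ^ ((i : ℕ) - 1)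

theorem hasDerivAt_powVec (i : Fin (n + 1)) :
    HasDerivAt (fun z => powVec n z i) (powDerivVec n z i) z := by
  simpa [powVec, powDerivVec] using hasDerivAt_pow (i : ℕ) z

/-- The rotation generates the motion of the evaluation vector. -/
theorem one_add_sq_mul_deriv_powVec (f : Fin (n + 1) → ℂ) :
    (1 + z ^ 2) * ((powDerivVec n z) ⬝ᵥ f) =
      powVec n z ⬝ᵥ rotationMatrix n *ᵥ f + n * z * (powVec n z ⬝ᵥ f) := by
  rw [dotProduct_mulVec, ← smul_eq_mul, ← smul_dotProduct, ← smul_eq_mul, ← smul_dotProduct,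
    ← add_dotProduct]
  congr 1
  ext j
  have := powVec_vecMul_rotation z j
  simp only [Pi.smul_apply, Pi.add_apply, smul_eq_mul]
  rw [powDerivVec, ← this]
  rfl

variable (h : IsCauchyMoments n a m w Ω) (hz : z ∈ Ω)
include h hz

theorem hasDerivAt_hankel (i j : Fin (n + 1)) : HasDerivAt (fun z => hankelMatrix n m z i j)
    ((w z • vecMulVec (powVec n z) (powVec n z)) i j) z := by
  refine (h.moment_deriv z hz (i + j) (by omega)).congr_deriv ?_
  simp [vecMulVec_apply, powVec, pow_add]
  ring

theorem hasDerivAt_kernelVec (i : Fin (n + 1)) :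
    HasDerivAt (fun z => ((hankelMatrix n m z)⁻¹ *ᵥ powVec n z) i)
      (((hankelMatrix n m z)⁻¹ *ᵥ (powDerivVec n z)
        - (w z * (powVec n z ⬝ᵥ (hankelMatrix n m z)⁻¹ *ᵥ powVec n z)) •
          ((hankelMatrix n m z)⁻¹ *ᵥ powVec n z)) i) z := by
  refine (hasDerivAt_inv_mulVec (h.hasDerivAt_hankel hz) (h.det_ne z hz)
    hasDerivAt_powVec i).congr_deriv ?_
  rw [smul_mulVec, vecMulVec_mulVec, op_smul_eq_smul, mulVec_smul, mulVec_smul, smul_smul]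

theorem hasDerivAt_recVec (i : Fin (n + 1)) :
    HasDerivAt (fun z => recVec n m z i)
      (((w z * (z ^ (n + 1) - powVec n z ⬝ᵥ recVec n m z)) •
          ((hankelMatrix n m z)⁻¹ *ᵥ powVec n z)) i) z := by
  refine (hasDerivAt_inv_mulVec (h.hasDerivAt_hankel hz) (h.det_ne z hz)
    (y := fun z (i : Fin (n + 1)) => m (n + 1 + i) z) (y' := (z ^ (n + 1) * w z) • powVec n z)
    (fun i => (h.moment_deriv z hz (n + 1 + i) (by omega)).congr_deriv ?_) i).congr_deriv ?_
  · simp [powVec, pow_add]; ring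
  · rw [smul_mulVec, vecMulVec_mulVec, op_smul_eq_smul, mulVec_smul, mulVec_smul, mulVec_smul,
      ← recVec]
    simp
    ring

theorem hasDerivAt_sigma : HasDerivAt (hankelSigma n m w)
    (-2 * a * w z * (z ^ (n + 1) - powVec n z ⬝ᵥ recVec n m z) *
      (leadVec n ⬝ᵥ (hankelMatrix n m z)⁻¹ *ᵥ powVec n z)) z := by
  have hH := h.isCauchyHankel hz
  obtain ⟨w', hw', hw⟩ := h.weight_deriv z hz
  have d1 := hasDerivAt_dotProduct hasDerivAt_powVec (h.hasDerivAt_kernelVec hz)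
  have d2 := (((hasDerivAt_pow 2 z).const_add 1).mul hw').mul d1
  refine d2.congr_deriv ?_
  have e1 := one_add_sq_mul_deriv_powVec (z := z) ((hankelMatrix n m z)⁻¹ *ᵥ powVec n z)
  have e2 := hH.dot_rotation_pow
  rw [dotProduct_sub, dotProduct_smul, hH.dot_inv (powVec n z) (powDerivVec n z)]
  rw [hH.dot_inv (leadVec n)]
  simp only [smul_eq_mul]
  simp only [Pi.mul_apply]
  push_cast
  linear_combination (powVec n z ⬝ᵥ (hankelMatrix n m z)⁻¹ *ᵥ powVec n z) * hw
    + 2 * w z * e1 + w z * e2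

/-- The second derivative of `σ`, together with the relations of `IsCauchyHankel.kernel_values` for
the same scalar `α`. -/
theorem hasDerivAt_deriv_sigma : ∃ d α : ℂ, HasDerivAt (fun z => -2 * a * w z *
      (z ^ (n + 1) - powVec n z ⬝ᵥ recVec n m z) *
      (leadVec n ⬝ᵥ (hankelMatrix n m z)⁻¹ *ᵥ powVec n z)) d z ∧
    (1 + z ^ 2) * d = -2 * a * w z * (α * (powVec n z ⬝ᵥ (hankelMatrix n m z)⁻¹ *ᵥ leadVec n) ^ 2
      - (2 * a + 1) * (leadVec n ⬝ᵥ (hankelMatrix n m z)⁻¹ *ᵥ leadVec n) *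
        (z ^ (n + 1) - powVec n z ⬝ᵥ recVec n m z) ^ 2) ∧
    leadVec n ⬝ᵥ IsCauchyHankel.remVec n (recVec n m z) =
      (1 + z ^ 2) * w z * (z ^ (n + 1) - powVec n z ⬝ᵥ recVec n m z) *
        (powVec n z ⬝ᵥ (hankelMatrix n m z)⁻¹ *ᵥ leadVec n)
        + α * (leadVec n ⬝ᵥ (hankelMatrix n m z)⁻¹ *ᵥ leadVec n) ∧
    (1 + z ^ 2) * (powVec n z ⬝ᵥ (hankelMatrix n m z)⁻¹ *ᵥ powVec n z) =
      α * (powVec n z ⬝ᵥ (hankelMatrix n m z)⁻¹ *ᵥ leadVec n) ^ 2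
      + (2 * a + 1) * (leadVec n ⬝ᵥ (hankelMatrix n m z)⁻¹ *ᵥ leadVec n) *
        (z ^ (n + 1) - powVec n z ⬝ᵥ recVec n m z) ^ 2
      + (2 * (leadVec n ⬝ᵥ recVec n m z) - 2 * a * z) *
        (z ^ (n + 1) - powVec n z ⬝ᵥ recVec n m z) *
        (powVec n z ⬝ᵥ (hankelMatrix n m z)⁻¹ *ᵥ leadVec n) := by
  have hH := h.isCauchyHankel hz
  obtain ⟨w', hw', hw⟩ := h.weight_deriv z hz
  obtain ⟨α, f1, f2, f3⟩ := hH.kernel_values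
  have d1 := (hasDerivAt_pow (n + 1) z).sub
    (hasDerivAt_dotProduct hasDerivAt_powVec (h.hasDerivAt_recVec hz))
  have d2 := hasDerivAt_dotProduct (x := fun _ => leadVec n) (x' := 0)
    (fun i => hasDerivAt_const z (leadVec n i)) (h.hasDerivAt_kernelVec hz)
  refine ⟨_, α, ((hw'.const_mul (-2 * a)).mul d1).mul d2, ?_, f2, f3⟩
  have e1 := one_add_sq_mul_deriv_powVec (z := z) ((hankelMatrix n m z)⁻¹ *ᵥ leadVec n)
  have e2 := one_add_sq_mul_deriv_powVec (z := z) (recVec n m z)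
  have e3 := hH.dot_rotation_lead
  have e4 : powVec n z ⬝ᵥ rotationMatrix n *ᵥ recVec n m z =
      (n + 1) * z ^ n + (z * (powVec n z ⬝ᵥ recVec n m z)
        - z ^ (n + 1) * (leadVec n ⬝ᵥ recVec n m z))
      + (leadVec n ⬝ᵥ recVec n m z) * (powVec n z ⬝ᵥ recVec n m z)
      - powVec n z ⬝ᵥ IsCauchyHankel.remVec n (recVec n m z) := by
    have hl : powVec n z ⬝ᵥ leadVec n = z ^ n := by simp [powVec, leadVec]
    simp only [IsCauchyHankel.remVec, dotProduct_add, dotProduct_sub, dotProduct_smul, smul_eq_mul,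
      hl]
    rw [dotProduct_mulVec _ (shiftMatrix n), powVec_vecMul_shift, sub_dotProduct, smul_dotProduct,
      smul_dotProduct]
    simp only [smul_eq_mul]
    ring
  rw [f1] at e4
  rw [e4] at e2
  rw [e3] at e1
  rw [dotProduct_sub, dotProduct_smul, dotProduct_smul, zero_dotProduct,
    hH.dot_inv (leadVec n) (powDerivVec n z), hH.dot_inv (leadVec n) (powVec n z)]
  simp only [smul_eq_mul, Nat.add_sub_cancel, Pi.mul_apply, Pi.sub_apply]
  push_cast
  generalize (powDerivVec n z) ⬝ᵥ recVec n m z = X1 at *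
  generalize (powDerivVec n z) ⬝ᵥ
    (hankelMatrix n m z)⁻¹ *ᵥ leadVec n = X2 at *
  generalize (powVec n z ⬝ᵥ (hankelMatrix n m z)⁻¹ *ᵥ leadVec n) = π at *
  generalize (powVec n z ⬝ᵥ (hankelMatrix n m z)⁻¹ *ᵥ powVec n z) = κ at *
  generalize (leadVec n ⬝ᵥ (hankelMatrix n m z)⁻¹ *ᵥ leadVec n) = g at *
  generalize hρ : z ^ (n + 1) - powVec n z ⬝ᵥ recVec n m z = ρ at *
  have hv : powVec n z ⬝ᵥ recVec n m z = z ^ (n + 1) - ρ := by rw [← hρ]; ring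
  rw [hv] at e2
  linear_combination (-2 * a * ρ * π) * hw + (-2 * a * w z * ρ) * e1 + (2 * a * w z * π) * e2

end IsCauchyMoments

theorem IsCauchyHankel.lead_dot_remVec {n : ℕ} (q : Fin (n + 1) → ℂ) :
    leadVec n ⬝ᵥ IsCauchyHankel.remVec n q =
      n + 1 + 2 * (leadVec n ⬝ᵥ shiftMatrix n *ᵥ q) + (leadVec n ⬝ᵥ q) ^ 2 := by
  have h1 : leadVec n ⬝ᵥ rotationMatrix n *ᵥ q = -(leadVec n ⬝ᵥ shiftMatrix n *ᵥ q) := by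
    rw [dotProduct_mulVec, leadVec_vecMul_rotation, neg_dotProduct, ← dotProduct_mulVec]
  simp only [IsCauchyHankel.remVec, dotProduct_add, dotProduct_sub, dotProduct_smul, smul_eq_mul,
    IsCauchyHankel.leadVec_dotProduct_leadVec, h1]
  ring

namespace IsCauchyMoments
variable {n : ℕ} {a : ℂ} {m : ℕ → ℂ → ℂ} {w : ℂ → ℂ} {Ω : Set ℂ} {z : ℂ}
variable (h : IsCauchyMoments n a m w Ω)
include h

theorem analyticOnNhd_sigma (hΩ : IsOpen Ω) : AnalyticOnNhd ℂ (hankelSigma n m w) Ω :=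
  DifferentiableOn.analyticOnNhd
    (fun _ hz => (h.hasDerivAt_sigma hz).differentiableAt.differentiableWithinAt) hΩ

/-- The second order equation of second degree satisfied by `σ`. -/
theorem sigma_equation (hΩ : IsOpen Ω) (ha : a ≠ 0) (hz : z ∈ Ω) {σ σ₁ σ₂ : ℂ}
    (hσ : hankelSigma n m w z = σ) (hσ₁ : deriv (hankelSigma n m w) z = σ₁)
    (hσ₂ : deriv (deriv (hankelSigma n m w)) z = σ₂) :
    ((1 + z ^ 2) * σ₂) ^ 2 + 4 * (1 + z ^ 2) * σ₁ ^ 3 - 8 * z * σ * σ₁ ^ 2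
      + 4 * σ ^ 2 * (σ₁ - a ^ 2) + 8 * a ^ 2 * z * σ * σ₁
      + 4 * ((n + 1) * (n + 1 + 2 * a) - a ^ 2 * z ^ 2) * σ₁ ^ 2 = 0 := by
  have hH := h.isCauchyHankel hz
  rw [(h.hasDerivAt_sigma hz).deriv] at hσ₁
  obtain ⟨d, α, h1, h2, h3, h4⟩ := h.hasDerivAt_deriv_sigma hz
  have h5 : deriv (deriv (hankelSigma n m w)) z = d := by
    rw [← h1.deriv]
    refine Filter.EventuallyEq.deriv_eq ?_
    filter_upwards [hΩ.mem_nhds hz] with x hx using (h.hasDerivAt_sigma hx).deriv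
  rw [h5] at hσ₂
  subst hσ₂
  have t1 := hH.trace_rotation_eq
  have t2 := hH.trace_rotation_mul_comp_eq
  rw [IsCauchyHankel.lead_dot_remVec] at h3
  rw [hankelSigma] at hσ
  rw [hH.dot_inv (leadVec n) (powVec n z)] at hσ₁
  generalize (powVec n z ⬝ᵥ (hankelMatrix n m z)⁻¹ *ᵥ leadVec n) = π at *
  generalize (powVec n z ⬝ᵥ (hankelMatrix n m z)⁻¹ *ᵥ powVec n z) = κ at *
  generalize (leadVec n ⬝ᵥ (hankelMatrix n m z)⁻¹ *ᵥ leadVec n) = g at *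
  generalize z ^ (n + 1) - powVec n z ⬝ᵥ recVec n m z = ρ at *
  generalize leadVec n ⬝ᵥ recVec n m z = E at *
  generalize leadVec n ⬝ᵥ shiftMatrix n *ᵥ recVec n m z = Q at *
  rw [hσ] at t1
  have hE : E = -σ / (2 * a) := by field_simp; linear_combination t1
  have k1 : (2 * a + 1) * α * g =
      (n + 1) * (n + 1 + 2 * a) + E ^ 2 - z * σ + (1 + z ^ 2) * σ₁ := by
    linear_combination -(2 * a + 1) * h3 - t2 - z * hσ + (1 + z ^ 2) * hσ₁
  have k2 : w z * (α * π ^ 2 + (2 * a + 1) * g * ρ ^ 2) =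
      σ + (E - a * z) * σ₁ / a := by
    field_simp
    linear_combination (-w z * a) * h4 + a * hσ + (E - a * z) * hσ₁
  have k3 : ((1 + z ^ 2) * d) ^ 2 = 4 * a ^ 2 * (w z * (α * π ^ 2 + (2 * a + 1) * g * ρ ^ 2)) ^ 2
      - 4 * ((2 * a + 1) * α * g) * σ₁ ^ 2 := by
    rw [h2, ← hσ₁]; ring
  rw [k3, k1, k2, hE]
  field_simp
  ring

end IsCauchyMoments

end SigmaEquation

/-! ### The Cauchy weight and its incomplete moments -/

section CauchyWeight
open Matrix MeasureTheory Set Filter Topology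

section realWeight
variable {n : ℕ} {a : ℝ}

theorem cauchyWeight_pos (N : ℕ) (a x : ℝ) : 0 < cauchyWeight N a x :=
  Real.rpow_pos_of_pos (by positivity) _

theorem continuous_cauchyWeight (N : ℕ) (a : ℝ) : Continuous (cauchyWeight N a) :=
  Continuous.rpow_const (by fun_prop) fun x => Or.inl (by positivity)

theorem abs_pow_le_one_add_sq_rpow (k : ℕ) (x : ℝ) : |x| ^ k ≤ (1 + x ^ 2) ^ ((k : ℝ) / 2) := by
  have h : |x| ≤ (1 + x ^ 2) ^ ((1 : ℝ) / 2) := by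
    rw [← Real.sqrt_eq_rpow]
    exact Real.abs_le_sqrt (by linarith)
  calc |x| ^ k ≤ ((1 + x ^ 2) ^ ((1 : ℝ) / 2)) ^ k := by gcongr
    _ = (1 + x ^ 2) ^ ((k : ℝ) / 2) := by
      rw [← Real.rpow_natCast, ← Real.rpow_mul (by positivity)]
      congr 1
      ring

theorem integrable_pow_mul_cauchyWeight (ha : 0 < a) {k : ℕ} (hk : k ≤ 2 * n + 1) :
    Integrable fun x => x ^ k * cauchyWeight (n + 1) a x := by
  have h1 := integrable_rpow_neg_one_add_norm_sq (E := ℝ) (μ := volume) (r := 1 + 2 * a)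
    (by simp; linarith)
  refine h1.mono' ?_ (Eventually.of_forall fun x => ?_)
  · exact ((continuous_pow k).mul (continuous_cauchyWeight _ _)).aestronglyMeasurable
  · have hk' : (k : ℝ) ≤ 2 * n + 1 := by exact_mod_cast hk
    rw [norm_mul, norm_pow, Real.norm_eq_abs, Real.norm_of_nonneg (cauchyWeight_pos _ _ _).le,
      sq_abs]
    calc |x| ^ k * cauchyWeight (n + 1) a x
        ≤ (1 + x ^ 2) ^ ((k : ℝ) / 2) * cauchyWeight (n + 1) a x :=
          mul_le_mul_of_nonneg_right (abs_pow_le_one_add_sq_rpow k x) (cauchyWeight_pos _ _ _).le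
      _ = (1 + x ^ 2) ^ ((k : ℝ) / 2 + (-((n + 1 : ℕ) : ℝ) - a)) := by
          rw [cauchyWeight, ← Real.rpow_add (by positivity)]
      _ ≤ (1 + x ^ 2) ^ (-(1 + 2 * a) / 2) := by
          refine Real.rpow_le_rpow_of_exponent_le (by nlinarith) ?_
          push_cast
          linarith

theorem hasDerivAt_cauchyWeight (N : ℕ) (a x : ℝ) : HasDerivAt (cauchyWeight N a)
    (-2 * (N + a) * x * cauchyWeight N a x / (1 + x ^ 2)) x := by
  have h1 : (1 + x ^ 2) ≠ 0 := by positivity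
  have h2 := ((hasDerivAt_pow 2 x).const_add 1).rpow_const (p := -(N : ℝ) - a) (Or.inl h1)
  refine h2.congr_deriv ?_
  rw [Real.rpow_sub_one h1, cauchyWeight]
  push_cast
  ring

theorem tendsto_pow_mul_cauchyWeight (ha : 0 < a) {k : ℕ} (hk : k ≤ 2 * n) :
    Tendsto (fun x => x ^ k * ((1 + x ^ 2) * cauchyWeight (n + 1) a x)) atBot (𝓝 0) := by
  have h1 : Tendsto (fun x : ℝ => (1 + x ^ 2) ^ (-a)) atBot (𝓝 0) := by
    refine (tendsto_rpow_neg_atTop ha).comp (tendsto_atTop_add_const_left _ _ ?_)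
    exact ((tendsto_pow_atTop (α := ℝ) two_ne_zero).comp tendsto_abs_atBot_atTop).congr sq_abs
  refine squeeze_zero_norm (fun x => ?_) h1
  have hk' : (k : ℝ) ≤ 2 * n := by exact_mod_cast hk
  have hx : 0 < 1 + x ^ 2 := by positivity
  rw [norm_mul, norm_pow, Real.norm_eq_abs,
    Real.norm_of_nonneg (mul_pos hx (cauchyWeight_pos _ _ _)).le]
  calc |x| ^ k * ((1 + x ^ 2) * cauchyWeight (n + 1) a x)
      ≤ (1 + x ^ 2) ^ ((k : ℝ) / 2) * ((1 + x ^ 2) * cauchyWeight (n + 1) a x) :=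
        mul_le_mul_of_nonneg_right (abs_pow_le_one_add_sq_rpow k x)
          (mul_pos hx (cauchyWeight_pos _ _ _)).le
    _ = (1 + x ^ 2) ^ ((k : ℝ) / 2 + (1 + (-((n + 1 : ℕ) : ℝ) - a))) := by
        rw [cauchyWeight, Real.rpow_add hx, Real.rpow_add hx, Real.rpow_one]
    _ ≤ (1 + x ^ 2) ^ (-a) := by
        refine Real.rpow_le_rpow_of_exponent_le (by nlinarith) ?_
        push_cast
        linarith

/-- The incomplete moments of the Cauchy weight. -/
noncomputable def cauchyMoment (N : ℕ) (a : ℝ) (k : ℕ) (s : ℝ) : ℝ :=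
  ∫ x in Iic s, x ^ k * cauchyWeight N a x

/-- Integration of `(x^k (1 + x²) w)'`; the boundary term at `-∞` vanishes for `k ≤ 2 n`. -/
theorem cauchyMoment_recursion (ha : 0 < a) {k : ℕ} (hk : k ≤ 2 * n) (s : ℝ) :
    (k - 2 * n - 2 * a) * cauchyMoment (n + 1) a (k + 1) s
      + k * cauchyMoment (n + 1) a (k - 1) s =
      s ^ k * ((1 + s ^ 2) * cauchyWeight (n + 1) a s) := by
  have i1 := ((integrable_pow_mul_cauchyWeight ha (n := n) (k := k + 1)
    (by omega)).const_mul ((k : ℝ) - 2 * n - 2 * a))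
  have i2 := ((integrable_pow_mul_cauchyWeight ha (n := n) (k := k - 1)
    (by omega)).const_mul (k : ℝ))
  have h := integral_Iic_of_hasDerivAt_of_tendsto' (a := s) (m := 0)
    (f := fun x => x ^ k * ((1 + x ^ 2) * cauchyWeight (n + 1) a x))
    (f' := fun x => ((k : ℝ) - 2 * n - 2 * a) * (x ^ (k + 1) * cauchyWeight (n + 1) a x)
      + k * (x ^ (k - 1) * cauchyWeight (n + 1) a x)) (fun x _ => ?_)
    (i1.add i2).integrableOn (tendsto_pow_mul_cauchyWeight ha hk)
  · rw [integral_add i1.integrableOn i2.integrableOn, integral_const_mul, integral_const_mul,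
      sub_zero] at h
    exact h
  · have hx : 1 + x ^ 2 ≠ 0 := by positivity
    have h1 := (hasDerivAt_pow k x).mul
      (((hasDerivAt_pow 2 x).const_add 1).mul (hasDerivAt_cauchyWeight (n + 1) a x))
    refine h1.congr_deriv ?_
    rcases k with _ | k
    · simp only [Pi.mul_apply]; push_cast; field_simp; ring
    · simp only [Pi.mul_apply]; push_cast; field_simp; ring

end realWeight

section complexWeight

/-- The strip `|Im z| < 1`, on which `1 + z²` avoids the cut of the complex power. -/
def unitStrip : Set ℂ := {z | |z.im| < 1}

theorem convex_unitStrip : Convex ℝ unitStrip := by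
  have : unitStrip = Complex.imLm ⁻¹' Ioo (-1) 1 := by
    ext z; simp [unitStrip, abs_lt]
  rw [this]
  exact (convex_Ioo _ _).linear_preimage _

theorem isOpen_unitStrip : IsOpen unitStrip :=
  isOpen_lt (by fun_prop) continuous_const

theorem one_add_sq_mem_slitPlane {z : ℂ} (hz : z ∈ unitStrip) : 1 + z ^ 2 ∈ Complex.slitPlane := by
  left
  have h : z.im ^ 2 < 1 := (sq_lt_one_iff_abs_lt_one _).2 hz
  simp [pow_two]
  nlinarith [sq_nonneg z.re]

theorem ofReal_mem_unitStrip (s : ℝ) : (s : ℂ) ∈ unitStrip := by simp [unitStrip]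

/-- The analytic continuation of the Cauchy weight to `unitStrip`. -/
noncomputable def complexWeight (N : ℕ) (a : ℝ) (z : ℂ) : ℂ := (1 + z ^ 2) ^ (-(N : ℂ) - a)

theorem complexWeight_ofReal (N : ℕ) (a s : ℝ) : complexWeight N a s = cauchyWeight N a s := by
  rw [complexWeight, cauchyWeight, Complex.ofReal_cpow (by positivity)]
  push_cast
  rfl

theorem hasDerivAt_complexWeight (N : ℕ) (a : ℝ) {z : ℂ} (hz : z ∈ unitStrip) :
    HasDerivAt (complexWeight N a) (-2 * (N + a) * z * complexWeight N a z / (1 + z ^ 2)) z := by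
  have h0 := one_add_sq_mem_slitPlane hz
  have h1 : (1 + z ^ 2) ≠ 0 := Complex.slitPlane_ne_zero h0
  have h2 := ((hasDerivAt_pow 2 z).const_add 1).cpow_const (c := -(N : ℂ) - a) h0
  refine h2.congr_deriv ?_
  rw [Complex.cpow_sub _ _ h1, complexWeight, Complex.cpow_one]
  push_cast
  ring

/-- An incomplete moment continues to the strip, as a primitive on a convex set. -/
theorem exists_complexMoment (n : ℕ) {a : ℝ} (ha : 0 < a) {k : ℕ} (hk : k ≤ 2 * n + 1) :
    ∃ g : ℂ → ℂ, (∀ z ∈ unitStrip, HasDerivAt g (z ^ k * complexWeight (n + 1) a z) z) ∧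
      ∀ s : ℝ, g s = cauchyMoment (n + 1) a k s := by
  have hd : DifferentiableOn ℂ (fun z => z ^ k * complexWeight (n + 1) a z) unitStrip :=
    fun z hz => ((differentiableAt_pow k).mul
      (hasDerivAt_complexWeight (n + 1) a hz).differentiableAt).differentiableWithinAt
  obtain ⟨g, hg⟩ := convex_unitStrip.exists_forall_hasDerivWithinAt hd
  have hg' : ∀ z ∈ unitStrip, HasDerivAt g (z ^ k * complexWeight (n + 1) a z) z :=
    fun z hz => (hg z hz).hasDerivAt (isOpen_unitStrip.mem_nhds hz)
  refine ⟨fun z => g z - g 0 + cauchyMoment (n + 1) a k 0,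
    fun z hz => ((hg' z hz).sub_const _).add_const _, fun s => ?_⟩
  have h1 : ∀ x ∈ uIcc 0 s, HasDerivAt (fun x : ℝ => g x)
      (((x ^ k * cauchyWeight (n + 1) a x : ℝ) : ℂ)) x := fun x _ => by
    have := (hg' x (ofReal_mem_unitStrip x)).comp_ofReal
    rw [complexWeight_ofReal] at this
    push_cast
    exact this
  have hc : Continuous fun x => x ^ k * cauchyWeight (n + 1) a x :=
    (continuous_pow k).mul (continuous_cauchyWeight _ _)
  have h2 := intervalIntegral.integral_eq_sub_of_hasDerivAt h1
    ((Complex.continuous_ofReal.comp hc).intervalIntegrable 0 s)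
  have hi := integrable_pow_mul_cauchyWeight ha hk
  rw [intervalIntegral.integral_ofReal, ← intervalIntegral.integral_Iic_sub_Iic hi.integrableOn
    hi.integrableOn] at h2
  push_cast at h2
  simp only [cauchyMoment]
  linear_combination -h2

theorem exists_complexMoments (n : ℕ) {a : ℝ} (ha : 0 < a) :
    ∃ m : ℕ → ℂ → ℂ, (∀ k (s : ℝ), k ≤ 2 * n + 1 → m k s = cauchyMoment (n + 1) a k s) ∧
      (∀ k ≤ 2 * n + 1, DifferentiableOn ℂ (m k) unitStrip) ∧
      ∀ Ω ⊆ unitStrip, (∀ z ∈ Ω, (hankelMatrix n m z).det ≠ 0) →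
        IsCauchyMoments n a m (complexWeight (n + 1) a) Ω := by
  have h : ∀ k, ∃ g : ℂ → ℂ, k ≤ 2 * n + 1 →
      (∀ z ∈ unitStrip, HasDerivAt g (z ^ k * complexWeight (n + 1) a z) z) ∧
      ∀ s : ℝ, g s = cauchyMoment (n + 1) a k s := fun k => by
    by_cases hk : k ≤ 2 * n + 1
    · obtain ⟨g, hg⟩ := exists_complexMoment n ha hk
      exact ⟨g, fun _ => hg⟩
    · exact ⟨0, fun h => absurd h hk⟩
  choose m hm using h
  refine ⟨m, fun k s hk => (hm k hk).2 s, fun k hk z hz =>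
      ((hm k hk).1 z hz).differentiableAt.differentiableWithinAt, fun Ω hΩ hdet =>
    ⟨fun z hz k hk => (hm k hk).1 z (hΩ hz),
    fun z hz => ⟨_, hasDerivAt_complexWeight (n + 1) a (hΩ hz), ?_⟩, fun z hz k hk => ?_,
    hdet⟩⟩
  · have := Complex.slitPlane_ne_zero (one_add_sq_mem_slitPlane (hΩ hz))
    push_cast
    field_simp
  · -- the difference of the two sides has derivative zero on the strip and vanishes at the origin
    set F : ℂ → ℂ := fun z => ((k : ℂ) - 2 * n - 2 * a) * m (k + 1) z + k * m (k - 1) z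
      - z ^ k * ((1 + z ^ 2) * complexWeight (n + 1) a z) with hF
    have hF' : ∀ z ∈ unitStrip, HasDerivAt F 0 z := fun z hz => by
      have h0 := Complex.slitPlane_ne_zero (one_add_sq_mem_slitPlane hz)
      have h1 := ((((hm (k + 1) (by omega)).1 z hz).const_mul ((k : ℂ) - 2 * n - 2 * a)).add
        (((hm (k - 1) (by omega)).1 z hz).const_mul (k : ℂ))).sub
        ((hasDerivAt_pow k z).mul
          (((hasDerivAt_pow 2 z).const_add 1).mul (hasDerivAt_complexWeight (n + 1) a hz)))
      refine h1.congr_deriv ?_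
      rcases k with _ | k
      · simp only [Pi.mul_apply]; push_cast; field_simp; ring
      · simp only [Pi.mul_apply]; push_cast; field_simp; ring
    have hF0 : F 0 = 0 := by
      have h1 := cauchyMoment_recursion ha hk 0
      have h2 := congrArg (fun x : ℝ => (x : ℂ)) h1
      have e1 := (hm (k + 1) (by omega)).2 0
      have e2 := (hm (k - 1) (by omega)).2 0
      have e3 := complexWeight_ofReal (n + 1) a 0
      simp only [Complex.ofReal_zero] at e1 e2 e3
      simp only [hF, e1, e2, e3]
      push_cast at h2
      linear_combination h2
    have hc := convex_unitStrip.is_const_of_fderivWithin_eq_zero (𝕜 := ℂ) (f := F)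
      (fun z hz => (hF' z hz).differentiableAt.differentiableWithinAt) (fun z hz => by
        rw [fderivWithin_of_isOpen isOpen_unitStrip hz]
        simpa using (hF' z hz).hasFDerivAt.fderiv) (hΩ hz) (by simpa using ofReal_mem_unitStrip 0)
    rw [hF0] at hc
    exact sub_eq_zero.1 hc

end complexWeight

end CauchyWeight

/-! ### Gram matrices and orthonormal polynomials -/

section GramMatrices
open Matrix MeasureTheory Set Filter Topology

/-- The vector `(1, x, …, xⁿ)` of real numbers. -/
def powers (n : ℕ) (x : ℝ) : Fin (n + 1) → ℝ := fun i => x ^ (i : ℕ)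

/-- The Gram matrix of the monomials of degree at most `n` for the weight `w` on `S`. -/
noncomputable def gramMatrix (n : ℕ) (w : ℝ → ℝ) (S : Set ℝ) :
    Matrix (Fin (n + 1)) (Fin (n + 1)) ℝ :=
  of fun i j => ∫ x in S, x ^ ((i : ℕ) + j) * w x

/-- The coefficients of `1, X, …, Xⁿ` in a polynomial. -/
noncomputable def coeffVec (n : ℕ) : ℝ[X] →ₗ[ℝ] Fin (n + 1) → ℝ :=
  LinearMap.pi fun i => Polynomial.lcoeff ℝ i

theorem coeffVec_dotProduct_powers {n : ℕ} {P : ℝ[X]} (hP : P.natDegree ≤ n) (x : ℝ) :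
    coeffVec n P ⬝ᵥ powers n x = P.eval x := by
  rw [Polynomial.eval_eq_sum_range' (Nat.lt_succ_of_le hP), ← Fin.sum_univ_eq_sum_range
    (fun i => P.coeff i * x ^ i)]
  rfl

/-- A positive continuous weight for which products of polynomials of degree at most `n` are
integrable. -/
structure IsMomentWeight (n : ℕ) (w : ℝ → ℝ) : Prop where
  pos : ∀ x, 0 < w x
  continuous : Continuous w
  integrable : ∀ k ≤ 2 * n, Integrable fun x => x ^ k * w x

theorem isMomentWeight_cauchyWeight (n : ℕ) {a : ℝ} (ha : 0 < a) :
    IsMomentWeight n (cauchyWeight (n + 1) a) :=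
  ⟨cauchyWeight_pos _ _, continuous_cauchyWeight _ _,
    fun _ hk => integrable_pow_mul_cauchyWeight ha (by omega)⟩

namespace IsMomentWeight
variable {n : ℕ} {w : ℝ → ℝ} {S : Set ℝ}

theorem dot_mul_dot_mul (u v : Fin (n + 1) → ℝ) (x : ℝ) :
    (u ⬝ᵥ powers n x) * (v ⬝ᵥ powers n x) * w x =
      ∑ i, ∑ j, u i * v j * (x ^ ((i : ℕ) + j) * w x) := by
  simp only [dotProduct, Finset.sum_mul_sum, powers]
  rw [Finset.sum_mul]
  refine Finset.sum_congr rfl fun i _ => ?_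
  rw [Finset.sum_mul]
  refine Finset.sum_congr rfl fun j _ => ?_
  ring

theorem gramMatrix_symm (S : Set ℝ) : (gramMatrix n w S)ᵀ = gramMatrix n w S := by
  ext i j
  simp [gramMatrix, add_comm]

variable (h : IsMomentWeight n w)
include h

theorem integrable_dot (u v : Fin (n + 1) → ℝ) :
    Integrable fun x => (u ⬝ᵥ powers n x) * (v ⬝ᵥ powers n x) * w x := by
  simp only [dot_mul_dot_mul]
  exact integrable_finsetSum _ fun i _ => integrable_finsetSum _ fun j _ =>
    (h.integrable _ (by omega)).const_mul _

theorem integral_dot (S : Set ℝ) (u v : Fin (n + 1) → ℝ) :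
    ∫ x in S, (u ⬝ᵥ powers n x) * (v ⬝ᵥ powers n x) * w x = u ⬝ᵥ gramMatrix n w S *ᵥ v := by
  simp only [dot_mul_dot_mul]
  have hi : ∀ i j : Fin (n + 1),
      Integrable (fun x => u i * v j * (x ^ ((i : ℕ) + j) * w x)) (volume.restrict S) :=
    fun i j => ((h.integrable _ (by omega)).const_mul _).integrableOn
  rw [integral_finsetSum _ fun i _ => integrable_finsetSum _ fun j _ => hi i j]
  simp only [integral_finsetSum _ fun j _ => hi _ j, integral_const_mul, dotProduct, mulVec,
    Finset.mul_sum, gramMatrix, of_apply]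
  refine Finset.sum_congr rfl fun i _ => Finset.sum_congr rfl fun j _ => ?_
  ring

theorem posDef_gramMatrix (hS : volume S ≠ 0) : (gramMatrix n w S).PosDef := by
  refine PosDef.of_dotProduct_mulVec_pos ?_ fun u hu => ?_
  · rw [IsHermitian, conjTranspose_eq_transpose_of_trivial, gramMatrix_symm]
  · rw [star_trivial, ← h.integral_dot, integral_pos_iff_support_of_nonneg_ae
      (Eventually.of_forall fun x => mul_nonneg (mul_self_nonneg _) (h.pos x).le)
      (h.integrable_dot u u).integrableOn]
    -- a nonzero polynomial has finitely many zeros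
    set P : ℝ[X] := ∑ i : Fin (n + 1), Polynomial.C (u i) * Polynomial.X ^ (i : ℕ) with hP
    have hPx : ∀ x, P.eval x = u ⬝ᵥ powers n x := fun x => by
      simp [hP, Polynomial.eval_finsetSum, dotProduct, powers]
    have hP0 : P ≠ 0 := fun h0 => hu <| by
      ext i
      have := congrArg (fun p => p.coeff i) h0
      simpa [hP, Polynomial.finsetSum_coeff, Polynomial.coeff_C_mul, Polynomial.coeff_X_pow,
        Fin.val_inj] using this
    have hfin : (P.rootSet ℝ).Finite := Polynomial.rootSet_finite P ℝ
    rw [pos_iff_ne_zero]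
    intro h0
    refine hS ?_
    have hsub : S ⊆ (Function.support fun x => (u ⬝ᵥ powers n x) * (u ⬝ᵥ powers n x) * w x) ∩ S ∪
        P.rootSet ℝ := fun x hx => by
      by_cases hr : P.eval x = 0
      · exact Or.inr ((Polynomial.mem_rootSet_of_ne hP0).2 (by simpa using hr))
      · rw [hPx] at hr
        exact Or.inl ⟨mul_ne_zero (mul_ne_zero hr hr) (h.pos x).ne', hx⟩
    refine measure_mono_null hsub (measure_union_null ?_ (hfin.measure_zero _))
    exact le_antisymm ((Measure.le_restrict_apply _ _).trans_eq h0) bot_le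

theorem gramMatrix_Iic_add_Ioi (s : ℝ) :
    gramMatrix n w (Iic s) + gramMatrix n w (Ioi s) = gramMatrix n w univ := by
  ext i j
  simp only [gramMatrix, Matrix.add_apply, of_apply, Measure.restrict_univ]
  rw [← compl_Iic]
  exact integral_add_compl measurableSet_Iic (h.integrable _ (by omega))

theorem weightInner_eq {P Q : ℝ[X]} (hP : P.natDegree ≤ n) (hQ : Q.natDegree ≤ n) :
    weightInner w P Q = coeffVec n P ⬝ᵥ gramMatrix n w univ *ᵥ coeffVec n Q := by
  rw [← h.integral_dot, weightInner, Measure.restrict_univ]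
  simp only [coeffVec_dotProduct_powers hP, coeffVec_dotProduct_powers hQ]

theorem weightInner_self_pos {P : ℝ[X]} (hP : P.natDegree ≤ n) (h0 : P ≠ 0) :
    0 < weightInner w P P := by
  rw [h.weightInner_eq hP hP]
  have := (h.posDef_gramMatrix (S := univ) (by simp)).dotProduct_mulVec_pos (x := coeffVec n P)
    (fun hc => h0 ?_)
  · simpa using this
  · ext k
    by_cases hk : k < n + 1
    · exact congrFun hc ⟨k, hk⟩
    · exact Polynomial.coeff_eq_zero_of_natDegree_lt (by omega)

theorem monicOrthoPoly_spec (k : ℕ) (hk : k ≤ n) :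
    (monicOrthoPoly w k).Monic ∧ (monicOrthoPoly w k).natDegree = k ∧
      ∀ j < k, weightInner w (monicOrthoPoly w k) (monicOrthoPoly w j) = 0 := by
  induction k using Nat.strong_induction_on with
  | _ k ih =>
    have hlt : (∑ j : Fin k, Polynomial.C (weightInner w (Polynomial.X ^ k) (monicOrthoPoly w j) /
        weightInner w (monicOrthoPoly w j) (monicOrthoPoly w j)) * monicOrthoPoly w j).degree <
        (k : WithBot ℕ) := by
      refine (Polynomial.degree_sum_le _ _).trans_lt ((Finset.sup_lt_iff (WithBot.bot_lt_coe k)).2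
        fun j _ => ?_)
      obtain ⟨hm, hd, -⟩ := ih j j.2 (by omega)
      refine (Polynomial.degree_mul_le _ _).trans_lt ?_
      rw [Polynomial.degree_eq_natDegree hm.ne_zero, hd]
      refine lt_of_le_of_lt (add_le_add_left Polynomial.degree_C_le _) ?_
      rw [zero_add]
      exact WithBot.coe_lt_coe.2 j.2
    have hm : (monicOrthoPoly w k).Monic := by
      rw [monicOrthoPoly]
      exact Polynomial.monic_X_pow_sub hlt
    have hd : (monicOrthoPoly w k).natDegree = k := by
      refine Polynomial.natDegree_eq_of_degree_eq_some ?_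
      rw [monicOrthoPoly, Polynomial.degree_sub_eq_left_of_degree_lt, Polynomial.degree_X_pow]
      rwa [Polynomial.degree_X_pow]
    refine ⟨hm, hd, fun j hj => ?_⟩
    have hdeg : ∀ i < k, (monicOrthoPoly w i).natDegree ≤ n := fun i hi => by
      rw [(ih i hi (by omega)).2.1]; omega
    have horth : ∀ i : Fin k, (i : ℕ) ≠ j →
        weightInner w (monicOrthoPoly w i) (monicOrthoPoly w j) = 0 := fun i hi => by
      rcases lt_or_gt_of_ne hi with hij | hij
      · have := (ih j hj (by omega)).2.2 i hij
        rw [← this]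
        simp only [weightInner, mul_comm (Polynomial.eval _ (monicOrthoPoly w i))]
      · exact (ih i i.2 (by omega)).2.2 j hij
    rw [h.weightInner_eq (hd.le.trans hk) (hdeg j hj), monicOrthoPoly, map_sub, map_sum,
      sub_dotProduct, sum_dotProduct, Finset.sum_eq_single ⟨j, hj⟩]
    · rw [Polynomial.C_mul', map_smul, smul_dotProduct,
        ← h.weightInner_eq (hdeg j hj) (hdeg j hj), ← h.weightInner_eq
          (by simpa using hk) (hdeg j hj), smul_eq_mul, div_mul_cancel₀, sub_self]
      exact (h.weightInner_self_pos (hdeg j hj) (ih j hj (by omega)).1.ne_zero).ne'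
    · intro i _ hi
      rw [Polynomial.C_mul', map_smul, smul_dotProduct,
        ← h.weightInner_eq (hdeg i i.2) (hdeg j hj), horth i (fun hc => hi (Fin.ext hc)), smul_zero]
    · simp

theorem natDegree_orthonormalPoly_le {k : ℕ} (hk : k ≤ n) : (orthonormalPoly w k).natDegree ≤ n :=
  (Polynomial.natDegree_C_mul_le _ _).trans ((h.monicOrthoPoly_spec k hk).2.1.le.trans hk)

theorem weightInner_orthonormalPoly {k l : ℕ} (hk : k ≤ n) (hl : l ≤ n) :
    weightInner w (orthonormalPoly w k) (orthonormalPoly w l) = if k = l then 1 else 0 := by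
  obtain ⟨mk, dk, ok⟩ := h.monicOrthoPoly_spec k hk
  obtain ⟨-, dl, ol⟩ := h.monicOrthoPoly_spec l hl
  have hs : ∀ P Q, weightInner w P Q = weightInner w Q P := fun P Q => by
    simp only [weightInner, mul_comm (Polynomial.eval _ P)]
  rw [h.weightInner_eq (h.natDegree_orthonormalPoly_le hk) (h.natDegree_orthonormalPoly_le hl),
    orthonormalPoly, orthonormalPoly, Polynomial.C_mul', Polynomial.C_mul', map_smul, map_smul,
    mulVec_smul, smul_dotProduct, dotProduct_smul,
    ← h.weightInner_eq (dk.le.trans hk) (dl.le.trans hl)]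
  split_ifs with hkl
  · subst hkl
    have hp := h.weightInner_self_pos (dk.le.trans hk) mk.ne_zero
    have hq := Real.sqrt_pos.2 hp
    rw [smul_eq_mul, smul_eq_mul]
    field_simp
    rw [Real.sq_sqrt hp.le]
  · rcases lt_or_gt_of_ne hkl with h1 | h1
    · rw [hs (monicOrthoPoly w k) (monicOrthoPoly w l), ol k h1, smul_zero, smul_zero]
    · rw [ok l h1, smul_zero, smul_zero]

/-- The reproducing kernel of the polynomials of degree at most `n` is the inverse Gram matrix. -/
theorem sum_orthonormalPoly (x y : ℝ) :
    ∑ l ∈ Finset.range (n + 1), (orthonormalPoly w l).eval x * (orthonormalPoly w l).eval y =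
      powers n x ⬝ᵥ (gramMatrix n w univ)⁻¹ *ᵥ powers n y := by
  set C : Matrix (Fin (n + 1)) (Fin (n + 1)) ℝ := of fun l => coeffVec n (orthonormalPoly w l)
    with hC
  have h1 : C * gramMatrix n w univ * Cᵀ = 1 := by
    ext k l
    have := h.weightInner_orthonormalPoly (Nat.le_of_lt_succ k.2) (Nat.le_of_lt_succ l.2)
    rw [h.weightInner_eq (h.natDegree_orthonormalPoly_le (Nat.le_of_lt_succ k.2))
      (h.natDegree_orthonormalPoly_le (Nat.le_of_lt_succ l.2))] at this
    simp only [Fin.val_inj] at this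
    rw [one_apply, Matrix.mul_assoc, ← this]
    rfl
  have h2 : (gramMatrix n w univ)⁻¹ = Cᵀ * C := by
    refine inv_eq_left_inv ?_
    rw [Matrix.mul_assoc]
    exact mul_eq_one_comm.1 h1
  rw [h2, ← mulVec_mulVec, dotProduct_mulVec, vecMul_transpose, ← Fin.sum_univ_eq_sum_range
    (fun l => (orthonormalPoly w l).eval x * (orthonormalPoly w l).eval y)]
  refine Finset.sum_congr rfl fun l _ => ?_
  rw [← coeffVec_dotProduct_powers (h.natDegree_orthonormalPoly_le (Nat.le_of_lt_succ l.2)),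
    ← coeffVec_dotProduct_powers (h.natDegree_orthonormalPoly_le (Nat.le_of_lt_succ l.2))]
  rfl

end IsMomentWeight

end GramMatrices

/-! ### The resolvent kernel and its continuation -/

section Resolvent
open Matrix MeasureTheory Set Filter Topology

namespace IsMomentWeight
variable {n : ℕ} {w : ℝ → ℝ}

/-- The kernel `√(w x) √(w y) v(x)ᵀ A v(y)` of finite rank, with `v(x) = (1, x, …, xⁿ)`. -/
noncomputable def rankKernel (n : ℕ) (w : ℝ → ℝ) (A : Matrix (Fin (n + 1)) (Fin (n + 1)) ℝ)
    (x y : ℝ) : ℝ :=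
  √(w x) * √(w y) * (powers n x ⬝ᵥ A *ᵥ powers n y)

variable (h : IsMomentWeight n w)
include h

theorem memLp_dot (S : Set ℝ) (u : Fin (n + 1) → ℝ) :
    MemLp (fun z => √(w z) * (u ⬝ᵥ powers n z)) 2 (volume.restrict S) := by
  have hc : Continuous fun z => √(w z) * (u ⬝ᵥ powers n z) := by
    refine h.continuous.sqrt.mul ?_
    unfold dotProduct powers
    fun_prop
  refine (memLp_two_iff_integrable_sq hc.aestronglyMeasurable).2 ?_
  refine (h.integrable_dot u u).integrableOn.congr (Eventually.of_forall fun z => ?_)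
  simp only [mul_pow, Real.sq_sqrt (h.pos z).le]
  ring

theorem integral_rankKernel_mul (S : Set ℝ) (A B : Matrix (Fin (n + 1)) (Fin (n + 1)) ℝ)
    (x y : ℝ) : ∫ z in S, rankKernel n w A x z * rankKernel n w B z y =
      rankKernel n w (A * gramMatrix n w S * B) x y := by
  have h1 : ∀ z, rankKernel n w A x z * rankKernel n w B z y = √(w x) * √(w y) *
      (((powers n x ᵥ* A) ⬝ᵥ powers n z) * ((B *ᵥ powers n y) ⬝ᵥ powers n z) * w z) := fun z => by
    rw [rankKernel, rankKernel, dotProduct_mulVec, dotProduct_comm (B *ᵥ powers n y)]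
    nth_rewrite 3 [← Real.mul_self_sqrt (h.pos z).le]
    ring
  simp only [h1]
  rw [integral_const_mul, h.integral_dot, rankKernel, ← dotProduct_mulVec, mulVec_mulVec,
    mulVec_mulVec, Matrix.mul_assoc]

theorem isUnit_det_gramMatrix {S : Set ℝ} (hS : volume S ≠ 0) : IsUnit (gramMatrix n w S).det :=
  (isUnit_iff_isUnit_det _).1 (h.posDef_gramMatrix hS).isUnit

theorem resolvent_identities (s : ℝ) :
    (gramMatrix n w univ)⁻¹ + (gramMatrix n w univ)⁻¹ * gramMatrix n w (Ioi s) *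
        (gramMatrix n w (Iic s))⁻¹ = (gramMatrix n w (Iic s))⁻¹ ∧
    (gramMatrix n w univ)⁻¹ + (gramMatrix n w (Iic s))⁻¹ * gramMatrix n w (Ioi s) *
        (gramMatrix n w univ)⁻¹ = (gramMatrix n w (Iic s))⁻¹ := by
  have h1 := h.isUnit_det_gramMatrix (S := univ) (by simp)
  have h2 := h.isUnit_det_gramMatrix (S := Iic s) (by simp)
  have h3 : gramMatrix n w (Ioi s) = gramMatrix n w univ - gramMatrix n w (Iic s) := by
    rw [← h.gramMatrix_Iic_add_Ioi s]; abel
  constructor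
  · rw [h3, Matrix.mul_sub, Matrix.sub_mul, nonsing_inv_mul _ h1, Matrix.mul_assoc,
      mul_nonsing_inv _ h2, Matrix.one_mul, Matrix.mul_one]
    abel
  · rw [h3, Matrix.mul_sub, Matrix.sub_mul, nonsing_inv_mul _ h2, Matrix.mul_assoc,
      mul_nonsing_inv _ h1, Matrix.one_mul, Matrix.mul_one]
    abel

theorem isResolventKernel (s : ℝ) :
    IsResolventKernel (Ioi s) (rankKernel n w (gramMatrix n w univ)⁻¹)
      (rankKernel n w (gramMatrix n w (Iic s))⁻¹) := by
  have hadd : ∀ (A B : Matrix (Fin (n + 1)) (Fin (n + 1)) ℝ) x y,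
      rankKernel n w A x y + rankKernel n w B x y = rankKernel n w (A + B) x y :=
    fun A B x y => by
      simp only [rankKernel, add_mulVec, dotProduct_add]; ring
  obtain ⟨r1, r2⟩ := h.resolvent_identities s
  refine ⟨fun y => ?_, fun x => ?_, fun x y => ?_, fun x y => ?_⟩
  · refine ((h.memLp_dot (Ioi s) ((gramMatrix n w (Iic s))⁻¹ *ᵥ powers n y)).const_mul
      (√(w y))).ae_eq (Eventually.of_forall fun z => ?_)
    simp only [rankKernel]
    rw [dotProduct_comm]; ring
  · refine ((h.memLp_dot (Ioi s) (powers n x ᵥ* (gramMatrix n w (Iic s))⁻¹)).const_mul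
      (√(w x))).ae_eq (Eventually.of_forall fun z => ?_)
    simp only [rankKernel]
    rw [dotProduct_mulVec]; ring
  · rw [h.integral_rankKernel_mul, hadd, r1]
  · rw [h.integral_rankKernel_mul, hadd, r2]

/-- A resolvent kernel is unique: the resolvent equation forces `R x ·` into the finite-dimensional
range of the kernel, where it becomes an invertible linear system. -/
theorem eq_of_isResolventKernel {s : ℝ} {R : ℝ → ℝ → ℝ}
    (hR : IsResolventKernel (Ioi s) (rankKernel n w (gramMatrix n w univ)⁻¹) R) (x y : ℝ) :
    R x y = rankKernel n w (gramMatrix n w (Iic s))⁻¹ x y := by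
  set A := (gramMatrix n w univ)⁻¹ with hA
  set J := gramMatrix n w (Ioi s) with hJ
  set B := (gramMatrix n w (Iic s))⁻¹ with hB
  -- the coefficients of `R x ·` against the functions `√w zʲ`
  set c : Fin (n + 1) → ℝ := fun j => ∫ z in Ioi s, R x z * (√(w z) * z ^ (j : ℕ)) with hc
  have hi : ∀ u : Fin (n + 1) → ℝ, Integrable (fun z => R x z * (√(w z) * (u ⬝ᵥ powers n z)))
      (volume.restrict (Ioi s)) := fun u => (hR.memLp_right x).integrable_mul (h.memLp_dot _ u)
  have hlin : ∀ u : Fin (n + 1) → ℝ,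
      ∫ z in Ioi s, R x z * (√(w z) * (u ⬝ᵥ powers n z)) = u ⬝ᵥ c := fun u => by
    have hz : ∀ z, R x z * (√(w z) * (u ⬝ᵥ powers n z)) =
        ∑ j, u j * (R x z * (√(w z) * z ^ (j : ℕ))) := fun z => by
      simp only [dotProduct, powers, Finset.mul_sum]
      exact Finset.sum_congr rfl fun j _ => by ring
    simp only [hz]
    have hj : ∀ j : Fin (n + 1), Integrable (fun z => u j * (R x z * (√(w z) * z ^ (j : ℕ))))
        (volume.restrict (Ioi s)) := fun j => Integrable.const_mul
      (by simpa [powers] using hi (Pi.single j 1)) _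
    rw [integral_finsetSum _ fun j _ => hj j]
    simp only [integral_const_mul, dotProduct, hc]
  have hRx : ∀ y, R x y = √(w y) * ((√(w x) • powers n x + c) ⬝ᵥ A *ᵥ powers n y) := fun y => by
    rw [hR.eq_right x y]
    have hz : ∀ z, R x z * rankKernel n w A z y =
        √(w y) * (R x z * (√(w z) * ((A *ᵥ powers n y) ⬝ᵥ powers n z))) := fun z => by
      rw [rankKernel, dotProduct_comm]; ring
    simp only [hz]
    rw [integral_const_mul, hlin, rankKernel, add_dotProduct, smul_dotProduct,
      dotProduct_comm _ c, smul_eq_mul]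
    ring
  set u := √(w x) • powers n x + c with hu
  have hcu : ∀ v, v ⬝ᵥ c = (u ᵥ* A) ⬝ᵥ J *ᵥ v := fun v => by
    rw [← hlin, hJ, ← h.integral_dot]
    refine integral_congr_ae (Eventually.of_forall fun z => ?_)
    simp only
    rw [hRx, ← dotProduct_mulVec]
    nth_rewrite 3 [← Real.mul_self_sqrt (h.pos z).le]
    ring
  -- hence `(1 - A J) u = √w(x) v(x)`, which determines `u`
  have h1 := h.isUnit_det_gramMatrix (S := univ) (by simp)
  have h2 := h.isUnit_det_gramMatrix (S := Iic s) (by simp)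
  have h3 : J = gramMatrix n w univ - gramMatrix n w (Iic s) := by
    rw [← h.gramMatrix_Iic_add_Ioi s]; abel
  have hfin := hcu (B *ᵥ powers n y)
  rw [h3, sub_mulVec, mulVec_mulVec _ (gramMatrix n w (Iic s)), hB, mul_nonsing_inv _ h2,
    one_mulVec, dotProduct_sub, ← dotProduct_mulVec, mulVec_mulVec, mulVec_mulVec, hA,
    nonsing_inv_mul _ h1, Matrix.one_mul, ← dotProduct_mulVec, ← hA, ← hB,
    hu, add_dotProduct, smul_dotProduct, ← hu, dotProduct_comm _ c] at hfin
  rw [hRx, rankKernel]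
  rw [smul_eq_mul] at hfin
  linear_combination √(w y) * hfin

theorem resolventKernel_eq (s : ℝ) :
    resolventKernel (Ioi s) (rankKernel n w (gramMatrix n w univ)⁻¹) =
      rankKernel n w (gramMatrix n w (Iic s))⁻¹ := by
  have hex : ∃ R, IsResolventKernel (Ioi s) (rankKernel n w (gramMatrix n w univ)⁻¹) R :=
    ⟨_, h.isResolventKernel s⟩
  rw [resolventKernel, dif_pos hex]
  ext x y
  exact h.eq_of_isResolventKernel (Classical.choose_spec hex) x y

end IsMomentWeight

theorem cauchyKernel_eq (n : ℕ) {a : ℝ} (ha : 0 < a) : cauchyKernel (n + 1) a =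
    IsMomentWeight.rankKernel n (cauchyWeight (n + 1) a)
      (gramMatrix n (cauchyWeight (n + 1) a) univ)⁻¹ := by
  ext x y
  rw [cauchyKernel, (isMomentWeight_cauchyWeight n ha).sum_orthonormalPoly,
    Real.sqrt_mul (cauchyWeight_pos _ _ _).le]
  rfl

theorem cauchySigma_eq (n : ℕ) {a : ℝ} (ha : 0 < a) (s : ℝ) : cauchySigma (n + 1) a s =
    (1 + s ^ 2) * cauchyWeight (n + 1) a s *
      (powers n s ⬝ᵥ (gramMatrix n (cauchyWeight (n + 1) a) (Iic s))⁻¹ *ᵥ powers n s) := by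
  rw [cauchySigma, cauchyKernel_eq n ha, (isMomentWeight_cauchyWeight n ha).resolventKernel_eq,
    IsMomentWeight.rankKernel, Real.mul_self_sqrt (cauchyWeight_pos _ _ _).le, mul_assoc]

theorem cauchySigma_pos (n : ℕ) {a : ℝ} (ha : 0 < a) (s : ℝ) : 0 < cauchySigma (n + 1) a s := by
  rw [cauchySigma_eq n ha]
  have h1 := ((isMomentWeight_cauchyWeight n ha).posDef_gramMatrix
    (S := Iic s) (by simp)).inv.dotProduct_mulVec_pos (x := powers n s)
    (fun h => one_ne_zero (by simpa [powers] using congrFun h 0 : (1 : ℝ) = 0))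
  rw [star_trivial] at h1
  have := cauchyWeight_pos (n + 1) a s
  positivity

theorem hankelMatrix_ofReal {n : ℕ} {a : ℝ} {m : ℕ → ℂ → ℂ}
    (hm : ∀ k (s : ℝ), k ≤ 2 * n + 1 → m k s = cauchyMoment (n + 1) a k s) (s : ℝ) :
    hankelMatrix n m s =
      (gramMatrix n (cauchyWeight (n + 1) a) (Iic s)).map (Complex.ofRealHom : ℝ → ℂ) := by
  ext i j
  simp only [hankelMatrix, of_apply, map_apply, hm (i + j) s (by omega)]
  rfl

theorem hankelSigma_ofReal {n : ℕ} {a : ℝ} (ha : 0 < a) {m : ℕ → ℂ → ℂ}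
    (hm : ∀ k (s : ℝ), k ≤ 2 * n + 1 → m k s = cauchyMoment (n + 1) a k s) (s : ℝ) :
    hankelSigma n m (complexWeight (n + 1) a) s = cauchySigma (n + 1) a s := by
  have hG := (isMomentWeight_cauchyWeight n ha).isUnit_det_gramMatrix (S := Iic s) (by simp)
  have hinv : (hankelMatrix n m s)⁻¹ = (gramMatrix n (cauchyWeight (n + 1) a) (Iic s))⁻¹.map
      (Complex.ofRealHom : ℝ → ℂ) := by
    refine inv_eq_left_inv ?_
    rw [hankelMatrix_ofReal hm, ← Matrix.map_mul, nonsing_inv_mul _ hG]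
    exact Matrix.map_one _ (map_zero _) (map_one _)
  have hp : powVec n (s : ℂ) = Complex.ofRealHom ∘ powers n s := by
    ext i; simp [powVec, powers]
  rw [hankelSigma, hinv, hp, complexWeight_ofReal, cauchySigma_eq n ha]
  push_cast
  congr 1
  rw [← Complex.ofRealHom_eq_coe (_ ⬝ᵥ _), RingHom.map_dotProduct]
  congr 1
  ext i
  rw [Function.comp_apply, RingHom.map_mulVec]

/-- The function `σ` continues to a connected neighbourhood of the line, with its differential
equation. -/
theorem exists_sigma_continuation (n : ℕ) {a : ℝ} (ha : 0 < a) :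
    ∃ (σ : ℂ → ℂ) (Ω : Set ℂ), IsOpen Ω ∧ IsConnected Ω ∧ Ω ⊆ unitStrip ∧
      (∀ s : ℝ, (s : ℂ) ∈ Ω) ∧ (∀ s : ℝ, σ s = cauchySigma (n + 1) a s) ∧
      AnalyticOnNhd ℂ σ Ω ∧ ∀ z ∈ Ω,
      ((1 + z ^ 2) * deriv (deriv σ) z) ^ 2 + 4 * (1 + z ^ 2) * deriv σ z ^ 3
      - 8 * z * σ z * deriv σ z ^ 2
      + 4 * σ z ^ 2 * (deriv σ z - a ^ 2) + 8 * a ^ 2 * z * σ z * deriv σ z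
      + 4 * ((n + 1) * (n + 1 + 2 * a) - a ^ 2 * z ^ 2) * deriv σ z ^ 2 = 0 := by
  obtain ⟨m, hm, hd, hΩ⟩ := exists_complexMoments n ha
  set D : Set ℂ := unitStrip ∩ (fun z => (hankelMatrix n m z).det) ⁻¹' {0}ᶜ with hD
  have hcont : ContinuousOn (fun z => (hankelMatrix n m z).det) unitStrip := by
    simp only [det_apply]
    refine continuousOn_finsetSum _ fun p _ => ContinuousOn.const_smul
      (continuousOn_finsetProd _ fun i _ => ?_) _
    exact (hd (p i + i) (by omega)).continuousOn
  have hDo : IsOpen D := hcont.isOpen_inter_preimage isOpen_unitStrip isOpen_compl_singleton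
  have hsub : range (fun s : ℝ => (s : ℂ)) ⊆ D := by
    rintro _ ⟨s, rfl⟩
    refine ⟨ofReal_mem_unitStrip s, ?_⟩
    have hG := (isMomentWeight_cauchyWeight n ha).isUnit_det_gramMatrix (S := Iic s) (by simp)
    simp only [mem_preimage, mem_compl_iff, mem_singleton_iff]
    rw [hankelMatrix_ofReal hm]
    have := RingHom.map_det Complex.ofRealHom (gramMatrix n (cauchyWeight (n + 1) a) (Iic s))
    rw [RingHom.mapMatrix_apply] at this
    rw [← this]
    simpa using hG.ne_zero
  have h0 : (0 : ℂ) ∈ range (fun s : ℝ => (s : ℂ)) := ⟨0, by simp⟩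
  have hC := hΩ (connectedComponentIn D 0)
    ((connectedComponentIn_subset D 0).trans inter_subset_left)
    fun z hz => (connectedComponentIn_subset D 0 hz).2
  refine ⟨hankelSigma n m (complexWeight (n + 1) a), connectedComponentIn D 0,
    hDo.connectedComponentIn, isConnected_connectedComponentIn_iff.2 (hsub h0),
    (connectedComponentIn_subset D 0).trans inter_subset_left, fun s => ?_,
    hankelSigma_ofReal ha hm, hC.analyticOnNhd_sigma hDo.connectedComponentIn, fun z hz => ?_⟩
  · exact (isPreconnected_range Complex.continuous_ofReal).subset_connectedComponentIn h0 hsub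
      ⟨s, rfl⟩
  · have := hC.sigma_equation hDo.connectedComponentIn (by exact_mod_cast ha.ne') hz rfl rfl rfl
    exact this

end Resolvent

/-! ### The gauge transformation -/

section Gauge
open Set Filter Topology

/-- A Riccati inequality without positive solutions on the line: followed to the left from `s = 0`,
a positive solution blows up at a finite point. -/
theorem not_pos_of_riccati_le {f f' : ℝ → ℝ} {c : ℝ} (hc : 1 < c) (hpos : ∀ s, 0 < f s)
    (hd : ∀ s, HasDerivAt f (f' s) s)
    (h : ∀ s ≤ 0, (1 + s ^ 2) * f' s ≤ -(f s ^ 2 + c ^ 2)) : False := by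
  have hc0 : 0 < c := by linarith
  -- `arctan (f / c) + c arctan s` is bounded by `π / 2 + c arctan s` and decreases on `s ≤ 0`
  have hφ : ∀ s, HasDerivAt (fun s => Real.arctan (f s / c) + c * Real.arctan s)
      (1 / (1 + (f s / c) ^ 2) * (f' s / c) + c * (1 / (1 + s ^ 2))) s := fun s =>
    ((hd s).div_const c).arctan.add ((Real.hasDerivAt_arctan s).const_mul c)
  have hanti : AntitoneOn (fun s => Real.arctan (f s / c) + c * Real.arctan s) (Iic 0) := by
    refine antitoneOn_of_deriv_nonpos (convex_Iic 0)
      (fun s _ => (hφ s).continuousAt.continuousWithinAt)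
      (fun s _ => (hφ s).differentiableAt.differentiableWithinAt) fun s hs => ?_
    rw [interior_Iic] at hs
    rw [(hφ s).deriv]
    have h1 : 0 < 1 + s ^ 2 := by positivity
    have h2 : 0 < c ^ 2 + f s ^ 2 := by positivity
    have h3 : 1 / (1 + (f s / c) ^ 2) * (f' s / c) + c * (1 / (1 + s ^ 2)) =
        c * ((1 + s ^ 2) * f' s + (f s ^ 2 + c ^ 2)) / ((1 + s ^ 2) * (c ^ 2 + f s ^ 2)) := by
      field_simp
      ring
    rw [h3]
    refine div_nonpos_of_nonpos_of_nonneg (mul_nonpos_of_nonneg_of_nonpos hc0.le ?_)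
      (by positivity)
    linarith [h s hs.le]
  have hθ0 : 0 < Real.pi / (2 * c) := by positivity
  have hθ1 : Real.pi / (2 * c) < Real.pi / 2 := by
    rw [div_lt_div_iff₀ (by positivity) (by norm_num)]
    nlinarith [Real.pi_pos]
  have hs0 : -Real.tan (Real.pi / (2 * c)) ≤ 0 := by
    linarith [Real.tan_pos_of_pos_of_lt_pi_div_two hθ0 hθ1]
  have h1 := hanti (mem_Iic.2 hs0) (mem_Iic.2 le_rfl) hs0
  simp only [Real.arctan_zero, mul_zero, add_zero, Real.arctan_neg,
    Real.arctan_tan (by linarith : -(Real.pi / 2) < Real.pi / (2 * c)) hθ1] at h1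
  have h2 := Real.arctan_lt_pi_div_two (f (-Real.tan (Real.pi / (2 * c))) / c)
  have h3 : 0 < Real.arctan (f 0 / c) := by
    rw [Real.arctan_pos]
    exact div_pos (hpos 0) hc0
  have h4 : c * -(Real.pi / (2 * c)) = -(Real.pi / 2) := by field_simp
  linarith

section gauge

/-- The inverse of the gauge `s ↦ t = (1 - i s) / 2`, for complex `t`. -/
noncomputable def linePoint (t : ℂ) : ℂ := Complex.I * (2 * t - 1)

theorem linePoint_gaugePoint (s : ℝ) : linePoint (gaugePoint s) = s := by
  rw [linePoint, gaugePoint]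
  linear_combination (-(s : ℂ)) * Complex.I_sq

theorem one_add_linePoint_sq (t : ℂ) : 1 + linePoint t ^ 2 = 4 * t * (1 - t) := by
  rw [linePoint]
  linear_combination (2 * t - 1) ^ 2 * Complex.I_sq

theorem hasDerivAt_linePoint (t : ℂ) : HasDerivAt linePoint (2 * Complex.I) t := by
  have := (((hasDerivAt_id t).const_mul 2).sub_const 1).const_mul Complex.I
  exact this.congr_deriv (by ring)

theorem linePoint_preimage_eq (Ω : Set ℂ) :
    linePoint ⁻¹' Ω = (fun z => (1 - Complex.I * z) / 2) '' Ω := by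
  ext t
  constructor
  · intro ht
    refine ⟨_, ht, ?_⟩
    simp only [linePoint]
    linear_combination (-(2 * t - 1) / 2) * Complex.I_sq
  · rintro ⟨z, hz, rfl⟩
    have : linePoint ((1 - Complex.I * z) / 2) = z := by
      rw [linePoint]; linear_combination (-z) * Complex.I_sq
    rw [mem_preimage, this]
    exact hz

/-- The function `η(t) = (σ(s) - a² s) / (2 i)` with `t = (1 - i s) / 2`. -/
noncomputable def gaugedSigma (a : ℝ) (σ : ℂ → ℂ) (t : ℂ) : ℂ :=
  (σ (linePoint t) - a ^ 2 * linePoint t) / (2 * Complex.I)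

variable {a : ℝ} {σ : ℂ → ℂ} {Ω : Set ℂ}

theorem hasDerivAt_gaugedSigma {t : ℂ} (h : DifferentiableAt ℂ σ (linePoint t)) :
    HasDerivAt (gaugedSigma a σ) (deriv σ (linePoint t) - a ^ 2) t := by
  have h1 := (h.hasDerivAt.comp t (hasDerivAt_linePoint t)).sub
    ((hasDerivAt_linePoint t).const_mul ((a : ℂ) ^ 2))
  refine (h1.div_const (2 * Complex.I)).congr_deriv ?_
  field_simp [Complex.I_ne_zero]

theorem deriv_gaugedSigma {t : ℂ} (h : DifferentiableAt ℂ σ (linePoint t)) :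
    deriv (gaugedSigma a σ) t = deriv σ (linePoint t) - a ^ 2 := (hasDerivAt_gaugedSigma h).deriv

theorem deriv_deriv_gaugedSigma (hΩ : IsOpen Ω) (h : AnalyticOnNhd ℂ σ Ω) {t : ℂ}
    (ht : linePoint t ∈ Ω) :
    deriv (deriv (gaugedSigma a σ)) t = 2 * Complex.I * deriv (deriv σ) (linePoint t) := by
  have hc : Continuous linePoint := by unfold linePoint; fun_prop
  have h1 : deriv (gaugedSigma a σ) =ᶠ[𝓝 t] fun t => deriv σ (linePoint t) - a ^ 2 := by
    filter_upwards [(hΩ.preimage hc).mem_nhds ht] with x hx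
    exact deriv_gaugedSigma (h _ hx).differentiableAt
  rw [h1.deriv_eq]
  have := ((h _ ht).deriv.differentiableAt.hasDerivAt.comp t (hasDerivAt_linePoint t)).sub_const
    ((a : ℂ) ^ 2)
  rw [mul_comm]
  exact this.deriv

/-- In the gauge variable the equation for `σ` is a sigma form. Only the symmetric functions of the
`b_j²` and the vanishing of the product of the `b_j` enter. -/
theorem sigmaForm_gaugedSigma (hΩ : IsOpen Ω) (h : AnalyticOnNhd ℂ σ Ω) {N b₁ b₂ b₃ b₄ : ℂ}
    {t : ℂ} (ht : linePoint t ∈ Ω)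
    (hE : ∀ z ∈ Ω, ((1 + z ^ 2) * deriv (deriv σ) z) ^ 2 + 4 * (1 + z ^ 2) * deriv σ z ^ 3
      - 8 * z * σ z * deriv σ z ^ 2
      + 4 * σ z ^ 2 * (deriv σ z - a ^ 2) + 8 * a ^ 2 * z * σ z * deriv σ z
      + 4 * (N * (N + 2 * a) - a ^ 2 * z ^ 2) * deriv σ z ^ 2 = 0)
    (h4 : b₁ * b₂ * b₃ * b₄ = 0)
    (e1 : b₁ ^ 2 + b₂ ^ 2 + b₃ ^ 2 + b₄ ^ 2 = (N + a) ^ 2 + 2 * a ^ 2)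
    (e2 : b₁ ^ 2 * b₂ ^ 2 + b₁ ^ 2 * b₃ ^ 2 + b₁ ^ 2 * b₄ ^ 2 + b₂ ^ 2 * b₃ ^ 2
      + b₂ ^ 2 * b₄ ^ 2 + b₃ ^ 2 * b₄ ^ 2 = 2 * a ^ 2 * (N + a) ^ 2 + a ^ 4)
    (e3 : b₁ ^ 2 * b₂ ^ 2 * b₃ ^ 2 + b₁ ^ 2 * b₂ ^ 2 * b₄ ^ 2 + b₁ ^ 2 * b₃ ^ 2 * b₄ ^ 2
      + b₂ ^ 2 * b₃ ^ 2 * b₄ ^ 2 = a ^ 4 * (N + a) ^ 2) :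
    SigmaForm b₁ b₂ b₃ b₄ (gaugedSigma a σ) t := by
  have hz := hE _ ht
  have hη : 2 * gaugedSigma a σ t = -Complex.I * (σ (linePoint t) - a ^ 2 * linePoint t) := by
    rw [gaugedSigma]
    field_simp [Complex.I_ne_zero]
    linear_combination (σ (linePoint t) - a ^ 2 * linePoint t) * Complex.I_sq
  have hI : 2 * t - 1 = -Complex.I * linePoint t := by
    rw [linePoint]; linear_combination (2 * t - 1) * Complex.I_sq
  have ht2 : t * (t - 1) = -(1 + linePoint t ^ 2) / 4 := by rw [one_add_linePoint_sq]; ring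
  rw [SigmaForm, deriv_deriv_gaugedSigma hΩ h ht, deriv_gaugedSigma (h _ ht).differentiableAt,
    h4, e1, e2, e3, hη, hI, ht2]
  generalize linePoint t = z at *
  generalize deriv (deriv σ) z = σ₂ at *
  generalize deriv σ z = σ₁ at *
  generalize σ z = σ₀ at *
  linear_combination (-1 / 4) * hz + ((1 + z ^ 2) ^ 2 * σ₂ ^ 2 / 4
    + (σ₁ - a ^ 2) * (σ₀ - z * σ₁) ^ 2) * Complex.I_sq

end gauge

section line
variable {f : ℝ → ℝ} {σ : ℂ → ℂ} {Ω : Set ℂ}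

theorem hasDerivAt_re_deriv (hf : ∀ s : ℝ, σ s = f s) {s : ℝ} (h : DifferentiableAt ℂ σ s) :
    HasDerivAt f (deriv σ s).re s ∧ deriv σ s = ((deriv σ s).re : ℂ) := by
  have h1 : HasDerivAt f (deriv σ s).re s := by
    refine h.hasDerivAt.real_of_complex.congr_of_eventuallyEq (Eventually.of_forall fun x => ?_)
    simp [hf]
  refine ⟨h1, ?_⟩
  have h2 := h.hasDerivAt.comp_ofReal
  simp only [hf] at h2
  exact h2.unique h1.ofReal_comp

/-- An affine function that is positive on the line is constant. -/
theorem exists_deriv_deriv_ne_zero (hΩ : IsOpen Ω) (hc : IsPreconnected Ω)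
    (hσ : AnalyticOnNhd ℂ σ Ω) (hl : ∀ s : ℝ, (s : ℂ) ∈ Ω) (hf : ∀ s : ℝ, σ s = f s)
    (hpos : ∀ s, 0 < f s) (hne : deriv σ 0 ≠ 0) : ∃ z ∈ Ω, deriv (deriv σ) z ≠ 0 := by
  by_contra hcon
  push Not at hcon
  have hd := hσ.deriv
  have h0 : (0 : ℂ) ∈ Ω := by simpa using hl 0
  have h1 : ∀ z ∈ Ω, deriv σ z = deriv σ 0 := fun z hz =>
    hΩ.is_const_of_deriv_eq_zero hc hd.differentiableOn hcon hz h0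
  have h2 : ∀ z ∈ Ω, σ z - deriv σ 0 * z = σ 0 - deriv σ 0 * 0 := fun z hz =>
    hΩ.is_const_of_deriv_eq_zero (f := fun z => σ z - deriv σ 0 * z) hc
      (hσ.differentiableOn.sub (differentiableOn_id.const_mul _)) (fun x hx => by
        have := ((hσ x hx).differentiableAt.hasDerivAt.sub
          ((hasDerivAt_id x).const_mul (deriv σ 0))).deriv
        simp only [Pi.zero_apply]
        refine this.trans ?_
        rw [h1 x hx]; ring) hz h0
  obtain ⟨-, hr⟩ := hasDerivAt_re_deriv hf (s := 0)
    (by simpa using (hσ 0 h0).differentiableAt)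
  simp only [Complex.ofReal_zero] at hr
  set c := (deriv σ 0).re with hcdef
  have hf0 := hf 0
  simp only [Complex.ofReal_zero] at hf0
  have h3 : ∀ s : ℝ, f s = f 0 + c * s := fun s => by
    have := h2 s (hl s)
    rw [hf, hf0, hr] at this
    have h4 : (f s : ℂ) = ((f 0 + c * s : ℝ) : ℂ) := by push_cast; linear_combination this
    exact_mod_cast h4
  have hc0 : c ≠ 0 := fun h => hne (by rw [hr, h]; simp)
  have h5 := h3 (-f 0 / c)
  rw [mul_div_cancel₀ _ hc0] at h5
  linarith [hpos (-f 0 / c)]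

end line

end Gauge

/-! ### The degenerate parameters -/

section Degenerate
open Set Filter Topology

section exclusions
variable {f : ℝ → ℝ} {σ : ℂ → ℂ}

theorem gaugedSigma_gaugePoint {a : ℝ} (hf : ∀ s : ℝ, σ s = f s) (s : ℝ) :
    gaugedSigma a σ (gaugePoint s) = ((f s : ℂ) - a ^ 2 * s) / (2 * Complex.I) := by
  rw [gaugedSigma, linePoint_gaugePoint, hf]

theorem gaugedSigma_gaugePoint_eq_neg {a : ℝ} (hf : ∀ s : ℝ, σ s = f s) (s : ℝ) :
    gaugedSigma a σ (gaugePoint s) = -(Complex.I * ((f s : ℂ) - a ^ 2 * s)) / 2 := by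
  rw [gaugedSigma_gaugePoint hf]
  field_simp [Complex.I_ne_zero]
  linear_combination ((f s : ℂ) - a ^ 2 * s) * Complex.I_sq

/-- For `b₃ + b₄ = -1` with `b₄ = 0` and `a = 1`, the imaginary part of `leadQuad` on the line is
`b₁ b₂ σ / 2`. -/
theorem leadQuad_ne_zero_of_im {b₁ b₂ : ℂ} {b : ℝ} (hb : b₁ * b₂ = b) (hb0 : b ≠ 0) {s : ℝ}
    {c : ℝ} (hc : (b₁ + b₂) ^ 2 + (b₁ - b₂) ^ 2 = c)
    (hf : ∀ s : ℝ, σ s = f s) (hpos : ∀ s, 0 < f s) (hd : DifferentiableAt ℂ σ s) :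
    leadQuad b₁ b₂ (-1) 0 (gaugedSigma 1 σ) (gaugePoint s) ≠ 0 := fun h => by
  obtain ⟨-, hr⟩ := hasDerivAt_re_deriv hf hd
  rw [leadQuad, linCoeff, quadCoeff, gaugedSigma_gaugePoint_eq_neg hf,
    deriv_gaugedSigma (by rwa [linePoint_gaugePoint]), linePoint_gaugePoint, hr, hb,
    gaugePoint] at h
  have h1 : (((b ^ 2 - (f s - s) ^ 2 - (1 + s ^ 2) * ((deriv σ s).re - 1) - c / 2) / 4 : ℝ) : ℂ)
      + ((b * f s / 2 : ℝ) : ℂ) * Complex.I = 0 := by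
    push_cast
    rw [← h]
    push_cast
    linear_combination (1 / 8 : ℂ) * hc + (-(s : ℂ) * Complex.I / 2) * hb
      - (((f s : ℂ) - s) ^ 2 / 4 + (s : ℂ) ^ 2 * (((deriv σ s).re : ℂ) - 1) / 4) * Complex.I_sq
  have h2 := congrArg Complex.im h1
  simp only [Complex.add_im, Complex.ofReal_im, Complex.mul_im, Complex.ofReal_re, Complex.I_re,
    Complex.I_im, Complex.zero_im, zero_add, mul_zero, mul_one, add_zero] at h2
  exact mul_ne_zero hb0 (hpos s).ne' (by linarith)

/-- For `b₃ = b₄ = -1/2` and `a = 1/2`, the vanishing of `leadQuad` on the line would be the Riccati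
equation `(1 + s²) σ' = -σ² + s σ - N (N + 1)`. -/
theorem exists_leadQuad_ne_zero {N : ℝ} (hN : 1 ≤ N) (hf : ∀ s : ℝ, σ s = f s)
    (hpos : ∀ s, 0 < f s) (hd : ∀ s : ℝ, DifferentiableAt ℂ σ s) :
    ∃ s : ℝ, leadQuad (N + 1 / 2) 0 (-(1 / 2)) (-(1 / 2)) (gaugedSigma (1 / 2) σ)
      (gaugePoint s) ≠ 0 := by
  by_contra hcon
  push Not at hcon
  refine not_pos_of_riccati_le (c := √(N * (N + 1))) ?_ hpos
    (fun s => (hasDerivAt_re_deriv hf (hd s)).1) fun s hs => ?_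
  · rw [Real.lt_sqrt (by norm_num)]; nlinarith
  · have hr := (hasDerivAt_re_deriv hf (hd s)).2
    have h := hcon s
    rw [leadQuad, linCoeff, quadCoeff, gaugedSigma_gaugePoint_eq_neg hf,
      deriv_gaugedSigma (by rw [linePoint_gaugePoint]; exact hd s), linePoint_gaugePoint, hr,
      gaugePoint] at h
    have h1 : (1 + s ^ 2) * (deriv σ s).re = -(f s ^ 2) + s * f s - N * (N + 1) := by
      have : (((1 + s ^ 2) * (deriv σ s).re : ℝ) : ℂ) =
          ((-(f s ^ 2) + s * f s - N * (N + 1) : ℝ) : ℂ) := by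
        push_cast at h ⊢
        linear_combination (-4 : ℂ) * h
          + (((f s : ℂ) - s / 2) ^ 2 + (s : ℂ) ^ 2 * (((deriv σ s).re : ℂ) - 1 / 4)) * Complex.I_sq
      exact_mod_cast this
    rw [Real.sq_sqrt (by nlinarith), h1]
    nlinarith [mul_nonneg (neg_nonneg.2 hs) (hpos s).le]

end exclusions

end Degenerate

/-! ### The Cauchy unitary ensemble -/

section Final
open Set Filter Topology

/-- For `θ = 1` and `γ = -β` the Bäcklund formulas simplify. -/
theorem exists_isPainleveVI_of_related {U : Set ℂ} (h0 : (0 : ℂ) ∉ U) (h1 : (1 : ℂ) ∉ U) {η : ℂ → ℂ}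
    {M a : ℂ} (h : IsPainleveVIRelated U η 1 (-M ^ 2 / 2) (M ^ 2 / 2) (1 / 2 - 2 * a ^ 2)) :
    ∃ u : ℂ → ℂ, IsPainleveVI (1 / 2) (-M ^ 2 / 2) (M ^ 2 / 2) (1 / 2 - 2 * a ^ 2) U u ∧
      ∀ t ∈ U, IsRegularPoint u t →
        η t = t ^ 2 * (t - 1) ^ 2 / (4 * u t * (u t - 1) * (u t - t)) *
              (deriv u t - u t * (u t - 1) / (t * (t - 1))) ^ 2
            - 1 / 4 * M ^ 2 * ((u t - t) / (u t * (u t - 1)))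
            + 1 / 2 * a ^ 2 * (1 - 2 * t * ((u t - 1) / (u t - t))) ∧
        deriv η t = -(t * (t - 1) / (4 * u t * (u t - 1))) *
              (deriv u t - u t * (u t - 1) / (t * (t - 1))) ^ 2
            + 1 / 4 * M ^ 2 * ((u t - t) ^ 2 / (t * (t - 1) * u t * (u t - 1))) := by
  obtain ⟨u, hu, hη⟩ := h
  refine ⟨u, by simpa using hu, fun t ht hr => ?_⟩
  obtain ⟨e1, e2⟩ := hη t ht hr
  have t0 : t ≠ 0 := fun h => h0 (h ▸ ht)
  have t1 : t - 1 ≠ 0 := fun h => h1 (sub_eq_zero.1 h ▸ ht)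
  have u0 := hr.2.1
  have u1 : u t - 1 ≠ 0 := sub_ne_zero.2 hr.2.2.1
  have ut : u t - t ≠ 0 := sub_ne_zero.2 hr.2.2.2
  constructor
  · rw [e1]
    generalize (deriv u t - u t * (u t - 1) / (t * (t - 1))) ^ 2 = d
    have k : -(-M ^ 2 / 2 / 4 * (1 - 2 * t / u t)) - M ^ 2 / 2 / 4 * (1 - 2 * (t - 1) / (u t - 1)) =
        -(1 / 4 * M ^ 2 * ((u t - t) / (u t * (u t - 1)))) := by
      field_simp
      ring
    linear_combination k
  · rw [e2, one_mul]
    generalize (deriv u t - u t * (u t - 1) / (t * (t - 1))) ^ 2 = d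
    have k : -(-M ^ 2 / 2 * (u t - t) / (2 * (t - 1) * u t))
        - M ^ 2 / 2 * (u t - t) / (2 * t * (u t - 1)) =
        1 / 4 * M ^ 2 * ((u t - t) ^ 2 / (t * (t - 1) * u t * (u t - 1))) := by
      field_simp
      ring
    linear_combination k

theorem proposition5 (N : ℕ) (hN : 1 ≤ N) (a : ℝ) (ha : 0 < a) :
    ∃ (U : Set ℂ) (η : ℂ → ℂ),
      IsOpen U ∧ IsConnected U ∧ (0 : ℂ) ∉ U ∧ (1 : ℂ) ∉ U ∧
      -- the gauge
      AnalyticOnNhd ℂ η U ∧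
      (∀ s : ℝ, gaugePoint s ∈ U ∧
        η (gaugePoint s) = ((cauchySigma N a s : ℂ) - (a : ℂ) ^ 2 * (s : ℂ)) / (2 * Complex.I)) ∧
      -- the Painlevé transcendent and the Bäcklund formulas
      (∃ u : ℂ → ℂ,
        IsPainleveVI (1 / 2) (-((N : ℂ) + a) ^ 2 / 2) (((N : ℂ) + a) ^ 2 / 2)
          (1 / 2 - 2 * (a : ℂ) ^ 2) U u ∧
        ∀ t ∈ U, IsRegularPoint u t →
          η t = t ^ 2 * (t - 1) ^ 2 / (4 * u t * (u t - 1) * (u t - t)) *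
                (deriv u t - u t * (u t - 1) / (t * (t - 1))) ^ 2
              - 1 / 4 * ((N : ℂ) + a) ^ 2 * ((u t - t) / (u t * (u t - 1)))
              + 1 / 2 * (a : ℂ) ^ 2 * (1 - 2 * t * ((u t - 1) / (u t - t))) ∧
          deriv η t = -(t * (t - 1) / (4 * u t * (u t - 1))) *
                (deriv u t - u t * (u t - 1) / (t * (t - 1))) ^ 2
              + 1 / 4 * ((N : ℂ) + a) ^ 2 *
                ((u t - t) ^ 2 / (t * (t - 1) * u t * (u t - 1)))) ∧
      -- the table of equivalent parameter sets `(θ; β, γ, δ)`, `α = θ² / 2`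
      IsPainleveVIRelated U η 1 (-((N : ℂ) + a) ^ 2 / 2) (((N : ℂ) + a) ^ 2 / 2)
        (1 / 2 - 2 * (a : ℂ) ^ 2) ∧
      (∀ ε : ℂ, ε = 1 ∨ ε = -1 →
        IsPainleveVIRelated U η (1 + ε * (2 * a))
          (-((N : ℂ) + a) ^ 2 / 2) (((N : ℂ) + a) ^ 2 / 2) (1 / 2) ∧
        IsPainleveVIRelated U η (1 + ε * (N + 2 * a))
          (-(a : ℂ) ^ 2 / 2) ((a : ℂ) ^ 2 / 2) ((1 - (N : ℂ) ^ 2) / 2) ∧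
        (ε = 1 ∨ 2 ≤ N → IsPainleveVIRelated U η (1 + ε * N)
          (-(a : ℂ) ^ 2 / 2) ((a : ℂ) ^ 2 / 2) ((1 - ((N : ℂ) + 2 * a) ^ 2) / 2)) ∧
        IsPainleveVIRelated U η (1 + ε * (N + a))
          0 (2 * (a : ℂ) ^ 2) ((1 - ((N : ℂ) + a) ^ 2) / 2) ∧
        IsPainleveVIRelated U η (1 + ε * (N + a))
          (-2 * (a : ℂ) ^ 2) 0 ((1 - ((N : ℂ) + a) ^ 2) / 2) ∧
        IsPainleveVIRelated U η (1 + ε * a)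
          (-(N : ℂ) ^ 2 / 2) (((N : ℂ) + 2 * a) ^ 2 / 2) ((1 - (a : ℂ) ^ 2) / 2) ∧
        IsPainleveVIRelated U η (1 + ε * a)
          (-((N : ℂ) + 2 * a) ^ 2 / 2) ((N : ℂ) ^ 2 / 2) ((1 - (a : ℂ) ^ 2) / 2)) := by
  obtain ⟨n, rfl⟩ : ∃ n, N = n + 1 := ⟨N - 1, by omega⟩
  obtain ⟨σ, Ω, hΩ, hΩc, hΩs, hl, hf, hσ, hode⟩ := exists_sigma_continuation n ha
  have hpos := cauchySigma_pos n ha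
  have hcont : Continuous linePoint := by unfold linePoint; fun_prop
  set U := linePoint ⁻¹' Ω with hU
  set η := gaugedSigma a σ with hη
  have hUo : IsOpen U := hΩ.preimage hcont
  have hUc : IsConnected U := by
    rw [hU, linePoint_preimage_eq]
    exact hΩc.image _ (by fun_prop)
  -- `t = 0` and `t = 1` correspond to `s = ∓i`, on the boundary of the strip
  have h0 : (0 : ℂ) ∉ U := fun h => by
    have := hΩs h
    simp [linePoint, unitStrip] at this
  have h1 : (1 : ℂ) ∉ U := fun h => by
    have := hΩs h
    norm_num [linePoint, unitStrip] at this
  have hηa : AnalyticOnNhd ℂ η U := DifferentiableOn.analyticOnNhd (fun t ht =>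
    (hasDerivAt_gaugedSigma (hσ _ ht).differentiableAt).differentiableAt.differentiableWithinAt) hUo
  have hline : ∀ s : ℝ, gaugePoint s ∈ U := fun s => by
    rw [hU, mem_preimage, linePoint_gaugePoint]; exact hl s
  have hT : ∃ t ∈ U, deriv (deriv η) t ≠ 0 := by
    obtain ⟨z, hz, hz2⟩ : ∃ z ∈ Ω, deriv (deriv σ) z ≠ 0 := by
      by_cases h2 : deriv (deriv σ) 0 = 0
      · refine exists_deriv_deriv_ne_zero hΩ hΩc.isPreconnected hσ hl hf hpos fun h3 => ?_
        have h4 := hode 0 (by simpa using hl 0)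
        have h5 := hf 0
        rw [Complex.ofReal_zero] at h5
        rw [h2, h3, h5] at h4
        have h6 : ((cauchySigma (n + 1) a 0 * a : ℝ) : ℂ) ^ 2 = 0 := by
          push_cast; linear_combination (-1 / 4) * h4
        have h7 := mul_pos (hpos 0) ha
        exact h7.ne' (by exact_mod_cast pow_eq_zero_iff two_ne_zero |>.1 h6)
      · exact ⟨0, by simpa using hl 0, h2⟩
    rw [hU, linePoint_preimage_eq]
    refine ⟨_, ⟨z, hz, rfl⟩, ?_⟩
    have hzz : linePoint ((1 - Complex.I * z) / 2) = z := by
      rw [linePoint]; linear_combination (-z) * Complex.I_sq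
    rw [hη, deriv_deriv_gaugedSigma hΩ hσ (by rwa [hzz]), hzz]
    exact mul_ne_zero (mul_ne_zero two_ne_zero Complex.I_ne_zero) hz2
  -- any distribution of `±(N + a), ±a, ±a, 0` over the four parameters gives a transcendent
  have key : ∀ b₁ b₂ b₃ b₄ θ β γ δ : ℂ, b₁ * b₂ * b₃ * b₄ = 0 →
      b₁ ^ 2 + b₂ ^ 2 + b₃ ^ 2 + b₄ ^ 2 = (((n + 1 : ℕ) : ℂ) + a) ^ 2 + 2 * a ^ 2 →
      b₁ ^ 2 * b₂ ^ 2 + b₁ ^ 2 * b₃ ^ 2 + b₁ ^ 2 * b₄ ^ 2 + b₂ ^ 2 * b₃ ^ 2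
        + b₂ ^ 2 * b₄ ^ 2 + b₃ ^ 2 * b₄ ^ 2 = 2 * a ^ 2 * (((n + 1 : ℕ) : ℂ) + a) ^ 2 + a ^ 4 →
      b₁ ^ 2 * b₂ ^ 2 * b₃ ^ 2 + b₁ ^ 2 * b₂ ^ 2 * b₄ ^ 2 + b₁ ^ 2 * b₃ ^ 2 * b₄ ^ 2
        + b₂ ^ 2 * b₃ ^ 2 * b₄ ^ 2 = a ^ 4 * (((n + 1 : ℕ) : ℂ) + a) ^ 2 →
      (b₃ + b₄ ≠ -1 ∨ ∃ t ∈ U, leadQuad b₁ b₂ b₃ b₄ η t ≠ 0) →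
      θ = 1 + b₃ + b₄ → β = -(b₁ + b₂) ^ 2 / 2 → γ = (b₁ - b₂) ^ 2 / 2 →
      δ = (1 - (b₃ - b₄) ^ 2) / 2 → IsPainleveVIRelated U η θ β γ δ := by
    rintro b₁ b₂ b₃ b₄ _ _ _ _ p e1 e2 e3 hk rfl rfl rfl rfl
    refine isPainleveVIRelated_of_sigmaForm hUo hUc.isPreconnected h0 h1 hηa hT
      (fun t ht => sigmaForm_gaugedSigma hΩ hσ ht (fun z hz => ?_) p e1 e2 e3) hk
    have := hode z hz
    push_cast
    exact this
  have hre : ∀ x : ℝ, x ≠ -1 → (x : ℂ) ≠ -1 := fun x hx h => hx (by exact_mod_cast h)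
  have hNr : (1 : ℝ) ≤ ((n + 1 : ℕ) : ℝ) := by push_cast; linarith [n.cast_nonneg (α := ℝ)]
  have hcast : (((n + 1 : ℕ) : ℝ) : ℂ) = ((n + 1 : ℕ) : ℂ) := Complex.ofReal_natCast _
  generalize hM : (((n + 1 : ℕ)) : ℂ) = M at *
  generalize hMr : (((n + 1 : ℕ)) : ℝ) = Mr at *
  have hfirst : IsPainleveVIRelated U η 1 (-(M + a) ^ 2 / 2) ((M + a) ^ 2 / 2)
      (1 / 2 - 2 * (a : ℂ) ^ 2) :=
    key (M + a) 0 a (-a) _ _ _ _ (by ring) (by ring) (by ring) (by ring)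
      (Or.inl (by rw [add_neg_cancel]; norm_num)) (by ring) (by ring) (by ring) (by ring)
  -- the last two parameter sets degenerate for the lower sign and `a = 1`
  have hlast : ∀ d : ℝ, d ^ 2 = 1 → ∀ ε : ℂ, ε = 1 ∨ ε = -1 → ∀ b₁ b₂ : ℂ, b₁ = M + a →
      b₂ = d * a → ε * a + 0 ≠ -1 ∨ ∃ t ∈ U, leadQuad b₁ b₂ (ε * a) 0 η t ≠ 0 := by
    rintro d hd ε (rfl | rfl) _ _ rfl rfl
    · left
      have := hre a (by linarith)
      rwa [one_mul, add_zero]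
    · rcases eq_or_ne a 1 with rfl | ha1
      · right
        have hd0 : d ≠ 0 := fun h => by norm_num [h] at hd
        refine ⟨gaugePoint 0, hline 0, ?_⟩
        have := leadQuad_ne_zero_of_im (b₁ := M + (1 : ℝ)) (b₂ := d * (1 : ℝ)) (b := (Mr + 1) * d)
          (c := (Mr + 1 + d) ^ 2 + (Mr + 1 - d) ^ 2) (by push_cast [hcast]; ring)
          (mul_ne_zero (by linarith) hd0) (s := 0) (by push_cast [hcast]; ring) hf hpos
          (hσ _ (hl 0)).differentiableAt
        convert this using 2
        simp
      · left
        have := hre (-a) fun h => ha1 (by linarith)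
        push_cast at this
        simpa using this
  refine ⟨U, η, hUo, hUc, h0, h1, hηa, fun s => ⟨hline s, gaugedSigma_gaugePoint hf s⟩,
    exists_isPainleveVI_of_related h0 h1 hfirst, hfirst,
    fun ε hε => ⟨?_, ?_, fun hε2 => ?_, ?_, ?_, ?_, ?_⟩⟩
  · refine key (M + a) 0 (ε * a) (ε * a) _ _ _ _ (by ring) (by rcases hε with rfl | rfl <;> ring)
      (by rcases hε with rfl | rfl <;> ring) (by rcases hε with rfl | rfl <;> ring) ?_
      (by ring) (by ring) (by ring) (by ring)
    rcases hε with rfl | rfl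
    · left
      have := hre (2 * a) (by linarith)
      push_cast at this
      rwa [one_mul, ← two_mul]
    -- `b₃ + b₄ = -2a` equals `-1` for `a = 1/2`
    · rcases eq_or_ne a (1 / 2) with rfl | ha2
      · right
        obtain ⟨s, hs⟩ := exists_leadQuad_ne_zero hNr hf hpos
          fun s => (hσ _ (hl s)).differentiableAt
        refine ⟨gaugePoint s, hline s, ?_⟩
        convert hs using 2 <;> push_cast [hcast] <;> ring
      · left
        have := hre (-2 * a) fun h => ha2 (by linarith)
        push_cast at this
        convert this using 1
        ring
  · refine key a 0 (ε * (M + a)) (ε * a) _ _ _ _ (by ring) (by rcases hε with rfl | rfl <;> ring)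
      (by rcases hε with rfl | rfl <;> ring) (by rcases hε with rfl | rfl <;> ring) (Or.inl ?_)
      (by ring) (by ring) (by ring) (by rcases hε with rfl | rfl <;> ring)
    rcases hε with rfl | rfl
    · have := hre (Mr + 2 * a) (by linarith)
      push_cast [hcast] at this
      convert this using 1
      ring
    · have := hre (-(Mr + 2 * a)) (by linarith)
      push_cast [hcast] at this
      convert this using 1
      ring
  · refine key a 0 (ε * (M + a)) (-(ε * a)) _ _ _ _ (by ring)
      (by rcases hε with rfl | rfl <;> ring)
      (by rcases hε with rfl | rfl <;> ring) (by rcases hε with rfl | rfl <;> ring) (Or.inl ?_)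
      (by ring) (by ring) (by ring) (by rcases hε with rfl | rfl <;> ring)
    rcases hε with rfl | rfl
    · have := hre Mr (by linarith)
      push_cast [hcast] at this
      convert this using 1
      ring
    · have hn2 : (2 : ℝ) ≤ Mr := by
        rcases hε2 with h | h
        · norm_num [Complex.ext_iff] at h
        · rw [← hMr]; exact_mod_cast h
      have := hre (-Mr) (by linarith)
      push_cast [hcast] at this
      convert this using 1
      ring
  · refine key a (-a) (ε * (M + a)) 0 _ _ _ _ (by ring) (by rcases hε with rfl | rfl <;> ring)
      (by rcases hε with rfl | rfl <;> ring) (by rcases hε with rfl | rfl <;> ring) (Or.inl ?_)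
      (by ring) (by ring) (by ring) (by rcases hε with rfl | rfl <;> ring)
    rcases hε with rfl | rfl
    · have := hre (Mr + a) (by linarith)
      push_cast [hcast] at this
      convert this using 1
      ring
    · have := hre (-(Mr + a)) (by linarith)
      push_cast [hcast] at this
      convert this using 1
      ring
  · refine key a a (ε * (M + a)) 0 _ _ _ _ (by ring) (by rcases hε with rfl | rfl <;> ring)
      (by rcases hε with rfl | rfl <;> ring) (by rcases hε with rfl | rfl <;> ring) (Or.inl ?_)
      (by ring) (by ring) (by ring) (by rcases hε with rfl | rfl <;> ring)
    rcases hε with rfl | rfl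
    · have := hre (Mr + a) (by linarith)
      push_cast [hcast] at this
      convert this using 1
      ring
    · have := hre (-(Mr + a)) (by linarith)
      push_cast [hcast] at this
      convert this using 1
      ring
  · refine key (M + a) (-a) (ε * a) 0 _ _ _ _ (by ring) (by rcases hε with rfl | rfl <;> ring)
      (by rcases hε with rfl | rfl <;> ring) (by rcases hε with rfl | rfl <;> ring) ?_
      (by ring) (by ring) (by ring) (by rcases hε with rfl | rfl <;> ring)
    exact hlast (-1) (by norm_num) ε hε _ _ rfl (by push_cast; ring)
  · refine key (M + a) a (ε * a) 0 _ _ _ _ (by ring) (by rcases hε with rfl | rfl <;> ring)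
      (by rcases hε with rfl | rfl <;> ring) (by rcases hε with rfl | rfl <;> ring) ?_
      (by ring) (by ring) (by ring) (by rcases hε with rfl | rfl <;> ring)
    exact hlast 1 (by norm_num) ε hε _ _ rfl (by push_cast; ring)

end Final
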